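/- **Model.** A rigid load of mass $m_L>0$ and positive-definite inertia matrix $J_L$ is carried by four quadrotors of mass $m_Q>0$ and positive-definite inertia matrix $J_Q$ through inelastic massless cables of length $L>0$, attached to the load at body-fixed points $r_1,\dots,r_4\in\mathbb R^3$; $g>0$. Write $\hat a b=a\times b$, let $\vee$ be the inverse of $\hat{\ }$, $m_{\rm eff}=4m_Q+m_L$, $J_{\rm eff}=J_L-\sum_j m_Q\hat r_j^2$. The state is $x_L,v_L\in\mathbb R^3$, $R_L\in SO(3)$, $\Omega_L\in\mathbb R^3$, cable directions $q_j\in S^2$ and $\omega_j\perp q_j$, quadrotor attitudes $R_j\in SO(3)$ and $\Omega_j\in\mathbb R^3$, and the reduced model with inputs $u_j,M_j\in\mathbb R^3$ is $$\dot x_L=v_L,\quad \dot R_L=R_L\hat\Omega_L,\quad \dot q_j=\omega_j\times q_j,\quad \dot R_j=R_j\hat\Omega_j,\quad J_Q\dot\Omega_j=J_Q\Omega_j\times\Omega_j+M_j,$$ $$m_{\rm eff}(\dot v_L+ge_3)=\sum_{j=1}^4\big(u_j-m_QR_L(\hat\Omega_L^2+\dot{\hat\Omega}_L)r_j+m_QL\ddot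 q_j\big),$$ $$J_{\rm eff}\dot\Omega_L+\hat\Omega_LJ_{\rm eff}\Omega_L=\sum_{j=1}^4 m_Q\hat r_jR_L^T\big(-ge_3-\dot v_L+L\ddot q_j+\tfrac1{m_Q}u_j\big),$$ $$\dot\omega_j=\tfrac1L\hat q_j\big(\dot v_L+R_L(\hat\Omega_L^2+\dot{\hat\Omega}_L)r_j+ge_3-\tfrac1{m_Q}u_j\big).$$ **Errors and controller.** Let $\tilde x_L,\tilde R_L,\tilde\Omega_L$ be a smooth desired load motion ($\dot{\tilde R}_L=\tilde R_L\hat{\tilde\Omega}_L$, $\tilde v_L=\dot{\tilde x}_L$). Put $e_{x_L}=x_L-\tilde x_L$, $e_{v_L}=v_L-\tilde v_L$, $e_{R_L}=\frac12(\tilde R_L^TR_L-R_L^T\tilde R_L)^\vee$, $w=R_L^T\tilde R_L\tilde\Omega_L$, $e_{\Omega_L}=\Omega_L-w$. Let $\mathcal P\in\mathbb R^{6\times12}$ have block rows $(I,I,I,I)$ and $(\hat r_1,\dots,\hat r_4)$, and assume $\operatorname{rank}\mathcal P=6$. For gains $k_{x_L},k_{v_L},k_{R_L},k_{\Omega_L},k_q,k_\omega$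 set $$\tilde F=m_L(-k_{x_L}e_{x_L}-k_{v_L}e_{v_L}+\dot{\tilde v}_L+ge_3),\qquad \tilde M=-k_{R_L}e_{R_L}-k_{\Omega_L}e_{\Omega_L}+\hat wJ_Lw+J_LR_L^T\tilde R_L\dot{\tilde\Omega}_L,$$ $$(\tilde\mu_1,\dots,\tilde\mu_4)^T=\operatorname{diag}(R_L,\dots,R_L)\,\mathcal P^T(\mathcal P\mathcal P^T)^{-1}(R_L^T\tilde F,\ \tilde M)^T,$$ the minimum-norm solution of $\sum_j\tilde\mu_j=\tilde F$, $\sum_j\hat r_jR_L^T\tilde\mu_j=\tilde M$, and $\tilde q_j=-\tilde\mu_j/\|\tilde\mu_j\|$, $\tilde\omega_j=\tilde q_j\times\dot{\tilde q}_j$, $e_{q_j}=\tilde q_j\times q_j$, $e_{\omega_j}=\omega_j+\hat q_j^2\tilde\omega_j$, $\mu_j=q_jq_j^T\tilde\mu_j$, $a_j=\dot v_L+ge_3+R_L\hat\Omega_L^2r_j-R_L\hat r_j\dot\Omega_L$. The control is $u_j=u_j^\parallel+u_j^\perp$ with $$u_j^\parallel=\mu_j+m_QL\|\omega_j\|^2q_j+m_Qq_jq_j^Ta_j,$$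 $$u_j^\perp=m_QL\,\hat q_j\big(-k_qe_{q_j}-k_\omega e_{\omega_j}-(q_j^T\tilde\omega_j)\dot q_j-\hat q_j^2\dot{\tilde\omega}_j\big)-m_Q\hat q_j^2a_j .$$ The $M_j$ are arbitrary. A closed-loop motion is one along which no $\tilde\mu_j$ vanishes. Let $\Psi_{q_j}=1-\tilde q_j^Tq_j$ and $\Psi_{R_L}=\frac12\operatorname{Tr}(I-\tilde R_L^TR_L)$. **Assumptions on the desired motion.** For $t\ge0$: $\dot{\tilde v}_L,\ddot{\tilde v}_L,\tilde\Omega_L,\dot{\tilde\Omega}_L,\ddot{\tilde\Omega}_L$ are bounded, and the norms of the vectors $\tilde\mu_j$ belonging to the desired motion itself (zero load errors) are bounded away from $0$. **Theorem.** There is $\alpha_0>0$ such that for all $\psi_{q_1},\dots,\psi_{q_4}\in(0,1)$ with $\alpha_j:=\sqrt{\psi_{q_j}(2-\psi_{q_j})}<\alpha_0$, and all $\psi_{R_L}\in(0,1)$, $e_{x_{\max}}>0$, there are positive gains $k_{x_L},k_{v_L},k_{R_L},k_{\Omega_L},k_q,k_\omega$ such that the zero tracking error is an exponentially stable equilibrium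 of the closed loop: 1. some closed-loop motion on an open time interval containing $[0,\infty)$ has zero tracking error, $\Psi_{R_L}=0$ and $\Psi_{q_j}=0$ for all $t\ge0$; 2. there are $\delta,C,\lambda>0$ such that for every closed-loop motion on an open interval and every $t_0\ge0$ in it at which $\Psi_{q_j}<\psi_{q_j}$ and $\|e_{\omega_j}\|<\delta$ for all $j$, $\Psi_{R_L}<\psi_{R_L}$ and $\|e_{x_L}\|,\|e_{v_L}\|,\|e_{R_L}\|,\|e_{\Omega_L}\|<\delta$, the error $e=(e_{x_L},e_{v_L},e_{R_L},e_{\Omega_L},e_{q_1},e_{\omega_1},\dots,e_{q_4},e_{\omega_4})$ satisfies, for all later times $t$ of the motion, $$\|e(t)\|\le C e^{-\lambda(t-t_0)}\|e(t_0)\|,\quad \|e_{x_L}(t)\|<e_{x_{\max}},\quad \Psi_{R_L}(t)<\psi_{R_L},\quad \Psi_{q_j}(t)<1\ (j=1,\dots,4).$$ -/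

import Mathlib

open Matrix

noncomputable section

namespace LoadTransport

/-- Vectors of `ℝ³`, as coordinate functions; Euclidean lengths are taken with `nrm`. -/
abbrev V3 := Fin 3 → ℝ

/-- Real `3 × 3` matrices. -/
abbrev M3 := Matrix (Fin 3) (Fin 3) ℝ

/-- The Euclidean norm of a vector of `ℝ³`. -/
def nrm (w : V3) : ℝ := Real.sqrt (w ⬝ᵥ w)

/-- The vertical unit vector, pointing upwards. -/
def e3 : V3 := ![0, 0, 1]

/-- The hat isomorphism from `ℝ³` to the skew-symmetric matrices. -/
def hat (w : V3) : M3 :=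
  !![0, -w 2, w 1; w 2, 0, -w 0; -w 1, w 0, 0]

/-- The vee map, the inverse of `hat` on skew-symmetric matrices. -/
def vee (A : M3) : V3 := ![A 2 1, A 0 2, A 1 0]

/-- The rotation group `SO(3)`. -/
def SO3 : Set M3 := {A | A ∈ Matrix.specialOrthogonalGroup (Fin 3) ℝ}

/-- The physical data: a rigid load (mass `mL`, inertia matrix `JL`) hanging from four identical
quadrotors (mass `mQ`, inertia matrix `JQ`) by cables of length `L`; the `j`-th cable is attached
to the load at the body-fixed point `r j`; `g` is the gravitational acceleration. -/
structure Params where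
  mL : ℝ
  mQ : ℝ
  L : ℝ
  g : ℝ
  JL : M3
  JQ : M3
  r : Fin 4 → V3
  mL_pos : 0 < mL
  mQ_pos : 0 < mQ
  L_pos : 0 < L
  g_pos : 0 < g
  JL_posDef : JL.PosDef
  JQ_posDef : JQ.PosDef

namespace Params

/-- Total mass. -/
def meff (S : Params) : ℝ := 4 * S.mQ + S.mL

/-- Effective inertia matrix `J_L - ∑ m_Q r̂_j²`. -/
def Jeff (S : Params) : M3 := S.JL - ∑ j, S.mQ • (hat (S.r j) * hat (S.r j))

/-- The `6 × 12` grasp matrix, with blocks `I` in the first and `r̂_j` in the second row. -/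
def grasp (S : Params) : Matrix (Fin 3 ⊕ Fin 3) (Fin 4 × Fin 3) ℝ :=
  Matrix.of fun i p => Sum.elim (fun a => (1 : M3) a p.2) (fun a => hat (S.r p.1) a p.2) i

/-- The `j`-th block of `diag(R,…,R) 𝒫ᵀ (𝒫 𝒫ᵀ)⁻¹ (Rᵀ F, M)`, the distribution of minimal
Euclidean norm of the force `F` and the moment `M` over the four cables. -/
def distribute (S : Params) (R : M3) (F M : V3) (j : Fin 4) : V3 :=
  R *ᵥ fun b =>
    (S.graspᵀ *ᵥ ((S.grasp * S.graspᵀ)⁻¹ *ᵥ Sum.elim (Rᵀ *ᵥ F) M)) (j, b)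

end Params

/-- A smooth desired motion of the load: position `x`, attitude `R`, body angular velocity `Ω`. -/
structure Reference where
  x : ℝ → V3
  R : ℝ → M3
  Ω : ℝ → V3
  x_smooth : ContDiff ℝ (⊤ : ℕ∞) x
  R_smooth : ∀ a b, ContDiff ℝ (⊤ : ℕ∞) fun t => R t a b
  Ω_smooth : ContDiff ℝ (⊤ : ℕ∞) Ω
  R_mem : ∀ t, R t ∈ SO3
  R_kin : ∀ t a b, HasDerivAt (fun s => R s a b) ((R t * hat (Ω t)) a b) t

namespace Reference

/-- Desired velocity. -/
def v (D : Reference) (t : ℝ) : V3 := deriv D.x t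

/-- The cable forces that the desired motion itself requires (all tracking errors zero). -/
def cableForce (S : Params) (D : Reference) (j : Fin 4) (t : ℝ) : V3 :=
  S.distribute (D.R t) (S.mL • (deriv D.v t + S.g • e3))
    (hat (D.Ω t) *ᵥ (S.JL *ᵥ D.Ω t) + S.JL *ᵥ deriv D.Ω t) j

/-- From time `0` on, the desired motion has bounded acceleration, jerk, angular velocity and first
two derivatives of the angular velocity. -/
def IsBounded (D : Reference) : Prop :=
  ∃ C : ℝ, ∀ t, 0 ≤ t →
    nrm (deriv D.v t) ≤ C ∧ nrm (deriv (deriv D.v) t) ≤ C ∧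
    nrm (D.Ω t) ≤ C ∧ nrm (deriv D.Ω t) ≤ C ∧ nrm (deriv (deriv D.Ω) t) ≤ C

/-- From time `0` on, the desired motion keeps each required cable force bounded away from zero, so
that the desired cable directions are defined, uniformly in time. -/
def IsTaut (S : Params) (D : Reference) : Prop :=
  ∃ b : ℝ, 0 < b ∧ ∀ t, 0 ≤ t → ∀ j, b ≤ nrm (D.cableForce S j t)

end Reference

/-- The controller gains. -/
structure Gains where
  kx : ℝ
  kv : ℝ
  kR : ℝ
  kΩ : ℝ
  kq : ℝ
  kω : ℝ

/-- All gains are positive. -/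
def Gains.Positive (K : Gains) : Prop :=
  0 < K.kx ∧ 0 < K.kv ∧ 0 < K.kR ∧ 0 < K.kΩ ∧ 0 < K.kq ∧ 0 < K.kω

/-- A motion of the reduced system: load position, velocity, attitude and body angular velocity,
cable directions (from quadrotor to load) and their angular velocities, quadrotor attitudes and
body angular velocities. -/
structure Motion where
  x : ℝ → V3
  v : ℝ → V3
  R : ℝ → M3
  Ω : ℝ → V3
  q : Fin 4 → ℝ → V3
  ω : Fin 4 → ℝ → V3
  Rq : Fin 4 → ℝ → M3
  Ωq : Fin 4 → ℝ → V3

/-- At time `t` the motion `y` lies in the state space and has differentiable state components. -/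
structure Motion.IsState (y : Motion) (t : ℝ) : Prop where
  R_mem : y.R t ∈ SO3
  q_unit : ∀ j, y.q j t ⬝ᵥ y.q j t = 1
  ω_perp : ∀ j, y.q j t ⬝ᵥ y.ω j t = 0
  Rq_mem : ∀ j, y.Rq j t ∈ SO3
  v_diff : DifferentiableAt ℝ y.v t
  Ω_diff : DifferentiableAt ℝ y.Ω t
  ω_diff : ∀ j, DifferentiableAt ℝ (y.ω j) t
  Ωq_diff : ∀ j, DifferentiableAt ℝ (y.Ωq j) t

/-- `R_L (Ω̂_L² + dΩ̂_L/dt) r_j`. -/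
def Motion.bodyAcc (S : Params) (y : Motion) (j : Fin 4) (t : ℝ) : V3 :=
  (y.R t * (hat (y.Ω t) * hat (y.Ω t) + hat (deriv y.Ω t))) *ᵥ S.r j

/-- The equations of motion of the reduced (inelastic-cable) model on a time set `I`, with thrust
vectors `u j` and quadrotor moments `τ j` as inputs. -/
structure Motion.SolvesReduced (S : Params) (y : Motion) (u τ : Fin 4 → ℝ → V3) (I : Set ℝ) :
    Prop where
  state : ∀ t ∈ I, y.IsState t
  pos_kin : ∀ t ∈ I, HasDerivAt y.x (y.v t) t
  att_kin : ∀ t ∈ I, ∀ a b, HasDerivAt (fun s => y.R s a b) ((y.R t * hat (y.Ω t)) a b) t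
  cable_kin : ∀ t ∈ I, ∀ j, HasDerivAt (y.q j) (y.ω j t ⨯₃ y.q j t) t
  pos_dyn : ∀ t ∈ I, S.meff • (deriv y.v t + S.g • e3) =
    ∑ j, (u j t - S.mQ • y.bodyAcc S j t + (S.mQ * S.L) • deriv (deriv (y.q j)) t)
  att_dyn : ∀ t ∈ I, S.Jeff *ᵥ deriv y.Ω t + hat (y.Ω t) *ᵥ (S.Jeff *ᵥ y.Ω t) =
    ∑ j, S.mQ • ((hat (S.r j) * (y.R t)ᵀ) *ᵥ
      (-(S.g • e3) - deriv y.v t + S.L • deriv (deriv (y.q j)) t + (1 / S.mQ) • u j t))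
  cable_dyn : ∀ t ∈ I, ∀ j, deriv (y.ω j) t =
    (1 / S.L) • (hat (y.q j t) *ᵥ
      (deriv y.v t + y.bodyAcc S j t + S.g • e3 - (1 / S.mQ) • u j t))
  quad_kin : ∀ t ∈ I, ∀ j a b,
    HasDerivAt (fun s => y.Rq j s a b) ((y.Rq j t * hat (y.Ωq j t)) a b) t
  quad_dyn : ∀ t ∈ I, ∀ j,
    S.JQ *ᵥ deriv (y.Ωq j) t = (S.JQ *ᵥ y.Ωq j t) ⨯₃ y.Ωq j t + τ j t

section Control

variable (S : Params) (D : Reference) (K : Gains) (y : Motion)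

/-- Load position error. -/
def errX (t : ℝ) : V3 := y.x t - D.x t

/-- Load velocity error. -/
def errV (t : ℝ) : V3 := y.v t - D.v t

/-- Load attitude error. -/
def errR (t : ℝ) : V3 :=
  vee ((1 / 2 : ℝ) • ((D.R t)ᵀ * y.R t - (y.R t)ᵀ * D.R t))

/-- The desired angular velocity, in the body frame of the load: `R_Lᵀ R̃_L Ω̃_L`. -/
def desΩ (t : ℝ) : V3 := ((y.R t)ᵀ * D.R t) *ᵥ D.Ω t

/-- Load angular velocity error. -/
def errΩ (t : ℝ) : V3 := y.Ω t - desΩ D y t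

/-- Desired total force on the load. -/
def desForce (t : ℝ) : V3 :=
  S.mL • (-(K.kx • errX D y t) - K.kv • errV D y t + deriv D.v t + S.g • e3)

/-- Desired total moment on the load. -/
def desMoment (t : ℝ) : V3 :=
  -(K.kR • errR D y t) - K.kΩ • errΩ D y t + hat (desΩ D y t) *ᵥ (S.JL *ᵥ desΩ D y t)
    + (S.JL * (y.R t)ᵀ * D.R t) *ᵥ deriv D.Ω t

/-- The auxiliary inputs `μ̃_j` of minimal norm. -/
def desMu (j : Fin 4) (t : ℝ) : V3 :=
  S.distribute (y.R t) (desForce S D K y t) (desMoment S D K y t) j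

/-- Desired cable direction `q̃_j = -μ̃_j / ‖μ̃_j‖`. -/
def desQ (j : Fin 4) (t : ℝ) : V3 :=
  -((1 / nrm (desMu S D K y j t)) • desMu S D K y j t)

/-- Desired cable angular velocity `ω̃_j = q̃_j × dq̃_j/dt`. -/
def desω (j : Fin 4) (t : ℝ) : V3 := desQ S D K y j t ⨯₃ deriv (desQ S D K y j) t

/-- Cable direction error. -/
def errQ (j : Fin 4) (t : ℝ) : V3 := desQ S D K y j t ⨯₃ y.q j t

/-- Cable angular velocity error. -/
def errω (j : Fin 4) (t : ℝ) : V3 :=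
  y.ω j t + (hat (y.q j t) * hat (y.q j t)) *ᵥ desω S D K y j t

/-- Configuration error `Ψ_{q_j} = 1 - q̃_jᵀ q_j` of the cable direction. -/
def psiQ (j : Fin 4) (t : ℝ) : ℝ := 1 - desQ S D K y j t ⬝ᵥ y.q j t

/-- Configuration error `Ψ_{R_L} = ½ Tr(I - R̃_Lᵀ R_L)` of the load attitude. -/
def psiR (t : ℝ) : ℝ := (1 / 2) * Matrix.trace (1 - (D.R t)ᵀ * y.R t)

/-- Euclidean norm of the whole tracking error
`(e_{x_L}, e_{v_L}, e_{R_L}, e_{Ω_L}, e_{q_j}, e_{ω_j})`. -/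
def errNorm (t : ℝ) : ℝ :=
  Real.sqrt (nrm (errX D y t) ^ 2 + nrm (errV D y t) ^ 2 + nrm (errR D y t) ^ 2
    + nrm (errΩ D y t) ^ 2
    + ∑ j, (nrm (errQ S D K y j t) ^ 2 + nrm (errω S D K y j t) ^ 2))

/-- The acceleration `a_j` of the attachment point of cable `j`, plus gravity. -/
def attachAcc (j : Fin 4) (t : ℝ) : V3 :=
  deriv y.v t + S.g • e3 + (y.R t * (hat (y.Ω t) * hat (y.Ω t))) *ᵥ S.r j
    - (y.R t * hat (S.r j)) *ᵥ deriv y.Ω t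

/-- The projected auxiliary input `μ_j = q_j q_jᵀ μ̃_j`. -/
def mu (j : Fin 4) (t : ℝ) : V3 := (y.q j t ⬝ᵥ desMu S D K y j t) • y.q j t

/-- The component of the control along the cable. -/
def uPar (j : Fin 4) (t : ℝ) : V3 :=
  mu S D K y j t + (S.mQ * S.L * nrm (y.ω j t) ^ 2) • y.q j t
    + (S.mQ * (y.q j t ⬝ᵥ attachAcc S y j t)) • y.q j t

/-- The component of the control normal to the cable. -/
def uPerp (j : Fin 4) (t : ℝ) : V3 :=
  (S.mQ * S.L) • (hat (y.q j t) *ᵥ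
      (-(K.kq • errQ S D K y j t) - K.kω • errω S D K y j t
        - (y.q j t ⬝ᵥ desω S D K y j t) • deriv (y.q j) t
        - (hat (y.q j t) * hat (y.q j t)) *ᵥ deriv (desω S D K y j) t))
    - S.mQ • ((hat (y.q j t) * hat (y.q j t)) *ᵥ attachAcc S y j t)

/-- `y` is a motion of the closed loop on the time set `I`: the controller is defined along `y`
(the `μ̃_j` do not vanish, and the desired cable directions and angular velocities have the
derivatives that the controller uses), and `y` solves the reduced model with
`u_j = u_j^∥ + u_j^⊥` (and some quadrotor moments, which do not enter the other equations). -/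
structure IsClosedLoop (I : Set ℝ) : Prop where
  mu_ne : ∀ t ∈ I, ∀ j, desMu S D K y j t ≠ 0
  desQ_diff : ∀ t ∈ I, ∀ j, DifferentiableAt ℝ (desQ S D K y j) t
  desω_diff : ∀ t ∈ I, ∀ j, DifferentiableAt ℝ (desω S D K y j) t
  solves : ∃ τ : Fin 4 → ℝ → V3,
    y.SolvesReduced S (fun j t => uPar S D K y j t + uPerp S D K y j t) τ I

/-- The zero tracking error is an equilibrium of the closed loop: some closed-loop motion, defined
on an open time interval containing `[0, ∞)`, has zero tracking error at all times `t ≥ 0`. -/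
def ZeroIsEquilibrium : Prop :=
  ∃ (y : Motion) (I : Set ℝ), IsOpen I ∧ I.OrdConnected ∧ Set.Ici 0 ⊆ I ∧
    IsClosedLoop S D K y I ∧
    ∀ t, 0 ≤ t → errNorm S D K y t = 0 ∧ psiR D y t = 0 ∧ ∀ j, psiQ S D K y j t = 0

/-- Uniform exponential stability of the zero tracking error, on the domain
`‖e_{x_L}‖ < eMax`, `Ψ_{R_L} < ψR`, `Ψ_{q_j} < ψq j`: for every closed-loop motion whose initial
cable errors satisfy `Ψ_{q_j} < ψq j` and whose other initial errors are small enough, the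
tracking error decays exponentially for as long as the motion exists, and the motion stays where
the errors vanish only at the desired configuration. -/
def ZeroIsExpStable (ψq : Fin 4 → ℝ) (ψR eMax : ℝ) : Prop :=
  ∃ δ C lam : ℝ, 0 < δ ∧ 0 < C ∧ 0 < lam ∧
    ∀ (y : Motion) (I : Set ℝ), IsOpen I → I.OrdConnected → IsClosedLoop S D K y I →
    ∀ t₀ ∈ I, 0 ≤ t₀ →
      (∀ j, psiQ S D K y j t₀ < ψq j) → psiR D y t₀ < ψR →
      nrm (errX D y t₀) < δ → nrm (errV D y t₀) < δ →
      nrm (errR D y t₀) < δ → nrm (errΩ D y t₀) < δ →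
      (∀ j, nrm (errω S D K y j t₀) < δ) →
    ∀ t ∈ I, t₀ ≤ t →
      errNorm S D K y t ≤ C * Real.exp (-lam * (t - t₀)) * errNorm S D K y t₀ ∧
      nrm (errX D y t) < eMax ∧ psiR D y t < ψR ∧ ∀ j, psiQ S D K y j t < 1

end Control

end LoadTransport

end

open LoadTransport

/-! The control makes the inertia of quadrotors and cables disappear from the load equations. Once
the cable accelerations are eliminated (`force_balance_iff`, `moment_balance_iff`), the load obeys
Newton-Euler equations driven by the forces `μ_j` alone. Replacing `μ_j` by `μ̃_j` would give exact
PD error dynamics; the disturbance `μ_j - μ̃_j` has length `‖μ̃_j‖ ‖e_{q_j}‖` (`nrm_mu_sub`), so it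
vanishes with the cable errors.

The cable errors have an energy `½‖e_ω‖² + k_q Ψ_q` with rate `-k_ω ‖e_ω‖²`, whatever the load does.
Hence `Ψ_q < 1` persists (`psiQ_lt_one`). Exponential decay needs in addition a cross term and a
bound on `ω̃_j` (`hasDerivAt_cableLyap`). Such a bound holds in a tube of small load errors, where
`μ̃_j` stays away from zero and varies at a bounded rate (`exists_nrm_desω_le`).

The load gains are fixed at 1 and the cable gains are `k_ω = k`, `k_q = k²`. Since `μ̃_j` does not
involve the cable gains, the bounds on `ω̃_j` and on the coupling of load and cables
(`exists_loadLyap`) do not depend on `k`. The total function is the load Lyapunov function plus `ε /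
k²` times the sum of the cable functions. With this weight the initial cable share is of order `ε`
however large `k` is, while the decay of the cable share grows like `k`. So `ε` is chosen to fit the
tube, then `k` to absorb the coupling (`composite_rate_le`). A first-exit argument keeps the motion
in the tube, where the total function decays exponentially (`zeroIsExpStable_of_loadLyap`).

The load attitude is measured by `Ψ_R`, not by `e_R`, because `e_R` also vanishes at rotations by
`π`; as long as `Ψ_R ≤ 1` the quantities `Ψ_R` and `‖e_R‖²` are equivalent.

The equilibrium is the desired motion itself, with cables along the forces it requires
(`isClosedLoop_refMotion`). -/

namespace LoadTransport

/-! ### Euclidean geometry of `ℝ³`. -/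

section Vectors

theorem hat_mulVec (a b : V3) : hat a *ᵥ b = a ⨯₃ b := by
  ext i; fin_cases i <;> simp [hat, cross_apply, mulVec, dotProduct, Fin.sum_univ_three] <;> ring

theorem dot_self_nonneg (a : V3) : 0 ≤ a ⬝ᵥ a := by
  simp only [dotProduct, Fin.sum_univ_three]
  nlinarith [mul_self_nonneg (a 0), mul_self_nonneg (a 1), mul_self_nonneg (a 2)]

theorem nrm_nonneg (a : V3) : 0 ≤ nrm a := Real.sqrt_nonneg _

theorem nrm_sq (a : V3) : nrm a ^ 2 = a ⬝ᵥ a := Real.sq_sqrt (dot_self_nonneg a)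

theorem nrm_le_of_dot_le {a : V3} {c : ℝ} (hc : 0 ≤ c) (h : a ⬝ᵥ a ≤ c ^ 2) : nrm a ≤ c :=
  Real.sqrt_le_iff.2 ⟨hc, h⟩

theorem cauchy_sq (a b : V3) : (a ⬝ᵥ b) ^ 2 ≤ (a ⬝ᵥ a) * (b ⬝ᵥ b) := by
  simp only [dotProduct, Fin.sum_univ_three]
  nlinarith [sq_nonneg (a 0 * b 1 - a 1 * b 0), sq_nonneg (a 0 * b 2 - a 2 * b 0),
    sq_nonneg (a 1 * b 2 - a 2 * b 1)]

theorem abs_dot_le (a b : V3) : |a ⬝ᵥ b| ≤ nrm a * nrm b := by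
  apply abs_le_of_sq_le_sq _ (mul_nonneg (nrm_nonneg _) (nrm_nonneg _))
  rw [mul_pow, nrm_sq, nrm_sq]; exact cauchy_sq a b

theorem dot_le (a b : V3) : a ⬝ᵥ b ≤ nrm a * nrm b := (le_abs_self _).trans (abs_dot_le a b)

theorem neg_dot_le (a b : V3) : -(a ⬝ᵥ b) ≤ nrm a * nrm b :=
  (neg_le_abs _).trans (abs_dot_le a b)

theorem nrm_cross_sq (a b : V3) :
    nrm (a ⨯₃ b) ^ 2 = nrm a ^ 2 * nrm b ^ 2 - (a ⬝ᵥ b) ^ 2 := by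
  simp only [nrm_sq]; rw [cross_dot_cross, dotProduct_comm b a]; ring

theorem nrm_cross_le (a b : V3) : nrm (a ⨯₃ b) ≤ nrm a * nrm b := by
  apply le_of_sq_le_sq _ (mul_nonneg (nrm_nonneg _) (nrm_nonneg _))
  rw [nrm_cross_sq, mul_pow]; nlinarith [sq_nonneg (a ⬝ᵥ b)]

theorem nrm_smul (c : ℝ) (a : V3) : nrm (c • a) = |c| * nrm a := by
  unfold nrm
  rw [smul_dotProduct, dotProduct_smul, smul_eq_mul, smul_eq_mul, ← mul_assoc,
    Real.sqrt_mul (mul_self_nonneg c), Real.sqrt_mul_self_eq_abs]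

theorem nrm_neg (a : V3) : nrm (-a) = nrm a := by simp [nrm]

theorem nrm_zero : nrm 0 = 0 := by simp [nrm]

theorem nrm_add_le (a b : V3) : nrm (a + b) ≤ nrm a + nrm b := by
  apply nrm_le_of_dot_le (add_nonneg (nrm_nonneg _) (nrm_nonneg _))
  have := dot_le a b
  rw [add_sq, nrm_sq, nrm_sq, add_dotProduct, dotProduct_add, dotProduct_add, dotProduct_comm b a]
  linarith

theorem nrm_sub_le (a b : V3) : nrm (a - b) ≤ nrm a + nrm b := by
  rw [sub_eq_add_neg, ← nrm_neg b]; exact nrm_add_le _ _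

theorem nrm_sum_le {ι : Type*} (s : Finset ι) (f : ι → V3) :
    nrm (∑ i ∈ s, f i) ≤ ∑ i ∈ s, nrm (f i) := by
  classical
  induction s using Finset.induction_on with
  | empty => simp [nrm_zero]
  | insert i s hi ih =>
    rw [Finset.sum_insert hi, Finset.sum_insert hi]
    exact (nrm_add_le _ _).trans (by linarith)

theorem abs_apply_le_nrm (a : V3) (i : Fin 3) : |a i| ≤ nrm a := by
  apply abs_le_of_sq_le_sq _ (nrm_nonneg _)
  rw [nrm_sq]
  simp only [dotProduct, Fin.sum_univ_three]
  fin_cases i <;> simp <;> nlinarith [sq_nonneg (a 0), sq_nonneg (a 1), sq_nonneg (a 2)]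

theorem nrm_le_sum_abs (a : V3) : nrm a ≤ ∑ i, |a i| := by
  apply nrm_le_of_dot_le (by positivity)
  simp only [dotProduct, Fin.sum_univ_three]
  nlinarith [abs_nonneg (a 0), abs_nonneg (a 1), abs_nonneg (a 2), sq_abs (a 0), sq_abs (a 1),
    sq_abs (a 2), mul_nonneg (abs_nonneg (a 0)) (abs_nonneg (a 1)),
    mul_nonneg (abs_nonneg (a 0)) (abs_nonneg (a 2)),
    mul_nonneg (abs_nonneg (a 1)) (abs_nonneg (a 2))]

theorem nrm_pos {a : V3} (h : a ≠ 0) : 0 < nrm a := by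
  rcases (nrm_nonneg a).lt_or_eq with h' | h'
  · exact h'
  · exfalso; apply h; ext i
    have := abs_apply_le_nrm a i
    rw [← h'] at this
    exact abs_nonpos_iff.1 this

/-- A matrix acts as a bounded operator for the Euclidean norm. -/
theorem exists_nrm_mulVec_le (A : M3) : ∃ c : ℝ, 0 < c ∧ ∀ v, nrm (A *ᵥ v) ≤ c * nrm v := by
  refine ⟨(∑ i, ∑ j, |A i j|) + 1, by positivity, fun v => (nrm_le_sum_abs _).trans ?_⟩
  have h : ∀ i, |(A *ᵥ v) i| ≤ (∑ j, |A i j|) * nrm v := by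
    intro i
    rw [Finset.sum_mul, mulVec, dotProduct]
    refine (Finset.abs_sum_le_sum_abs _ _).trans (Finset.sum_le_sum fun j _ => ?_)
    rw [abs_mul]
    exact mul_le_mul_of_nonneg_left (abs_apply_le_nrm v j) (abs_nonneg _)
  calc ∑ i, |(A *ᵥ v) i| ≤ ∑ i, (∑ j, |A i j|) * nrm v := Finset.sum_le_sum fun i _ => h i
    _ = (∑ i, ∑ j, |A i j|) * nrm v := by rw [Finset.sum_mul]
    _ ≤ _ := by nlinarith [nrm_nonneg v]

/-- A positive definite matrix is bounded below by a positive multiple of the identity. -/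
theorem exists_le_dot_mulVec {A : M3} (hA : A.PosDef) :
    ∃ c : ℝ, 0 < c ∧ ∀ v : V3, c * nrm v ^ 2 ≤ v ⬝ᵥ (A *ᵥ v) := by
  have hcont : Continuous fun v : V3 => v ⬝ᵥ (A *ᵥ v) := by
    simp only [dotProduct, mulVec]; fun_prop
  have hn : Continuous fun v : V3 => v ⬝ᵥ v := by simp only [dotProduct]; fun_prop
  have hK : IsCompact {v : V3 | v ⬝ᵥ v = 1} := by
    refine Metric.isCompact_of_isClosed_isBounded (isClosed_eq hn continuous_const) ?_
    refine isBounded_iff_forall_norm_le.2 ⟨1, fun v hv => ?_⟩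
    refine (pi_norm_le_iff_of_nonneg zero_le_one).2 fun i => (abs_apply_le_nrm v i).trans ?_
    exact nrm_le_of_dot_le zero_le_one (by rw [one_pow]; exact le_of_eq hv)
  have hne : {v : V3 | v ⬝ᵥ v = 1}.Nonempty := ⟨e3, by simp [e3, dotProduct, Fin.sum_univ_three]⟩
  -- The constant is the minimum of the quadratic form on the unit sphere; homogeneity extends the
  -- bound to all vectors.
  obtain ⟨u, hu, hmin⟩ := hK.exists_isMinOn hne hcont.continuousOn
  have hu0 : u ≠ 0 := by rintro rfl; simp at hu
  have hpos : 0 < u ⬝ᵥ (A *ᵥ u) := by simpa using hA.dotProduct_mulVec_pos hu0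
  refine ⟨_, hpos, fun v => ?_⟩
  by_cases hv : v = 0
  · subst hv; simp [nrm_zero]
  have hnv := nrm_pos hv
  have h1 : ((nrm v)⁻¹ • v) ⬝ᵥ ((nrm v)⁻¹ • v) = 1 := by
    rw [smul_dotProduct, dotProduct_smul, ← nrm_sq, smul_eq_mul, smul_eq_mul]; field_simp
  have h2 : u ⬝ᵥ (A *ᵥ u) ≤ ((nrm v)⁻¹ • v) ⬝ᵥ (A *ᵥ ((nrm v)⁻¹ • v)) := hmin h1
  rw [mulVec_smul, smul_dotProduct, dotProduct_smul, smul_eq_mul, smul_eq_mul] at h2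
  calc _ ≤ ((nrm v)⁻¹ * ((nrm v)⁻¹ * (v ⬝ᵥ (A *ᵥ v)))) * nrm v ^ 2 := by gcongr
    _ = _ := by field_simp

end Vectors

/-! ### Product rules for vectors and matrices, entry by entry. -/

section Derivatives

variable {f g : ℝ → V3} {f' g' : V3} {t : ℝ}

theorem hasDerivAt_dot (hf : HasDerivAt f f' t) (hg : HasDerivAt g g' t) :
    HasDerivAt (fun s => f s ⬝ᵥ g s) (f' ⬝ᵥ g t + f t ⬝ᵥ g') t := by
  have hf := hasDerivAt_pi.1 hf
  have hg := hasDerivAt_pi.1 hg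
  simp only [dotProduct, ← Finset.sum_add_distrib]
  exact HasDerivAt.fun_sum fun i _ => (hf i).mul (hg i)

theorem hasDerivAt_cross (hf : HasDerivAt f f' t) (hg : HasDerivAt g g' t) :
    HasDerivAt (fun s => f s ⨯₃ g s) (f' ⨯₃ g t + f t ⨯₃ g') t := by
  have hf := hasDerivAt_pi.1 hf
  have hg := hasDerivAt_pi.1 hg
  refine hasDerivAt_pi.2 fun i => ?_
  fin_cases i <;> simp only [cross_apply]
  · exact (((hf 1).mul (hg 2)).sub ((hf 2).mul (hg 1))).congr_deriv (by simp; ring)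
  · exact (((hf 2).mul (hg 0)).sub ((hf 0).mul (hg 2))).congr_deriv (by simp; ring)
  · exact (((hf 0).mul (hg 1)).sub ((hf 1).mul (hg 0))).congr_deriv (by simp; ring)

theorem hasDerivAt_mulVec {A : ℝ → M3} {A' : M3}
    (hA : ∀ a b, HasDerivAt (fun s => A s a b) (A' a b) t) (hf : HasDerivAt f f' t) :
    HasDerivAt (fun s => A s *ᵥ f s) (A' *ᵥ f t + A t *ᵥ f') t := by
  have hf := hasDerivAt_pi.1 hf
  refine hasDerivAt_pi.2 fun i => ?_
  simp only [mulVec, dotProduct, Pi.add_apply, ← Finset.sum_add_distrib]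
  exact HasDerivAt.fun_sum fun j _ => (hA i j).mul (hf j)

theorem hasDerivAt_const_mulVec (A : M3) (hf : HasDerivAt f f' t) :
    HasDerivAt (fun s => A *ᵥ f s) (A *ᵥ f') t := by
  have := hasDerivAt_mulVec (A := fun _ => A) (A' := 0) (fun a b => hasDerivAt_const t (A a b)) hf
  simpa using this

theorem hasDerivAt_matMul {A B : ℝ → M3} {A' B' : M3}
    (hA : ∀ a b, HasDerivAt (fun s => A s a b) (A' a b) t)
    (hB : ∀ a b, HasDerivAt (fun s => B s a b) (B' a b) t) (a b : Fin 3) :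
    HasDerivAt (fun s => (A s * B s) a b) ((A' * B t + A t * B') a b) t := by
  simp only [Matrix.mul_apply, Matrix.add_apply, ← Finset.sum_add_distrib]
  exact HasDerivAt.fun_sum fun j _ => (hA a j).mul (hB j b)

end Derivatives

/-! ### Rotation matrices and attitude errors. -/

section Rotations

theorem SO3.transpose_mul {R : M3} (h : R ∈ SO3) : Rᵀ * R = 1 := by
  have := (mem_orthogonalGroup_iff' (Fin 3) ℝ).1 (mem_specialOrthogonalGroup_iff.1 h).1
  simpa [star_eq_conjTranspose] using this

theorem SO3.mul_transpose {R : M3} (h : R ∈ SO3) : R * Rᵀ = 1 :=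
  mul_eq_one_comm.1 (SO3.transpose_mul h)

theorem SO3.det {R : M3} (h : R ∈ SO3) : R.det = 1 := (mem_specialOrthogonalGroup_iff.1 h).2

theorem SO3.one_mem : (1 : M3) ∈ SO3 := OneMemClass.one_mem (specialOrthogonalGroup (Fin 3) ℝ)

theorem SO3.mk {R : M3} (h : Rᵀ * R = 1) (hd : R.det = 1) : R ∈ SO3 := by
  refine mem_specialOrthogonalGroup_iff.2 ⟨(mem_orthogonalGroup_iff' (Fin 3) ℝ).2 ?_, hd⟩
  simpa [star_eq_conjTranspose] using h

theorem SO3.transpose_mem {R : M3} (h : R ∈ SO3) : Rᵀ ∈ SO3 :=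
  SO3.mk (by simpa using SO3.mul_transpose h) (by simpa using SO3.det h)

theorem SO3.mul_mem {R Q : M3} (h : R ∈ SO3) (h' : Q ∈ SO3) : R * Q ∈ SO3 :=
  MulMemClass.mul_mem (S := Submonoid M3) (s := specialOrthogonalGroup (Fin 3) ℝ) h h'

theorem SO3.dot_mulVec {R : M3} (h : R ∈ SO3) (a b : V3) : (R *ᵥ a) ⬝ᵥ (R *ᵥ b) = a ⬝ᵥ b := by
  rw [dotProduct_mulVec, ← mulVec_transpose, mulVec_mulVec, SO3.transpose_mul h, one_mulVec]

theorem SO3.nrm_mulVec {R : M3} (h : R ∈ SO3) (a : V3) : nrm (R *ᵥ a) = nrm a := by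
  unfold nrm; rw [SO3.dot_mulVec h]

theorem SO3.sum_sq {R : M3} (h : R ∈ SO3) (j : Fin 3) :
    R 0 j ^ 2 + R 1 j ^ 2 + R 2 j ^ 2 = 1 := by
  have := congrFun (congrFun (SO3.transpose_mul h) j) j
  simp [Matrix.mul_apply, Fin.sum_univ_three] at this
  linarith

theorem SO3.abs_le_one {R : M3} (h : R ∈ SO3) (i j : Fin 3) : |R i j| ≤ 1 := by
  have := SO3.sum_sq h j
  rw [← sq_le_one_iff_abs_le_one]
  match i with
  | 0 | 1 | 2 => nlinarith [sq_nonneg (R 0 j), sq_nonneg (R 1 j), sq_nonneg (R 2 j)]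

/-- Paired with vectors `x` and `y`, the left side is the triple product of `Ax`, `Aw`, `Ay`, which
is `det A` times that of `x`, `w`, `y`. -/
theorem transpose_mul_hat_mul (A : M3) (w : V3) : Aᵀ * hat (A *ᵥ w) * A = A.det • hat w := by
  ext i j
  fin_cases i <;> fin_cases j <;>
    simp [hat, Matrix.mul_apply, mulVec, dotProduct, Fin.sum_univ_three, det_fin_three] <;> ring

theorem SO3.hat_mulVec_mul {R : M3} (h : R ∈ SO3) (w : V3) : hat (R *ᵥ w) * R = R * hat w := by
  have := congrArg (R * ·) (transpose_mul_hat_mul R w)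
  simp only [← Matrix.mul_assoc, SO3.mul_transpose h, SO3.det h, one_smul, Matrix.one_mul] at this
  exact this

/-- The attitude error vector of a relative rotation. -/
noncomputable def skewPart (Q : M3) : V3 := vee ((1 / 2 : ℝ) • (Q - Qᵀ))

/-- The configuration error of a relative rotation. -/
noncomputable def rotPsi (Q : M3) : ℝ := (1 / 2) * trace (1 - Q)

theorem rotPsi_eq (Q : M3) : rotPsi Q = (3 - (Q 0 0 + Q 1 1 + Q 2 2)) / 2 := by
  simp [rotPsi, trace, Fin.sum_univ_three]; ring

theorem SO3.adjugate {Q : M3} (h : Q ∈ SO3) : Q.adjugate = Qᵀ := by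
  calc Q.adjugate = Q.adjugate * (Q * Qᵀ) := by rw [SO3.mul_transpose h, Matrix.mul_one]
    _ = Qᵀ := by rw [← Matrix.mul_assoc, adjugate_mul, SO3.det h, one_smul, Matrix.one_mul]

/-- For a rotation by the angle `θ` this is `sin² θ = (1 - cos θ)(1 + cos θ)`. Without the angle:
unit columns give the sum of the squared off-diagonal entries, and `adjugate = transpose` writes the
diagonal entries as minors, which gives the products of opposite off-diagonal entries. -/
theorem SO3.skewPart_sq {Q : M3} (h : Q ∈ SO3) :
    nrm (skewPart Q) ^ 2 = rotPsi Q * (2 - rotPsi Q) := by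
  have h0 := SO3.sum_sq h 0
  have h1 := SO3.sum_sq h 1
  have h2 := SO3.sum_sq h 2
  have ha := SO3.adjugate h
  rw [adjugate_fin_three] at ha
  have a0 := congrFun (congrFun ha 0) 0
  have a1 := congrFun (congrFun ha 1) 1
  have a2 := congrFun (congrFun ha 2) 2
  simp at a0 a1 a2
  rw [nrm_sq, rotPsi_eq]
  simp [skewPart, vee, dotProduct, Fin.sum_univ_three]
  nlinarith

theorem SO3.rotPsi_nonneg {Q : M3} (h : Q ∈ SO3) : 0 ≤ rotPsi Q := by
  have h0 := abs_le.1 (SO3.abs_le_one h 0 0)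
  have h1 := abs_le.1 (SO3.abs_le_one h 1 1)
  have h2 := abs_le.1 (SO3.abs_le_one h 2 2)
  rw [rotPsi_eq]; linarith

theorem SO3.nrm_skewPart_le_one {Q : M3} (h : Q ∈ SO3) : nrm (skewPart Q) ≤ 1 := by
  rw [← abs_of_nonneg (nrm_nonneg _), ← sq_le_one_iff_abs_le_one, SO3.skewPart_sq h]
  nlinarith [sq_nonneg (rotPsi Q - 1)]

/-- The entries of the difference of two rotations are controlled by the configuration error. -/
theorem SO3.sub_apply_sq_le {R P : M3} (hR : R ∈ SO3) (hP : P ∈ SO3) (i j : Fin 3) :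
    (R i j - P i j) ^ 2 ≤ 4 * rotPsi (Pᵀ * R) := by
  have h0 := SO3.sum_sq hR 0
  have h1 := SO3.sum_sq hR 1
  have h2 := SO3.sum_sq hR 2
  have k0 := SO3.sum_sq hP 0
  have k1 := SO3.sum_sq hP 1
  have k2 := SO3.sum_sq hP 2
  -- The squared Frobenius distance of two rotations is `6 - 2 Tr(Pᵀ R)`.
  have key : ∑ a, ∑ b, (R a b - P a b) ^ 2 = 4 * rotPsi (Pᵀ * R) := by
    rw [rotPsi_eq]
    simp only [Fin.sum_univ_three, Matrix.mul_apply, transpose_apply]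
    linarith
  rw [← key]
  calc (R i j - P i j) ^ 2 ≤ ∑ b, (R i b - P i b) ^ 2 :=
        Finset.single_le_sum (f := fun b => (R i b - P i b) ^ 2)
          (fun b _ => sq_nonneg _) (Finset.mem_univ j)
    _ ≤ _ := Finset.single_le_sum (f := fun a => ∑ b, (R a b - P a b) ^ 2)
          (fun a _ => Finset.sum_nonneg fun b _ => sq_nonneg _) (Finset.mem_univ i)

/-- A skew matrix sees only the skew part of `Q`. Along `Q' = Q ŵ` the left side is the rate of the
configuration error. -/
theorem trace_mul_hat (Q : M3) (w : V3) :
    -(1 / 2) * trace (Q * hat w) = skewPart Q ⬝ᵥ w := by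
  simp [skewPart, vee, hat, trace, Matrix.mul_apply, dotProduct, Fin.sum_univ_three]
  ring

theorem hat_transpose (w : V3) : (hat w)ᵀ = -hat w := by
  ext i j; fin_cases i <;> fin_cases j <;> simp [hat]

theorem hat_sub (v w : V3) : hat (v - w) = hat v - hat w := by
  ext i j; fin_cases i <;> fin_cases j <;> simp [hat] <;> ring

theorem hat_zero : hat 0 = 0 := by
  ext i j; fin_cases i <;> fin_cases j <;> simp [hat]

theorem hat_mul_hat_mulVec (q v : V3) : (hat q * hat q) *ᵥ v = (q ⬝ᵥ v) • q - (q ⬝ᵥ q) • v := by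
  rw [← mulVec_mulVec, LoadTransport.hat_mulVec, LoadTransport.hat_mulVec,
    cross_cross_eq_smul_sub_smul']

theorem abs_hat_apply_le (w : V3) (i j : Fin 3) : |hat w i j| ≤ nrm w := by
  fin_cases i <;> fin_cases j <;> simp [hat, abs_apply_le_nrm, nrm_nonneg]

theorem abs_mul_hat_apply_le {R : M3} (h : R ∈ SO3) (w : V3) (i j : Fin 3) :
    |(R * hat w) i j| ≤ 3 * nrm w := by
  rw [Matrix.mul_apply]
  refine (Finset.abs_sum_le_sum_abs _ _).trans ?_
  have : ∀ k ∈ (Finset.univ : Finset (Fin 3)), |R i k * hat w k j| ≤ nrm w := by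
    intro k _
    rw [abs_mul]
    calc _ ≤ 1 * nrm w := mul_le_mul (SO3.abs_le_one h i k) (abs_hat_apply_le w k j)
          (abs_nonneg _) zero_le_one
      _ = _ := one_mul _
  exact (Finset.sum_le_sum this).trans (by simp)

/-- The derivative of the attitude error vector is controlled by the angular velocity error. -/
theorem SO3.nrm_skewPart_mul_hat_le {Q : M3} (h : Q ∈ SO3) (w : V3) :
    nrm (skewPart (Q * hat w)) ≤ 9 * nrm w := by
  have key := abs_mul_hat_apply_le h w
  have h2 : ∀ i j k l, |(1 / 2 : ℝ) * ((Q * hat w) i j - (Q * hat w) k l)| ≤ 3 * nrm w := by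
    intro i j k l
    have a := abs_le.1 (key i j)
    have b := abs_le.1 (key k l)
    rw [abs_le]; constructor <;> linarith
  refine (nrm_le_sum_abs _).trans ?_
  rw [Fin.sum_univ_three]
  have e0 := h2 2 1 1 2
  have e1 := h2 0 2 2 0
  have e2 := h2 1 0 0 1
  have : ∀ A : M3, skewPart A = ![(1 / 2 : ℝ) * (A 2 1 - A 1 2), (1 / 2 : ℝ) * (A 0 2 - A 2 0),
    (1 / 2 : ℝ) * (A 1 0 - A 0 1)] := by
    intro A; ext i; fin_cases i <;> simp [skewPart, vee]
  rw [this]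
  calc _ ≤ 3 * nrm w + 3 * nrm w + 3 * nrm w := add_le_add (add_le_add e0 e1) e2
    _ = _ := by ring

end Rotations

/-! ### The grasp matrix and the minimum-norm distribution of force and moment. -/

section Distribution

variable (S : Params)

/-- Over `ℝ` a matrix and its product with its transpose have equal rank, here the full number 6 of
rows. -/
theorem isUnit_grasp (hrank : 6 ≤ S.grasp.rank) : IsUnit (S.grasp * S.graspᵀ).det := by
  rw [← isUnit_iff_isUnit_det]
  have h := rank_self_mul_transpose S.grasp
  have h6 : Fintype.card (Fin 3 ⊕ Fin 3) = 6 := by simp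
  have hle := rank_le_card_height S.grasp
  rw [← mulVec_surjective_iff_isUnit]
  have hr : (S.grasp * S.graspᵀ).rank = 6 := by omega
  rw [Matrix.rank] at hr
  have : LinearMap.range (S.grasp * S.graspᵀ).mulVecLin = ⊤ := by
    apply Submodule.eq_top_of_finrank_eq
    rw [hr, Module.finrank_fintype_fun_eq_card, h6]
  exact LinearMap.range_eq_top.1 this

theorem grasp_mulVec_inl (f : Fin 4 × Fin 3 → ℝ) (a : Fin 3) :
    (S.grasp *ᵥ f) (Sum.inl a) = ∑ j, f (j, a) := by
  simp only [mulVec, dotProduct, Params.grasp, of_apply, Sum.elim_inl, Fintype.sum_prod_type]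
  simp [Matrix.one_apply]

theorem grasp_mulVec_inr (f : Fin 4 × Fin 3 → ℝ) (a : Fin 3) :
    (S.grasp *ᵥ f) (Sum.inr a) = (∑ j, hat (S.r j) *ᵥ fun b => f (j, b)) a := by
  simp only [mulVec, dotProduct, Params.grasp, of_apply, Sum.elim_inr, Fintype.sum_prod_type,
    Finset.sum_apply]

variable {S}

theorem grasp_distribute (hrank : 6 ≤ S.grasp.rank) (v : Fin 3 ⊕ Fin 3 → ℝ) :
    S.grasp *ᵥ (S.graspᵀ *ᵥ ((S.grasp * S.graspᵀ)⁻¹ *ᵥ v)) = v := by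
  rw [mulVec_mulVec, mulVec_mulVec, mul_nonsing_inv _ (isUnit_grasp S hrank), one_mulVec]

theorem sum_distribute (hrank : 6 ≤ S.grasp.rank) {R : M3} (hR : R ∈ SO3) (F M : V3) :
    ∑ j, S.distribute R F M j = F := by
  simp only [Params.distribute]
  rw [← mulVec_sum]
  have : (∑ j, fun b => (S.graspᵀ *ᵥ ((S.grasp * S.graspᵀ)⁻¹ *ᵥ Sum.elim (Rᵀ *ᵥ F) M)) (j, b))
      = Rᵀ *ᵥ F := by
    ext a
    rw [Finset.sum_apply, ← grasp_mulVec_inl, grasp_distribute hrank, Sum.elim_inl]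
  rw [this, mulVec_mulVec, SO3.mul_transpose hR, one_mulVec]

theorem sum_hat_distribute (hrank : 6 ≤ S.grasp.rank) {R : M3} (hR : R ∈ SO3) (F M : V3) :
    ∑ j, hat (S.r j) *ᵥ (Rᵀ *ᵥ S.distribute R F M j) = M := by
  have h : ∀ v, Rᵀ *ᵥ (R *ᵥ v) = v := fun v => by
    rw [mulVec_mulVec, SO3.transpose_mul hR, one_mulVec]
  simp only [Params.distribute, h]
  ext a
  rw [← grasp_mulVec_inr, grasp_distribute hrank, Sum.elim_inr]

end Distribution

/-! ### Pointwise algebra of the control on one cable. -/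

section CableAlgebra

theorem hat_mul_hat_unit {q : V3} (hq : q ⬝ᵥ q = 1) (v : V3) :
    (hat q * hat q) *ᵥ v = (q ⬝ᵥ v) • q - v := by
  rw [hat_mul_hat_mulVec, hq, one_smul]

theorem cross_cross_self (q v : V3) : q ⨯₃ (q ⨯₃ v) = (q ⬝ᵥ v) • q - (q ⬝ᵥ q) • v := by
  rw [cross_cross_eq_smul_sub_smul']

/-- The thrust of a quadrotor, in terms of the acceleration of its attachment point. -/
theorem thrust_eq {q : V3} (hq : q ⬝ᵥ q = 1) (a X : V3) (m c mQ mL : ℝ) :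
    m • q + c • q + (mQ * (q ⬝ᵥ a)) • q
      + (mL • (hat q *ᵥ X) - mQ • ((hat q * hat q) *ᵥ a))
      = mQ • a + (m + c) • q + mL • (q ⨯₃ X) := by
  rw [hat_mul_hat_unit hq, LoadTransport.hat_mulVec]
  module

/-- The cross product with `q` removes the tension, the acceleration `a` is compensated exactly, and
`-q × (q × X)` is the part of `X` normal to `q`. -/
theorem cable_feedback {q : V3} (hq : q ⬝ᵥ q = 1) {mQ L : ℝ} (hmQ : mQ ≠ 0) (hL : L ≠ 0)
    (a X : V3) (m : ℝ) :
    (1 / L) • (hat q *ᵥ (a - (1 / mQ) • (mQ • a + m • q + (mQ * L) • (q ⨯₃ X))))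
      = X - (q ⬝ᵥ X) • q := by
  have : a - (1 / mQ) • (mQ • a + m • q + (mQ * L) • (q ⨯₃ X))
      = -((m / mQ) • q) - L • (q ⨯₃ X) := by
    match_scalars <;> field_simp
    ring
  rw [this, LoadTransport.hat_mulVec, map_sub, map_neg, map_smul, map_smul, cross_self,
    cross_cross_self, hq]
  match_scalars <;> field_simp

/-- For `ω ⊥ q` the centripetal term is `-‖ω‖² q`, which the extra tension balances; the normal
thrust `q × X` cancels against the angular acceleration it produces. -/
theorem thrust_add_cable {q ω : V3} (hqω : q ⬝ᵥ ω = 0) (a X : V3) (m mQ L : ℝ) :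
    (mQ • a + (m + mQ * L * nrm ω ^ 2) • q + (mQ * L) • (q ⨯₃ X))
      + (mQ * L) • ((X - (q ⬝ᵥ X) • q) ⨯₃ q + ω ⨯₃ (ω ⨯₃ q)) = m • q + mQ • a := by
  rw [cross_cross_self, dotProduct_comm ω q, hqω, nrm_sq, map_sub, map_smul, LinearMap.sub_apply,
    LinearMap.smul_apply, cross_self, ← cross_anticomm q X]
  module

end CableAlgebra

/-! ### Elimination of the cables from the load equations. -/

section LoadAlgebra

variable (S : Params)

theorem sum_fin_four_const (v : V3) : ∑ _j : Fin 4, v = (4 : ℝ) • v := by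
  simp [← Nat.cast_smul_eq_nsmul ℝ]

/-- Eliminating the cables from the force balance. -/
theorem force_balance_iff (u mu b qdd : Fin 4 → V3) (vd : V3)
    (hu : ∀ j, u j + (S.mQ * S.L) • qdd j = mu j + S.mQ • (vd + S.g • e3 + b j)) :
    S.meff • (vd + S.g • e3) = ∑ j, (u j - S.mQ • b j + (S.mQ * S.L) • qdd j) ↔
      S.mL • (vd + S.g • e3) = ∑ j, mu j := by
  have h : ∀ j, u j - S.mQ • b j + (S.mQ * S.L) • qdd j
      = mu j + S.mQ • (vd + S.g • e3) := fun j => by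
    have := hu j
    calc _ = (u j + (S.mQ * S.L) • qdd j) - S.mQ • b j := by abel
      _ = _ := by rw [this]; module
  simp only [h, Finset.sum_add_distrib, sum_fin_four_const, Params.meff]
  constructor
  · intro h
    have := congrArg (· - (4 : ℝ) • S.mQ • (vd + S.g • e3)) h
    simp only [add_sub_cancel_right] at this
    rw [← this]; module
  · intro h; rw [← h]; module

/-- Both sides equal `(r · Ω) r × Ω`. This turns the centrifugal moment of a quadrotor into its
contribution to `Ω × J_eff Ω`. -/
theorem hat_cubic (r Ω : V3) :
    hat r *ᵥ ((hat Ω * hat Ω) *ᵥ r) = -(hat Ω *ᵥ ((hat r * hat r) *ᵥ Ω)) := by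
  rw [hat_mul_hat_mulVec, hat_mul_hat_mulVec, LoadTransport.hat_mulVec, LoadTransport.hat_mulVec,
    map_sub, map_sub, map_smul, map_smul, map_smul, map_smul, cross_self, cross_self,
    ← cross_anticomm Ω r, dotProduct_comm Ω r]
  module

/-- Eliminating the cables from the moment balance. -/
theorem moment_balance_iff {R : M3} (hR : R ∈ SO3) (u mu qdd : Fin 4 → V3) (vd Ω Ωd : V3)
    (hu : ∀ j, u j + (S.mQ * S.L) • qdd j
      = mu j + S.mQ • (vd + S.g • e3 + (R * (hat Ω * hat Ω + hat Ωd)) *ᵥ S.r j)) :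
    S.Jeff *ᵥ Ωd + hat Ω *ᵥ (S.Jeff *ᵥ Ω) = ∑ j, S.mQ • ((hat (S.r j) * Rᵀ) *ᵥ
      (-(S.g • e3) - vd + S.L • qdd j + (1 / S.mQ) • u j)) ↔
    S.JL *ᵥ Ωd + hat Ω *ᵥ (S.JL *ᵥ Ω) = ∑ j, hat (S.r j) *ᵥ (Rᵀ *ᵥ mu j) := by
  have hm := S.mQ_pos.ne'
  -- Beside the moment of `μ_j` there remain exactly the terms by which `J_eff` differs from `J_L`,
  -- in the inertial and in the gyroscopic part.
  have h : ∀ j, S.mQ • ((hat (S.r j) * Rᵀ) *ᵥ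
      (-(S.g • e3) - vd + S.L • qdd j + (1 / S.mQ) • u j))
      = hat (S.r j) *ᵥ (Rᵀ *ᵥ mu j)
        - (S.mQ • (hat (S.r j) * hat (S.r j))) *ᵥ Ωd
        - hat Ω *ᵥ ((S.mQ • (hat (S.r j) * hat (S.r j))) *ᵥ Ω) := fun j => by
    have e1 : S.mQ • (-(S.g • e3) - vd + S.L • qdd j + (1 / S.mQ) • u j)
        = mu j + S.mQ • ((R * (hat Ω * hat Ω + hat Ωd)) *ᵥ S.r j) := by
      calc _ = (u j + (S.mQ * S.L) • qdd j) - S.mQ • (vd + S.g • e3) := by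
            match_scalars <;> field_simp
        _ = _ := by rw [hu j]; module
    have e2 : Rᵀ *ᵥ ((R * (hat Ω * hat Ω + hat Ωd)) *ᵥ S.r j)
        = (hat Ω * hat Ω) *ᵥ S.r j - hat (S.r j) *ᵥ Ωd := by
      rw [mulVec_mulVec, ← Matrix.mul_assoc, SO3.transpose_mul hR, Matrix.one_mul, add_mulVec,
        LoadTransport.hat_mulVec Ωd, LoadTransport.hat_mulVec (S.r j), ← cross_anticomm (S.r j)]
      abel
    rw [← mulVec_smul, e1, ← mulVec_mulVec, mulVec_add, mulVec_add, mulVec_smul, e2, mulVec_smul,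
      mulVec_sub, hat_cubic]
    simp only [smul_mulVec, mulVec_smul, ← mulVec_mulVec]
    module
  have e3 : ∀ v, S.Jeff *ᵥ v = S.JL *ᵥ v
      - ∑ j, (S.mQ • (hat (S.r j) * hat (S.r j))) *ᵥ v := fun v => by
    rw [Params.Jeff, sub_mulVec, sum_mulVec]
  simp only [h, e3, Finset.sum_sub_distrib, mulVec_sub, mulVec_sum]
  constructor
  · intro h
    have := congrArg (· + (∑ x, (S.mQ • (hat (S.r x) * hat (S.r x))) *ᵥ Ωd
      + ∑ x, hat Ω *ᵥ (S.mQ • (hat (S.r x) * hat (S.r x))) *ᵥ Ω)) h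
    simp only at this
    calc _ = _ := ?_
      _ = _ := this
      _ = _ := ?_
    · abel
    · abel
  · intro h; rw [← h]; abel

end LoadAlgebra

/-! ### The control law inserted into the cable equations. -/

section Actuated

variable {S : Params} {D : Reference} {K : Gains} {y : Motion}

/-- The feedback that the normal control component imposes on the cable. -/
noncomputable def cableFeedback (S : Params) (D : Reference) (K : Gains) (y : Motion)
    (j : Fin 4) (t : ℝ) : V3 :=
  -(K.kq • errQ S D K y j t) - K.kω • errω S D K y j t
    - (y.q j t ⬝ᵥ desω S D K y j t) • deriv (y.q j) t
    - (hat (y.q j t) * hat (y.q j t)) *ᵥ deriv (desω S D K y j) t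

theorem attachAcc_eq (j : Fin 4) (t : ℝ) :
    attachAcc S y j t = deriv y.v t + y.bodyAcc S j t + S.g • e3 := by
  have : (y.R t * hat (S.r j)) *ᵥ deriv y.Ω t = -((y.R t * hat (deriv y.Ω t)) *ᵥ S.r j) := by
    rw [← mulVec_mulVec, ← mulVec_mulVec, LoadTransport.hat_mulVec, LoadTransport.hat_mulVec,
      ← cross_anticomm, mulVec_neg]
  rw [attachAcc, this, Motion.bodyAcc, Matrix.mul_add, add_mulVec]
  abel

theorem control_eq {j : Fin 4} {t : ℝ} (hq : y.q j t ⬝ᵥ y.q j t = 1) :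
    uPar S D K y j t + uPerp S D K y j t = S.mQ • attachAcc S y j t
      + (y.q j t ⬝ᵥ desMu S D K y j t + S.mQ * S.L * nrm (y.ω j t) ^ 2) • y.q j t
      + (S.mQ * S.L) • (y.q j t ⨯₃ cableFeedback S D K y j t) := by
  rw [← thrust_eq hq]; rfl

theorem cable_dyn_rhs {j : Fin 4} {t : ℝ} (hq : y.q j t ⬝ᵥ y.q j t = 1) :
    (1 / S.L) • (hat (y.q j t) *ᵥ (deriv y.v t + y.bodyAcc S j t + S.g • e3
      - (1 / S.mQ) • (uPar S D K y j t + uPerp S D K y j t)))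
      = cableFeedback S D K y j t - (y.q j t ⬝ᵥ cableFeedback S D K y j t) • y.q j t := by
  rw [control_eq hq, ← attachAcc_eq, cable_feedback hq S.mQ_pos.ne' S.L_pos.ne']

theorem control_add_cable {j : Fin 4} {t : ℝ} (hq : y.q j t ⬝ᵥ y.q j t = 1)
    (hqω : y.q j t ⬝ᵥ y.ω j t = 0) {ωd qdd : V3}
    (hω : ωd = cableFeedback S D K y j t - (y.q j t ⬝ᵥ cableFeedback S D K y j t) • y.q j t)
    (hqdd : qdd = ωd ⨯₃ y.q j t + y.ω j t ⨯₃ (y.ω j t ⨯₃ y.q j t)) :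
    uPar S D K y j t + uPerp S D K y j t + (S.mQ * S.L) • qdd
      = mu S D K y j t + S.mQ • (deriv y.v t + S.g • e3 + y.bodyAcc S j t) := by
  rw [control_eq hq, hqdd, hω, thrust_add_cable hqω, attachAcc_eq, mu]
  congr 2; abel

/-- The second derivative of a cable direction. -/
theorem deriv_deriv_cable {I : Set ℝ} (hI : IsOpen I) {j : Fin 4} {t : ℝ} (ht : t ∈ I)
    (hk : ∀ t ∈ I, HasDerivAt (y.q j) (y.ω j t ⨯₃ y.q j t) t)
    (hω : DifferentiableAt ℝ (y.ω j) t) :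
    deriv (deriv (y.q j)) t
      = deriv (y.ω j) t ⨯₃ y.q j t + y.ω j t ⨯₃ (y.ω j t ⨯₃ y.q j t) := by
  have : deriv (y.q j) =ᶠ[nhds t] fun s => y.ω j s ⨯₃ y.q j s :=
    Filter.eventually_of_mem (hI.mem_nhds ht) fun s hs => (hk s hs).deriv
  rw [this.deriv_eq]
  exact (hasDerivAt_cross hω.hasDerivAt (hk t ht)).deriv

end Actuated

/-! ### Smoothness of the desired motion. -/

section ReferenceDerivatives

variable (D : Reference)

theorem Reference.hasDerivAt_x (t : ℝ) : HasDerivAt D.x (D.v t) t :=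
  ((D.x_smooth.differentiable (by simp)) t).hasDerivAt

theorem Reference.v_smooth : ContDiff ℝ (⊤ : ℕ∞) D.v :=
  (contDiff_infty_iff_deriv.1 D.x_smooth).2

theorem Reference.dv_smooth : ContDiff ℝ (⊤ : ℕ∞) (deriv D.v) :=
  (contDiff_infty_iff_deriv.1 D.v_smooth).2

theorem Reference.dΩ_smooth : ContDiff ℝ (⊤ : ℕ∞) (deriv D.Ω) :=
  (contDiff_infty_iff_deriv.1 D.Ω_smooth).2

theorem hasDerivAt_of_smooth {f : ℝ → V3} (h : ContDiff ℝ (⊤ : ℕ∞) f) (t : ℝ) :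
    HasDerivAt f (deriv f t) t := ((h.differentiable (by simp)) t).hasDerivAt

end ReferenceDerivatives

/-! ### Error dynamics of the load. -/

section LoadErrors

variable {S : Params} {D : Reference} {K : Gains} {y : Motion} {I : Set ℝ} {t : ℝ}

theorem IsClosedLoop.state (hc : IsClosedLoop S D K y I) (ht : t ∈ I) : y.IsState t := by
  obtain ⟨τ, h⟩ := hc.solves
  exact h.state t ht

theorem IsClosedLoop.att_kin (hc : IsClosedLoop S D K y I) (ht : t ∈ I) (a b : Fin 3) :
    HasDerivAt (fun s => y.R s a b) ((y.R t * hat (y.Ω t)) a b) t := by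
  obtain ⟨τ, h⟩ := hc.solves
  exact h.att_kin t ht a b

theorem IsClosedLoop.pos_kin (hc : IsClosedLoop S D K y I) (ht : t ∈ I) :
    HasDerivAt y.x (y.v t) t := by
  obtain ⟨τ, h⟩ := hc.solves
  exact h.pos_kin t ht

theorem IsClosedLoop.cable_kin (hc : IsClosedLoop S D K y I) (ht : t ∈ I) (j : Fin 4) :
    HasDerivAt (y.q j) (y.ω j t ⨯₃ y.q j t) t := by
  obtain ⟨τ, h⟩ := hc.solves
  exact h.cable_kin t ht j

theorem IsClosedLoop.deriv_ω (hc : IsClosedLoop S D K y I) (ht : t ∈ I) (j : Fin 4) :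
    deriv (y.ω j) t = cableFeedback S D K y j t
      - (y.q j t ⬝ᵥ cableFeedback S D K y j t) • y.q j t := by
  obtain ⟨τ, h⟩ := hc.solves
  rw [h.cable_dyn t ht j, cable_dyn_rhs ((hc.state ht).q_unit j)]

theorem IsClosedLoop.control_add_cable (hI : IsOpen I) (hc : IsClosedLoop S D K y I) (ht : t ∈ I)
    (j : Fin 4) :
    uPar S D K y j t + uPerp S D K y j t + (S.mQ * S.L) • deriv (deriv (y.q j)) t
      = mu S D K y j t + S.mQ • (deriv y.v t + S.g • e3 + y.bodyAcc S j t) :=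
  LoadTransport.control_add_cable ((hc.state ht).q_unit j) ((hc.state ht).ω_perp j)
    (hc.deriv_ω ht j)
    (deriv_deriv_cable hI ht (fun _ hs => hc.cable_kin hs j) ((hc.state ht).ω_diff j))

/-- The closed-loop force balance of the load. -/
theorem IsClosedLoop.force_balance (hI : IsOpen I) (hc : IsClosedLoop S D K y I) (ht : t ∈ I) :
    S.mL • (deriv y.v t + S.g • e3) = ∑ j, mu S D K y j t := by
  obtain ⟨τ, h⟩ := hc.solves
  exact (force_balance_iff S _ _ _ _ _ fun j => hc.control_add_cable hI ht j).1 (h.pos_dyn t ht)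

/-- The closed-loop moment balance of the load. -/
theorem IsClosedLoop.moment_balance (hI : IsOpen I) (hc : IsClosedLoop S D K y I) (ht : t ∈ I) :
    S.JL *ᵥ deriv y.Ω t + hat (y.Ω t) *ᵥ (S.JL *ᵥ y.Ω t)
      = ∑ j, hat (S.r j) *ᵥ ((y.R t)ᵀ *ᵥ mu S D K y j t) := by
  obtain ⟨τ, h⟩ := hc.solves
  exact (moment_balance_iff S (hc.state ht).R_mem _ _ _ _ _ _
    fun j => hc.control_add_cable hI ht j).1 (h.att_dyn t ht)

/-- The force disturbance due to the cable errors. -/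
noncomputable def forceGap (S : Params) (D : Reference) (K : Gains) (y : Motion) (t : ℝ) : V3 :=
  ∑ j, (mu S D K y j t - desMu S D K y j t)

/-- The moment disturbance due to the cable errors. -/
noncomputable def momentGap (S : Params) (D : Reference) (K : Gains) (y : Motion) (t : ℝ) : V3 :=
  ∑ j, hat (S.r j) *ᵥ ((y.R t)ᵀ *ᵥ (mu S D K y j t - desMu S D K y j t))

theorem IsClosedLoop.hasDerivAt_errX (hc : IsClosedLoop S D K y I) (ht : t ∈ I) :
    HasDerivAt (errX D y) (errV D y t) t :=
  (hc.pos_kin ht).sub (D.hasDerivAt_x t)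

/-- Since the `μ̃_j` add up to the desired force, the feedforward and gravity cancel; PD feedback
and the gap remain. -/
theorem IsClosedLoop.hasDerivAt_errV (hrank : 6 ≤ S.grasp.rank) (hI : IsOpen I)
    (hc : IsClosedLoop S D K y I) (ht : t ∈ I) :
    HasDerivAt (errV D y)
      (-(K.kx • errX D y t) - K.kv • errV D y t + (1 / S.mL) • forceGap S D K y t) t := by
  have h1 := (hc.state ht).v_diff.hasDerivAt.sub (hasDerivAt_of_smooth D.v_smooth t)
  refine h1.congr_deriv ?_
  have hm := S.mL_pos.ne'
  have h2 := hc.force_balance hI ht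
  have h3 : ∑ j, desMu S D K y j t = desForce S D K y t :=
    sum_distribute hrank (hc.state ht).R_mem _ _
  have h4 : deriv y.v t = (1 / S.mL) • ∑ j, mu S D K y j t - S.g • e3 := by
    rw [← h2, smul_smul, one_div_mul_cancel hm, one_smul]; abel
  rw [h4, forceGap, Finset.sum_sub_distrib, h3, desForce]
  match_scalars <;> field_simp <;> ring

/-- The relative rotation `R̃ᵀ R`. -/
noncomputable def relRot (D : Reference) (y : Motion) (t : ℝ) : M3 := (D.R t)ᵀ * y.R t

theorem relRot_mem (h : y.IsState t) : relRot D y t ∈ SO3 :=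
  SO3.mul_mem (SO3.transpose_mem (D.R_mem t)) h.R_mem

theorem relRot_transpose : (relRot D y t)ᵀ = (y.R t)ᵀ * D.R t := by
  rw [relRot, transpose_mul, transpose_transpose]

theorem errR_eq (t : ℝ) : errR D y t = skewPart (relRot D y t) := by
  rw [skewPart, relRot_transpose, errR, relRot]

theorem psiR_eq (t : ℝ) : psiR D y t = rotPsi (relRot D y t) := rfl

theorem desΩ_eq (t : ℝ) : desΩ D y t = (relRot D y t)ᵀ *ᵥ D.Ω t := by
  rw [relRot_transpose, desΩ]

/-- Conjugation by the relative rotation carries the desired angular velocity to its expression `w`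
in the actual body frame, so only `Ω_L - w` drives the relative rotation. -/
theorem IsClosedLoop.hasDerivAt_relRot (hc : IsClosedLoop S D K y I) (ht : t ∈ I) (a b : Fin 3) :
    HasDerivAt (fun s => relRot D y s a b) ((relRot D y t * hat (errΩ D y t)) a b) t := by
  have h := hasDerivAt_matMul (A := fun s => (D.R s)ᵀ) (A' := (D.R t * hat (D.Ω t))ᵀ)
    (fun a b => D.R_kin t b a) (hc.att_kin ht) a b
  refine h.congr_deriv ?_
  have hQ : relRot D y t ∈ SO3 := relRot_mem (hc.state ht)
  have h1 := SO3.hat_mulVec_mul hQ (desΩ D y t)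
  rw [desΩ_eq, mulVec_mulVec, SO3.mul_transpose hQ, one_mulVec, ← desΩ_eq] at h1
  have h2 : (D.R t * hat (D.Ω t))ᵀ * y.R t + (D.R t)ᵀ * (y.R t * hat (y.Ω t))
      = relRot D y t * hat (errΩ D y t) := by
    rw [errΩ, hat_sub, Matrix.mul_sub, ← h1, transpose_mul, hat_transpose, relRot,
      Matrix.mul_assoc, Matrix.mul_assoc, Matrix.neg_mul]
    abel
  rw [h2]

theorem hasDerivAt_skewPart {Q : ℝ → M3} {Q' : M3}
    (h : ∀ a b, HasDerivAt (fun s => Q s a b) (Q' a b) t) :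
    HasDerivAt (fun s => skewPart (Q s)) (skewPart Q') t := by
  refine hasDerivAt_pi.2 fun i => ?_
  fin_cases i
  · exact ((h 2 1).sub (h 1 2)).const_mul (1 / 2)
  · exact ((h 0 2).sub (h 2 0)).const_mul (1 / 2)
  · exact ((h 1 0).sub (h 0 1)).const_mul (1 / 2)

theorem IsClosedLoop.hasDerivAt_errR (hc : IsClosedLoop S D K y I) (ht : t ∈ I) :
    HasDerivAt (errR D y) (skewPart (relRot D y t * hat (errΩ D y t))) t := by
  have : errR D y = fun s => skewPart (relRot D y s) := funext fun s => errR_eq s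
  rw [this]
  exact hasDerivAt_skewPart (hc.hasDerivAt_relRot ht)

theorem IsClosedLoop.hasDerivAt_psiR (hc : IsClosedLoop S D K y I) (ht : t ∈ I) :
    HasDerivAt (psiR D y) (errR D y t ⬝ᵥ errΩ D y t) t := by
  have h := hc.hasDerivAt_relRot ht
  have : psiR D y = fun s => (3 - (relRot D y s 0 0 + relRot D y s 1 1 + relRot D y s 2 2)) / 2 :=
    funext fun s => by rw [psiR_eq, rotPsi_eq]
  rw [this]
  refine ((((h 0 0).add (h 1 1)).add (h 2 2)).const_sub 3 |>.div_const 2).congr_deriv ?_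
  rw [errR_eq, ← trace_mul_hat, trace, Fin.sum_univ_three]
  simp only [diag_apply]; ring

theorem IsClosedLoop.hasDerivAt_desΩ (hc : IsClosedLoop S D K y I) (ht : t ∈ I) :
    HasDerivAt (desΩ D y)
      (-(y.Ω t ⨯₃ desΩ D y t) + ((y.R t)ᵀ * D.R t) *ᵥ deriv D.Ω t) t := by
  have : desΩ D y = fun s => (relRot D y s)ᵀ *ᵥ D.Ω s := funext fun s => desΩ_eq s
  have h := hasDerivAt_mulVec (A := fun s => (relRot D y s)ᵀ)
    (A' := (relRot D y t * hat (errΩ D y t))ᵀ) (fun a b => hc.hasDerivAt_relRot ht b a)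
    (hasDerivAt_of_smooth D.Ω_smooth t)
  rw [← this] at h
  refine h.congr_deriv ?_
  -- The lemma has `Ω` where the computation produces `e_Ω`; they differ by `w`, and `w × w = 0`.
  rw [transpose_mul, hat_transpose, ← mulVec_mulVec, ← desΩ_eq, relRot_transpose, neg_mulVec,
    LoadTransport.hat_mulVec, errΩ, map_sub, LinearMap.sub_apply, cross_self, sub_zero]

theorem IsClosedLoop.hasDerivAt_errΩ (hc : IsClosedLoop S D K y I) (ht : t ∈ I) :
    HasDerivAt (errΩ D y) (deriv (errΩ D y) t) t := by
  have h1 := (hc.state ht).Ω_diff.hasDerivAt.sub (hc.hasDerivAt_desΩ ht)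
  have : errΩ D y = fun s => y.Ω s - desΩ D y s := rfl
  exact h1.differentiableAt.hasDerivAt

/-- The feedforward moment cancels every term without errors. The remaining gyroscopic terms come
from expanding `(e_Ω + w) × J_L (e_Ω + w)` and from the rotation of the frame in which `w` is
expressed. -/
theorem IsClosedLoop.inertia_mulVec_deriv_errΩ (hrank : 6 ≤ S.grasp.rank) (hI : IsOpen I)
    (hc : IsClosedLoop S D K y I) (ht : t ∈ I) :
    S.JL *ᵥ deriv (errΩ D y) t = -(K.kR • errR D y t) - K.kΩ • errΩ D y t
      - errΩ D y t ⨯₃ (S.JL *ᵥ errΩ D y t) - errΩ D y t ⨯₃ (S.JL *ᵥ desΩ D y t)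
      - desΩ D y t ⨯₃ (S.JL *ᵥ errΩ D y t) + S.JL *ᵥ (errΩ D y t ⨯₃ desΩ D y t)
      + momentGap S D K y t := by
  have h1 := ((hc.state ht).Ω_diff.hasDerivAt.sub (hc.hasDerivAt_desΩ ht)).deriv
  have h0 : deriv (errΩ D y) t = deriv (y.Ω - desΩ D y) t := rfl
  have h2 := hc.moment_balance hI ht
  have h3 : ∑ j, hat (S.r j) *ᵥ ((y.R t)ᵀ *ᵥ desMu S D K y j t) = desMoment S D K y t :=
    sum_hat_distribute hrank (hc.state ht).R_mem _ _
  have h4 : S.JL *ᵥ deriv y.Ω t = momentGap S D K y t + desMoment S D K y t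
      - hat (y.Ω t) *ᵥ (S.JL *ᵥ y.Ω t) := by
    rw [momentGap]
    simp only [mulVec_sub, Finset.sum_sub_distrib, h3]
    rw [← h2]; abel
  have h5 : y.Ω t = errΩ D y t + desΩ D y t := by rw [errΩ]; abel
  rw [h0, h1, mulVec_sub, h4, desMoment, mulVec_add, mulVec_mulVec (deriv D.Ω t), ← Matrix.mul_assoc, h5,
    LoadTransport.hat_mulVec, LoadTransport.hat_mulVec]
  simp only [map_add, LinearMap.add_apply, mulVec_add, mulVec_neg, mulVec_zero, cross_self]
  abel

end LoadErrors

/-! ### Error dynamics of the cables. -/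

section CableErrors

variable {S : Params} {D : Reference} {K : Gains} {y : Motion} {I : Set ℝ} {t : ℝ}

theorem IsClosedLoop.desQ_unit (hc : IsClosedLoop S D K y I) (ht : t ∈ I) (j : Fin 4) :
    desQ S D K y j t ⬝ᵥ desQ S D K y j t = 1 := by
  have h := nrm_pos (hc.mu_ne t ht j)
  rw [desQ, neg_dotProduct_neg, smul_dotProduct, dotProduct_smul, ← nrm_sq, smul_eq_mul,
    smul_eq_mul]
  field_simp

theorem dot_deriv_of_unit (hI : IsOpen I) {f : ℝ → V3} {f' : V3} (hf : HasDerivAt f f' t)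
    (ht : t ∈ I) (hu : ∀ s ∈ I, f s ⬝ᵥ f s = 1) : f t ⬝ᵥ f' = 0 := by
  have h1 := hasDerivAt_dot hf hf
  have h2 : (fun s => f s ⬝ᵥ f s) =ᶠ[nhds t] fun _ => (1 : ℝ) :=
    Filter.eventually_of_mem (hI.mem_nhds ht) hu
  have h3 := h1.unique ((hasDerivAt_const t (1 : ℝ)).congr_of_eventuallyEq h2)
  rw [dotProduct_comm f'] at h3
  linarith

theorem IsClosedLoop.hasDerivAt_desQ (hI : IsOpen I) (hc : IsClosedLoop S D K y I) (ht : t ∈ I)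
    (j : Fin 4) :
    HasDerivAt (desQ S D K y j) (desω S D K y j t ⨯₃ desQ S D K y j t) t := by
  have h := (hc.desQ_diff t ht j).hasDerivAt
  have h0 := dot_deriv_of_unit hI h ht fun s hs => hc.desQ_unit hs j
  refine h.congr_deriv ?_
  rw [desω, ← cross_anticomm, cross_cross_self, h0, hc.desQ_unit ht]
  simp

theorem IsClosedLoop.ω_eq (hc : IsClosedLoop S D K y I) (ht : t ∈ I) (j : Fin 4) :
    y.ω j t = errω S D K y j t + desω S D K y j t
      - (y.q j t ⬝ᵥ desω S D K y j t) • y.q j t := by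
  rw [errω, hat_mul_hat_unit ((hc.state ht).q_unit j)]; abel

theorem IsClosedLoop.dot_errω (hc : IsClosedLoop S D K y I) (ht : t ∈ I) (j : Fin 4) :
    y.q j t ⬝ᵥ errω S D K y j t = 0 := by
  have hq := (hc.state ht).q_unit j
  rw [errω, hat_mul_hat_unit hq, dotProduct_add, dotProduct_sub, dotProduct_smul, hq,
    (hc.state ht).ω_perp j]
  simp

theorem dot_errQ (j : Fin 4) (t : ℝ) : y.q j t ⬝ᵥ errQ S D K y j t = 0 := by
  rw [errQ, dot_cross_self]

/-- A common rotation preserves `q̃ · q`, so only `ω - ω̃` enters; it differs from `e_ω` by a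
multiple of `q`, and `e_q ⊥ q`. -/
theorem IsClosedLoop.hasDerivAt_psiQ (hI : IsOpen I) (hc : IsClosedLoop S D K y I) (ht : t ∈ I)
    (j : Fin 4) :
    HasDerivAt (psiQ S D K y j) (errQ S D K y j t ⬝ᵥ errω S D K y j t) t := by
  have h := (hasDerivAt_dot (hc.hasDerivAt_desQ hI ht j) (hc.cable_kin ht j)).const_sub 1
  refine h.congr_deriv ?_
  rw [hc.ω_eq ht j, errQ]
  simp only [cross_apply, dotProduct, Fin.sum_univ_three]
  simp
  ring

/-- The feedforward terms of the control cancel the derivative of `q̂² ω̃` up to a multiple of `q`,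
which is invisible in products with `e_q` and `e_ω`. -/
theorem IsClosedLoop.hasDerivAt_errω (hc : IsClosedLoop S D K y I) (ht : t ∈ I) (j : Fin 4) :
    HasDerivAt (errω S D K y j) (-(K.kq • errQ S D K y j t) - K.kω • errω S D K y j t
      + ((y.ω j t ⨯₃ y.q j t) ⬝ᵥ desω S D K y j t) • y.q j t) t := by
  have hq := (hc.state ht).q_unit j
  have hk := hc.cable_kin ht j
  have hω := ((hc.state ht).ω_diff j).hasDerivAt
  have hd := (hc.desω_diff t ht j).hasDerivAt
  have h := hω.add (((hasDerivAt_dot hk hd).smul hk).sub ((hasDerivAt_dot hk hk).smul hd))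
  have e : errω S D K y j = fun s => y.ω j s + ((y.q j s ⬝ᵥ desω S D K y j s) • y.q j s
      - (y.q j s ⬝ᵥ y.q j s) • desω S D K y j s) := by
    funext s; rw [errω, hat_mul_hat_mulVec]
  -- The feedback is already normal to the cable, so the projection in `deriv_ω` changes nothing.
  have hX : y.q j t ⬝ᵥ cableFeedback S D K y j t = 0 := by
    rw [cableFeedback, hat_mul_hat_unit hq, hk.deriv]
    simp only [dotProduct_sub, dotProduct_neg, dotProduct_smul, dot_errQ, hc.dot_errω ht,
      dot_cross_self, hq, smul_eq_mul]
    ring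
  rw [hc.deriv_ω ht j, hX, cableFeedback, hat_mul_hat_unit hq, hk.deriv] at h
  have h0 : (y.ω j t ⨯₃ y.q j t) ⬝ᵥ y.q j t = 0 := by rw [dotProduct_comm, dot_cross_self]
  refine (h.congr_deriv ?_).congr_of_eventuallyEq (Filter.Eventually.of_forall (congrFun e))
  rw [dot_cross_self, h0, hq]
  module

/-- The Jacobi identity splits off the rotation of both directions with `ω̃`; the rest is `q̃ × (e_ω
× q)`, expanded as a double cross product. -/
theorem IsClosedLoop.hasDerivAt_errQ (hI : IsOpen I) (hc : IsClosedLoop S D K y I) (ht : t ∈ I)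
    (j : Fin 4) :
    HasDerivAt (errQ S D K y j) (desω S D K y j t ⨯₃ errQ S D K y j t
      + (desQ S D K y j t ⬝ᵥ y.q j t) • errω S D K y j t
      - (desQ S D K y j t ⬝ᵥ errω S D K y j t) • y.q j t) t := by
  have h := hasDerivAt_cross (hc.hasDerivAt_desQ hI ht j) (hc.cable_kin ht j)
  refine h.congr_deriv ?_
  rw [hc.ω_eq ht j, errQ]
  ext i
  simp only [Pi.add_apply, Pi.sub_apply, Pi.smul_apply]
  fin_cases i <;> simp [cross_apply, dotProduct, Fin.sum_univ_three] <;> ring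

/-- The configuration error and the direction error of a cable. -/
theorem IsClosedLoop.errQ_sq (hc : IsClosedLoop S D K y I) (ht : t ∈ I) (j : Fin 4) :
    nrm (errQ S D K y j t) ^ 2 = psiQ S D K y j t * (2 - psiQ S D K y j t) := by
  rw [errQ, nrm_cross_sq, nrm_sq, nrm_sq, hc.desQ_unit ht, (hc.state ht).q_unit, psiQ]
  ring

theorem IsClosedLoop.errQ_sq_le_one (hc : IsClosedLoop S D K y I) (ht : t ∈ I) (j : Fin 4) :
    nrm (errQ S D K y j t) ^ 2 ≤ 1 := by
  rw [hc.errQ_sq ht]; linarith [sq_nonneg (psiQ S D K y j t - 1)]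

theorem IsClosedLoop.psiQ_nonneg (hc : IsClosedLoop S D K y I) (ht : t ∈ I) (j : Fin 4) :
    0 ≤ psiQ S D K y j t := by
  have := dot_le (desQ S D K y j t) (y.q j t)
  rw [nrm, nrm, hc.desQ_unit ht, (hc.state ht).q_unit, Real.sqrt_one] at this
  rw [psiQ]; linarith

/-- The difference is `q × (q × μ̃)`, the part of `μ̃` normal to the cable, of length `‖μ̃‖` times
the sine of the angle between `q` and `q̃`. -/
theorem IsClosedLoop.nrm_mu_sub (hc : IsClosedLoop S D K y I) (ht : t ∈ I) (j : Fin 4) :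
    nrm (mu S D K y j t - desMu S D K y j t)
      = nrm (desMu S D K y j t) * nrm (errQ S D K y j t) := by
  have hq := (hc.state ht).q_unit j
  have hn := nrm_pos (hc.mu_ne t ht j)
  rw [mu, ← hat_mul_hat_unit hq, ← mulVec_mulVec, LoadTransport.hat_mulVec,
    LoadTransport.hat_mulVec]
  have hQ : errQ S D K y j t = (1 / nrm (desMu S D K y j t)) • (y.q j t ⨯₃ desMu S D K y j t) := by
    rw [errQ, desQ, map_neg, LinearMap.neg_apply, map_smul, LinearMap.smul_apply,
      ← cross_anticomm (y.q j t)]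
    module
  have h1 : nrm (y.q j t) = 1 := by rw [nrm, hq, Real.sqrt_one]
  have h2 : nrm (y.q j t ⨯₃ (y.q j t ⨯₃ desMu S D K y j t))
      = nrm (y.q j t ⨯₃ desMu S D K y j t) := by
    rw [← sq_eq_sq₀ (nrm_nonneg _) (nrm_nonneg _), nrm_cross_sq, dot_self_cross, h1]; ring
  rw [h2, hQ, nrm_smul, abs_of_pos (by positivity)]
  field_simp

end CableErrors

/-! ### The desired motion as a motion of the whole system. -/

section ReferenceMotion

variable (S : Params) (D : Reference)

/-- The desired motion itself, as a motion of the whole system. -/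
noncomputable def refMotion : Motion where
  x := D.x
  v := D.v
  R := D.R
  Ω := D.Ω
  q := fun j t => -((1 / nrm (D.cableForce S j t)) • D.cableForce S j t)
  ω := fun j t => -((1 / nrm (D.cableForce S j t)) • D.cableForce S j t) ⨯₃
    deriv (fun s => -((1 / nrm (D.cableForce S j s)) • D.cableForce S j s)) t
  -- The quadrotor attitudes do not influence the rest, so quadrotors without rotation, under zero
  -- moments, will do.
  Rq := fun _ _ => 1
  Ωq := fun _ _ => 0

theorem relRot_refMotion (t : ℝ) : relRot D (refMotion S D) t = 1 :=
  SO3.transpose_mul (D.R_mem t)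

theorem errX_refMotion (t : ℝ) : errX D (refMotion S D) t = 0 := sub_self _

theorem errV_refMotion (t : ℝ) : errV D (refMotion S D) t = 0 := sub_self _

theorem skewPart_one : skewPart 1 = 0 := by
  ext i; fin_cases i <;> simp [skewPart, vee]

theorem errR_refMotion (t : ℝ) : errR D (refMotion S D) t = 0 := by
  rw [errR_eq, relRot_refMotion, skewPart_one]

theorem psiR_refMotion (t : ℝ) : psiR D (refMotion S D) t = 0 := by
  rw [psiR_eq, relRot_refMotion, rotPsi, sub_self, trace_zero, mul_zero]

theorem desΩ_refMotion (t : ℝ) : desΩ D (refMotion S D) t = D.Ω t := by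
  rw [desΩ_eq, relRot_refMotion, transpose_one, one_mulVec]

theorem errΩ_refMotion (t : ℝ) : errΩ D (refMotion S D) t = 0 := by
  rw [errΩ, desΩ_refMotion]; exact sub_self _

theorem desMu_refMotion (K : Gains) (j : Fin 4) (t : ℝ) :
    desMu S D K (refMotion S D) j t = D.cableForce S j t := by
  have h : S.JL * ((refMotion S D).R t)ᵀ * D.R t = S.JL := by
    rw [Matrix.mul_assoc]
    exact (congrArg (S.JL * ·) (SO3.transpose_mul (D.R_mem t))).trans (Matrix.mul_one _)
  rw [desMu, desForce, desMoment, errX_refMotion, errV_refMotion, errR_refMotion, errΩ_refMotion,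
    desΩ_refMotion, h]
  simp only [smul_zero, neg_zero, sub_zero, zero_add]
  rfl

end ReferenceMotion

/-! ### Membership in function algebras: any property closed under sums and products passes to the
polynomial expression `μ̃_j`. -/

section Entries

variable {X : Type*} {𝒜 : Subalgebra ℝ (X → ℝ)}

/-- The entries of a family of vectors belong to an algebra of functions. -/
def VecIn (𝒜 : Subalgebra ℝ (X → ℝ)) (f : X → V3) : Prop := ∀ a, (fun x => f x a) ∈ 𝒜

/-- The entries of a family of matrices belong to an algebra of functions. -/
def MatIn (𝒜 : Subalgebra ℝ (X → ℝ)) (A : X → M3) : Prop := ∀ a b, (fun x => A x a b) ∈ 𝒜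

theorem const_mem_algebra (c : ℝ) : (fun _ : X => c) ∈ 𝒜 := 𝒜.algebraMap_mem c

theorem fun_sum_mem {ι : Type*} [Fintype ι] {f : ι → X → ℝ} (h : ∀ i, f i ∈ 𝒜) :
    (fun x => ∑ i, f i x) ∈ 𝒜 := by
  have : (fun x => ∑ i, f i x) = ∑ i, f i := by ext x; simp
  rw [this]; exact 𝒜.sum_mem fun i _ => h i

theorem fun_mul_mem {f g : X → ℝ} (hf : f ∈ 𝒜) (hg : g ∈ 𝒜) : (fun x => f x * g x) ∈ 𝒜 :=
  𝒜.mul_mem hf hg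

theorem fun_add_mem {f g : X → ℝ} (hf : f ∈ 𝒜) (hg : g ∈ 𝒜) : (fun x => f x + g x) ∈ 𝒜 :=
  𝒜.add_mem hf hg

theorem fun_sub_mem {f g : X → ℝ} (hf : f ∈ 𝒜) (hg : g ∈ 𝒜) : (fun x => f x - g x) ∈ 𝒜 :=
  𝒜.sub_mem hf hg

theorem fun_neg_mem {f : X → ℝ} (hf : f ∈ 𝒜) : (fun x => -f x) ∈ 𝒜 := 𝒜.neg_mem hf

theorem VecIn.const (v : V3) : VecIn 𝒜 fun _ => v := fun a => const_mem_algebra (v a)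

theorem MatIn.const (A : M3) : MatIn 𝒜 fun _ => A := fun a b => const_mem_algebra (A a b)

variable {f g : X → V3} {A B : X → M3}

theorem VecIn.add (hf : VecIn 𝒜 f) (hg : VecIn 𝒜 g) : VecIn 𝒜 fun x => f x + g x :=
  fun a => fun_add_mem (hf a) (hg a)

theorem VecIn.sub (hf : VecIn 𝒜 f) (hg : VecIn 𝒜 g) : VecIn 𝒜 fun x => f x - g x :=
  fun a => fun_sub_mem (hf a) (hg a)

theorem VecIn.neg (hf : VecIn 𝒜 f) : VecIn 𝒜 fun x => -f x := fun a => fun_neg_mem (hf a)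

theorem VecIn.smul {c : X → ℝ} (hc : c ∈ 𝒜) (hf : VecIn 𝒜 f) : VecIn 𝒜 fun x => c x • f x :=
  fun a => fun_mul_mem hc (hf a)

theorem VecIn.mulVec (hA : MatIn 𝒜 A) (hf : VecIn 𝒜 f) : VecIn 𝒜 fun x => A x *ᵥ f x :=
  fun a => fun_sum_mem fun b => fun_mul_mem (hA a b) (hf b)

theorem MatIn.mul (hA : MatIn 𝒜 A) (hB : MatIn 𝒜 B) : MatIn 𝒜 fun x => A x * B x := by
  intro a b
  simp only [Matrix.mul_apply]
  exact fun_sum_mem fun c => fun_mul_mem (hA a c) (hB c b)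

theorem MatIn.transpose (hA : MatIn 𝒜 A) : MatIn 𝒜 fun x => (A x)ᵀ := fun a b => hA b a

theorem MatIn.hat (hf : VecIn 𝒜 f) : MatIn 𝒜 fun x => hat (f x) := by
  intro a b
  fin_cases a <;> fin_cases b <;> simp only [LoadTransport.hat, of_apply, cons_val']
  exacts [const_mem_algebra 0, fun_neg_mem (hf 2), hf 1, hf 2, const_mem_algebra 0,
    fun_neg_mem (hf 0), fun_neg_mem (hf 1), hf 0, const_mem_algebra 0]

theorem VecIn.skewPart (hA : MatIn 𝒜 A) : VecIn 𝒜 fun x => skewPart (A x) := by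
  intro a
  fin_cases a
  exacts [fun_mul_mem (const_mem_algebra (1 / 2)) (fun_sub_mem (hA 2 1) (hA 1 2)),
    fun_mul_mem (const_mem_algebra (1 / 2)) (fun_sub_mem (hA 0 2) (hA 2 0)),
    fun_mul_mem (const_mem_algebra (1 / 2)) (fun_sub_mem (hA 1 0) (hA 0 1))]

theorem VecIn.distribute (S : Params) (hA : MatIn 𝒜 A) (hf : VecIn 𝒜 f) (hg : VecIn 𝒜 g)
    (j : Fin 4) : VecIn 𝒜 fun x => S.distribute (A x) (f x) (g x) j := by
  apply VecIn.mulVec hA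
  intro b
  change (fun x => ∑ c, S.graspᵀ (j, b) c * ∑ d, (S.grasp * S.graspᵀ)⁻¹ c d *
    Sum.elim ((A x)ᵀ *ᵥ f x) (g x) d) ∈ 𝒜
  refine fun_sum_mem (ι := Fin 3 ⊕ Fin 3) fun c => fun_mul_mem (const_mem_algebra _)
    (fun_sum_mem (ι := Fin 3 ⊕ Fin 3) fun d => fun_mul_mem (const_mem_algebra _) ?_)
  cases d with
  | inl d => exact VecIn.mulVec hA.transpose hf d
  | inr d => exact hg d

/-- The desired cable forces are polynomial in the load errors and in the desired motion. -/
theorem VecIn.desMu (S : Params) (D : Reference) {k : X → Gains} {y : X → Motion} {τ : X → ℝ}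
    (hkx : (fun x => (k x).kx) ∈ 𝒜) (hkv : (fun x => (k x).kv) ∈ 𝒜)
    (hkR : (fun x => (k x).kR) ∈ 𝒜) (hkΩ : (fun x => (k x).kΩ) ∈ 𝒜)
    (hR : MatIn 𝒜 fun x => (y x).R (τ x)) (hDR : MatIn 𝒜 fun x => D.R (τ x))
    (hX : VecIn 𝒜 fun x => errX D (y x) (τ x)) (hV : VecIn 𝒜 fun x => errV D (y x) (τ x))
    (hΩ : VecIn 𝒜 fun x => errΩ D (y x) (τ x)) (hDv : VecIn 𝒜 fun x => deriv D.v (τ x))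
    (hDΩ : VecIn 𝒜 fun x => D.Ω (τ x)) (hDdΩ : VecIn 𝒜 fun x => deriv D.Ω (τ x)) (j : Fin 4) :
    VecIn 𝒜 fun x => desMu S D (k x) (y x) j (τ x) := by
  have hQ : MatIn 𝒜 fun x => relRot D (y x) (τ x) := hDR.transpose.mul hR
  have heR : VecIn 𝒜 fun x => errR D (y x) (τ x) := by
    simp only [errR_eq]; exact VecIn.skewPart hQ
  have hw : VecIn 𝒜 fun x => desΩ D (y x) (τ x) := VecIn.mulVec (hR.transpose.mul hDR) hDΩ
  refine VecIn.distribute S hR ?_ ?_ j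
  · exact VecIn.smul (const_mem_algebra _) ((((hX.smul hkx).neg.sub (hV.smul hkv)).add hDv).add
      (VecIn.const _))
  · exact (((heR.smul hkR).neg.sub (hΩ.smul hkΩ)).add
      (VecIn.mulVec (MatIn.hat hw) (VecIn.mulVec (MatIn.const S.JL) hw))).add
      (VecIn.mulVec (((MatIn.const S.JL).mul hR.transpose).mul hDR) hDdΩ)

end Entries

/-! ### Two function algebras that encode uniform estimates. -/

section BoundedAlgebras

variable {ι : Type*}

/-- Functions with a bounded derivative, uniformly over a set of curves and times. -/
def c1Bounded (T : Set (ι × ℝ)) : Subalgebra ℝ (ι × ℝ → ℝ) where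
  carrier := {f | ∃ C, 0 ≤ C ∧ ∀ p ∈ T, |f p| ≤ C ∧
    ∃ d, HasDerivAt (fun s => f (p.1, s)) d p.2 ∧ |d| ≤ C}
  mul_mem' := by
    rintro f g ⟨A, hA, hf⟩ ⟨B, hB, hg⟩
    refine ⟨2 * (A * B), by positivity, fun p hp => ?_⟩
    obtain ⟨hf0, d, hd, hdA⟩ := hf p hp
    obtain ⟨hg0, e, he, heB⟩ := hg p hp
    refine ⟨?_, _, hd.mul he, ?_⟩
    · rw [Pi.mul_apply, abs_mul]
      nlinarith [mul_le_mul hf0 hg0 (abs_nonneg _) hA, mul_nonneg hA hB]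
    · refine (abs_add_le _ _).trans ?_
      rw [abs_mul, abs_mul]
      linarith [mul_le_mul hdA hg0 (abs_nonneg _) hA, mul_le_mul hf0 heB (abs_nonneg _) hA]
  add_mem' := by
    rintro f g ⟨A, hA, hf⟩ ⟨B, hB, hg⟩
    refine ⟨A + B, by positivity, fun p hp => ?_⟩
    obtain ⟨hf0, d, hd, hdA⟩ := hf p hp
    obtain ⟨hg0, e, he, heB⟩ := hg p hp
    exact ⟨(abs_add_le _ _).trans (add_le_add hf0 hg0), _, hd.add he,
      (abs_add_le _ _).trans (add_le_add hdA heB)⟩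
  algebraMap_mem' := fun c => ⟨|c|, abs_nonneg c, fun p _ =>
    ⟨le_rfl, 0, hasDerivAt_const p.2 c, by simp⟩⟩

/-- Functions on two copies of a set that are bounded, with a difference of the order of `s`. -/
def closePairs (T : Set ι) (s : ι → ℝ) : Subalgebra ℝ (Bool × ι → ℝ) where
  carrier := {f | ∃ C, 0 ≤ C ∧ ∀ p ∈ T, (∀ b, |f (b, p)| ≤ C) ∧
    |f (true, p) - f (false, p)| ≤ C * |s p|}
  mul_mem' := by
    rintro f g ⟨A, hA, hf⟩ ⟨B, hB, hg⟩
    refine ⟨2 * (A * B), by positivity, fun p hp => ?_⟩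
    obtain ⟨hf0, hf1⟩ := hf p hp
    obtain ⟨hg0, hg1⟩ := hg p hp
    refine ⟨fun b => ?_, ?_⟩
    · rw [Pi.mul_apply, abs_mul]
      nlinarith [mul_le_mul (hf0 b) (hg0 b) (abs_nonneg _) hA, mul_nonneg hA hB]
    · have : (f * g) (true, p) - (f * g) (false, p)
          = (f (true, p) - f (false, p)) * g (true, p)
            + f (false, p) * (g (true, p) - g (false, p)) := by
        simp only [Pi.mul_apply]; ring
      rw [this]
      refine (abs_add_le _ _).trans ?_
      rw [abs_mul, abs_mul]
      have h1 := mul_le_mul hf1 (hg0 true) (abs_nonneg _) (by positivity)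
      have h2 := mul_le_mul (hf0 false) hg1 (abs_nonneg _) hA
      linarith
  add_mem' := by
    rintro f g ⟨A, hA, hf⟩ ⟨B, hB, hg⟩
    refine ⟨A + B, by positivity, fun p hp => ?_⟩
    obtain ⟨hf0, hf1⟩ := hf p hp
    obtain ⟨hg0, hg1⟩ := hg p hp
    refine ⟨fun b => (abs_add_le _ _).trans (add_le_add (hf0 b) (hg0 b)), ?_⟩
    have : (f + g) (true, p) - (f + g) (false, p)
        = (f (true, p) - f (false, p)) + (g (true, p) - g (false, p)) := by
      simp only [Pi.add_apply]; ring
    rw [this]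
    exact (abs_add_le _ _).trans (by linarith)
  algebraMap_mem' := fun c => ⟨|c|, abs_nonneg c, fun p _ => ⟨fun _ => le_rfl, by
    have : (algebraMap ℝ (Bool × ι → ℝ)) c (true, p)
      - (algebraMap ℝ (Bool × ι → ℝ)) c (false, p) = 0 := by simp
    rw [this, abs_zero]; positivity⟩⟩

end BoundedAlgebras

/-! ### Estimates for small load errors, uniform in the cable gains. -/

section Tube

/-- The size of the load errors, with the attitude measured by its configuration error. -/
noncomputable def loadErr (D : Reference) (y : Motion) (t : ℝ) : ℝ :=
  Real.sqrt (nrm (errX D y t) ^ 2 + nrm (errV D y t) ^ 2 + psiR D y t + nrm (errΩ D y t) ^ 2)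

theorem psiR_nonneg {D : Reference} {y : Motion} {t : ℝ} (h : y.IsState t) : 0 ≤ psiR D y t := by
  rw [psiR_eq]; exact SO3.rotPsi_nonneg (relRot_mem h)

theorem errR_sq {D : Reference} {y : Motion} {t : ℝ} (h : y.IsState t) :
    nrm (errR D y t) ^ 2 = psiR D y t * (2 - psiR D y t) := by
  rw [errR_eq, psiR_eq, SO3.skewPart_sq (relRot_mem h)]

theorem loadErr_sq {D : Reference} {y : Motion} {t : ℝ} (h : y.IsState t) :
    loadErr D y t ^ 2 = nrm (errX D y t) ^ 2 + nrm (errV D y t) ^ 2 + psiR D y t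
      + nrm (errΩ D y t) ^ 2 :=
  Real.sq_sqrt (by have := psiR_nonneg (D := D) h; positivity)

theorem loadErr_nonneg (D : Reference) (y : Motion) (t : ℝ) : 0 ≤ loadErr D y t :=
  Real.sqrt_nonneg _

theorem nrm_errX_le_loadErr {D : Reference} {y : Motion} {t : ℝ} (h : y.IsState t) :
    nrm (errX D y t) ≤ loadErr D y t := by
  refine Real.le_sqrt_of_sq_le ?_
  nlinarith [psiR_nonneg (D := D) h, sq_nonneg (nrm (errV D y t)), sq_nonneg (nrm (errΩ D y t))]

theorem nrm_errV_le_loadErr {D : Reference} {y : Motion} {t : ℝ} (h : y.IsState t) :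
    nrm (errV D y t) ≤ loadErr D y t := by
  refine Real.le_sqrt_of_sq_le ?_
  nlinarith [psiR_nonneg (D := D) h, sq_nonneg (nrm (errX D y t)), sq_nonneg (nrm (errΩ D y t))]

theorem nrm_errΩ_le_loadErr {D : Reference} {y : Motion} {t : ℝ} (h : y.IsState t) :
    nrm (errΩ D y t) ≤ loadErr D y t := by
  refine Real.le_sqrt_of_sq_le ?_
  nlinarith [psiR_nonneg (D := D) h, sq_nonneg (nrm (errV D y t)), sq_nonneg (nrm (errX D y t))]

theorem psiR_le_loadErr_sq {D : Reference} {y : Motion} {t : ℝ} (h : y.IsState t) :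
    psiR D y t ≤ loadErr D y t ^ 2 := by
  rw [loadErr_sq h]
  nlinarith [sq_nonneg (nrm (errV D y t)), sq_nonneg (nrm (errX D y t)),
    sq_nonneg (nrm (errΩ D y t))]

/-- Unit gains for the load. -/
def Gains.UnitLoad (K : Gains) : Prop := K.kx = 1 ∧ K.kv = 1 ∧ K.kR = 1 ∧ K.kΩ = 1

/-- Instants of closed-loop motions with unit load gains at which the load errors are at most
`r`. -/
structure InTube (S : Params) (D : Reference) (r : ℝ) (K : Gains) (y : Motion) (t : ℝ) : Prop where
  nonneg : 0 ≤ t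
  unit : K.UnitLoad
  closed : ∃ I, IsOpen I ∧ t ∈ I ∧ IsClosedLoop S D K y I
  small : loadErr D y t ≤ r

variable {S : Params} {D : Reference}

theorem InTube.state {r : ℝ} {K : Gains} {y : Motion} {t : ℝ} (h : InTube S D r K y t) :
    y.IsState t := by
  obtain ⟨I, -, ht, hc⟩ := h.closed
  exact hc.state ht

/-- In a tube around the desired motion, the desired cable forces are close to those of the
desired motion. -/
theorem exists_nrm_desMu_sub_le (hbdd : D.IsBounded) :
    ∃ C : ℝ, 0 < C ∧ ∀ K y t, InTube S D 1 K y t → ∀ j,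
      nrm (desMu S D K y j t - D.cableForce S j t) ≤ C * loadErr D y t ∧
      nrm (desMu S D K y j t) ≤ C := by
  obtain ⟨C₀, hC₀⟩ := hbdd
  let T : Set ((Gains × Motion) × ℝ) := {p | InTube S D 1 p.1.1 p.1.2 p.2}
  let s : (Gains × Motion) × ℝ → ℝ := fun p => loadErr D p.1.2 p.2
  let 𝒜 := closePairs T s
  let k : Bool × ((Gains × Motion) × ℝ) → Gains := fun x => x.2.1.1
  -- The copy `true` carries the actual motion, `false` the desired one at the same time, so a
  -- difference of copies is a deviation from the desired motion.
  let y : Bool × ((Gains × Motion) × ℝ) → Motion := fun x => bif x.1 then x.2.1.2 else refMotion S D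
  let τ : Bool × ((Gains × Motion) × ℝ) → ℝ := fun x => x.2.2
  have hsame : ∀ f : (Gains × Motion) × ℝ → ℝ, (∃ C, ∀ p ∈ T, |f p| ≤ C) →
      (fun x : Bool × ((Gains × Motion) × ℝ) => f x.2) ∈ 𝒜 := by
    rintro f ⟨C, hC⟩
    refine ⟨|C|, abs_nonneg C, fun p hp => ⟨fun _ => (hC p hp).trans (le_abs_self C), ?_⟩⟩
    simp only [sub_self, abs_zero]; positivity
  have herr : ∀ e : Motion → ℝ → V3, (∀ t, e (refMotion S D) t = 0) →
      (∀ p ∈ T, nrm (e p.1.2 p.2) ≤ s p) → VecIn 𝒜 fun x => e (y x) (τ x) := by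
    intro e h0 h1 a
    have h2 : ∀ p ∈ T, |e p.1.2 p.2 a| ≤ s p := fun p hp =>
      (abs_apply_le_nrm _ a).trans (h1 p hp)
    refine ⟨1, zero_le_one, fun p hp => ⟨?_, ?_⟩⟩
    · rintro (_ | _)
      · simp [y, τ, h0]
      · exact (h2 p hp).trans hp.small
    · simp only [y, τ, cond_true, cond_false, h0, Pi.zero_apply, sub_zero, one_mul]
      exact (h2 p hp).trans (le_abs_self _)
  have hbd : ∀ f : ℝ → V3, (∀ t, 0 ≤ t → nrm (f t) ≤ C₀) → VecIn 𝒜 fun x => f (τ x) :=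
    fun f hf a => hsame (fun p => f p.2 a) ⟨C₀, fun p hp =>
      (abs_apply_le_nrm _ a).trans (hf p.2 hp.nonneg)⟩
  -- Entries of the two attitudes differ by at most `2 √Ψ_R`; as `loadErr` contains `Ψ_R` to the
  -- first power, this is linear in `loadErr`.
  have hR : MatIn 𝒜 fun x => (y x).R (τ x) := by
    intro a b
    refine ⟨2, by norm_num, fun p hp => ⟨?_, ?_⟩⟩
    · rintro (_ | _)
      · exact (SO3.abs_le_one (D.R_mem p.2) a b).trans (by norm_num)
      · exact (SO3.abs_le_one hp.state.R_mem a b).trans (by norm_num)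
    · have h := SO3.sub_apply_sq_le hp.state.R_mem (D.R_mem p.2) a b
      have h2 := psiR_le_loadErr_sq (D := D) hp.state
      rw [psiR_eq, relRot] at h2
      refine abs_le_of_sq_le_sq ?_ (by positivity)
      rw [mul_pow, sq_abs]
      calc _ ≤ _ := h
        _ ≤ 2 ^ 2 * loadErr D p.1.2 p.2 ^ 2 := by linarith
  have hunit : ∀ f : Gains → ℝ, (∀ p ∈ T, f p.1.1 = 1) → (fun x => f (k x)) ∈ 𝒜 := fun f hf =>
    hsame (fun p => f p.1.1) ⟨1, fun p hp => by rw [hf p hp, abs_one]⟩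
  have key := fun j => VecIn.desMu (𝒜 := 𝒜) S D (k := k) (y := y) (τ := τ)
    (hunit Gains.kx fun p hp => hp.unit.1) (hunit Gains.kv fun p hp => hp.unit.2.1)
    (hunit Gains.kR fun p hp => hp.unit.2.2.1) (hunit Gains.kΩ fun p hp => hp.unit.2.2.2) hR
    (fun a b => hsame (fun p => D.R p.2 a b) ⟨1, fun p _ => SO3.abs_le_one (D.R_mem p.2) a b⟩)
    (herr _ (errX_refMotion S D) fun p hp => nrm_errX_le_loadErr hp.state)
    (herr _ (errV_refMotion S D) fun p hp => nrm_errV_le_loadErr hp.state)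
    (herr _ (errΩ_refMotion S D) fun p hp => nrm_errΩ_le_loadErr hp.state)
    (hbd _ fun t ht => (hC₀ t ht).1) (hbd _ fun t ht => (hC₀ t ht).2.2.1)
    (hbd _ fun t ht => (hC₀ t ht).2.2.2.1) j
  choose c hc0 hc using key
  have hcs : ∀ j a, c j a ≤ ∑ j, ∑ a, c j a := fun j a =>
    (Finset.single_le_sum (f := c j) (fun a _ => hc0 j a) (Finset.mem_univ a)).trans
      (Finset.single_le_sum (f := fun j => ∑ a, c j a)
        (fun j _ => Finset.sum_nonneg fun a _ => hc0 j a) (Finset.mem_univ j))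
  set c' := ∑ j, ∑ a, c j a with hc'
  have hc'0 : 0 ≤ c' := Finset.sum_nonneg fun j _ => Finset.sum_nonneg fun a _ => hc0 j a
  refine ⟨3 * c' + 1, by positivity, fun K y' t h j => ⟨?_, ?_⟩⟩
  · have hb : ∀ a ∈ (Finset.univ : Finset (Fin 3)),
        |(desMu S D K y' j t - D.cableForce S j t) a| ≤ c' * loadErr D y' t := by
      intro a _
      have := (hc j a ((K, y'), t) h).2
      simp only [k, y, τ, cond_true, cond_false, desMu_refMotion, s,
        abs_of_nonneg (loadErr_nonneg D y' t)] at this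
      exact this.trans (mul_le_mul_of_nonneg_right (hcs j a) (loadErr_nonneg _ _ _))
    refine (nrm_le_sum_abs _).trans ((Finset.sum_le_sum hb).trans ?_)
    simp only [Finset.sum_const, Finset.card_univ, Fintype.card_fin, nsmul_eq_mul]
    push_cast
    nlinarith [loadErr_nonneg D y' t]
  · have hb : ∀ a ∈ (Finset.univ : Finset (Fin 3)), |desMu S D K y' j t a| ≤ c' := fun a _ =>
      ((hc j a ((K, y'), t) h).1 true).trans (hcs j a)
    refine (nrm_le_sum_abs _).trans ((Finset.sum_le_sum hb).trans ?_)
    simp only [Finset.sum_const, Finset.card_univ, Fintype.card_fin, nsmul_eq_mul]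
    push_cast
    linarith

theorem nrm_errQ_le_one {r : ℝ} {K : Gains} {y : Motion} {t : ℝ} (h : InTube S D r K y t)
    (j : Fin 4) : nrm (errQ S D K y j t) ≤ 1 := by
  obtain ⟨I, -, ht, hc⟩ := h.closed
  rw [← abs_of_nonneg (nrm_nonneg _), ← sq_le_one_iff_abs_le_one]
  exact hc.errQ_sq_le_one ht j

theorem SO3.nrm_transpose_mulVec {R : M3} (h : R ∈ SO3) (a : V3) : nrm (Rᵀ *ᵥ a) = nrm a :=
  SO3.nrm_mulVec (SO3.transpose_mem h) a

/-- The disturbances of the load are bounded by the cable direction errors. -/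
theorem exists_gap_le (hbdd : D.IsBounded) :
    ∃ C : ℝ, 0 < C ∧ ∀ K y t, InTube S D 1 K y t →
      nrm (forceGap S D K y t) ≤ C * ∑ j, nrm (errQ S D K y j t) ∧
      nrm (momentGap S D K y t) ≤ C * ∑ j, nrm (errQ S D K y j t) := by
  obtain ⟨C, hC, h⟩ := exists_nrm_desMu_sub_le (S := S) hbdd
  have hr : ∀ j, nrm (S.r j) ≤ ∑ j, nrm (S.r j) := fun j =>
    Finset.single_le_sum (f := fun j => nrm (S.r j)) (fun _ _ => nrm_nonneg _) (Finset.mem_univ j)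
  set ρ := ∑ j, nrm (S.r j)
  have hρ : 0 ≤ ρ := Finset.sum_nonneg fun _ _ => nrm_nonneg _
  refine ⟨C * (ρ + 1), by positivity, fun K y t ht => ?_⟩
  have hst := ht.state
  obtain ⟨I, -, htI, hc⟩ := ht.closed
  have h1 : ∀ j, nrm (mu S D K y j t - desMu S D K y j t) ≤ C * nrm (errQ S D K y j t) := by
    intro j
    rw [hc.nrm_mu_sub htI]
    exact mul_le_mul_of_nonneg_right (h K y t ht j).2 (nrm_nonneg _)
  have h0 : 0 ≤ ∑ j, nrm (errQ S D K y j t) := Finset.sum_nonneg fun _ _ => nrm_nonneg _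
  constructor
  · refine (nrm_sum_le _ _).trans ((Finset.sum_le_sum fun j _ => h1 j).trans ?_)
    rw [← Finset.mul_sum]
    exact mul_le_mul_of_nonneg_right (by nlinarith) h0
  · refine (nrm_sum_le _ _).trans ?_
    have h2 : ∀ j ∈ (Finset.univ : Finset (Fin 4)),
        nrm (hat (S.r j) *ᵥ ((y.R t)ᵀ *ᵥ (mu S D K y j t - desMu S D K y j t)))
          ≤ (C * ρ) * nrm (errQ S D K y j t) := by
      intro j _
      rw [LoadTransport.hat_mulVec]
      refine (nrm_cross_le _ _).trans ?_
      rw [SO3.nrm_transpose_mulVec hst.R_mem]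
      calc _ ≤ ρ * (C * nrm (errQ S D K y j t)) :=
            mul_le_mul (hr j) (h1 j) (nrm_nonneg _) hρ
        _ = _ := by ring
    refine (Finset.sum_le_sum h2).trans ?_
    rw [← Finset.mul_sum]
    exact mul_le_mul_of_nonneg_right (by nlinarith) h0

end Tube

/-! ### Bounded rates of the load errors, the cable forces and the desired directions. -/

section DerivativeBounds

variable {S : Params} {D : Reference}

theorem nrm_desΩ {y : Motion} {t : ℝ} (h : y.IsState t) : nrm (desΩ D y t) = nrm (D.Ω t) := by
  rw [desΩ_eq, SO3.nrm_transpose_mulVec (relRot_mem h)]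

theorem nrm_le_of_nrm_mulVec_le {A : M3} {c : ℝ} (hc : 0 < c)
    (hA : ∀ v : V3, c * nrm v ^ 2 ≤ v ⬝ᵥ (A *ᵥ v)) (v : V3) : nrm v ≤ nrm (A *ᵥ v) / c := by
  rw [le_div_iff₀ hc]
  rcases (nrm_nonneg v).eq_or_lt with h | h
  · rw [← h, zero_mul]; exact nrm_nonneg _
  · have := (hA v).trans (dot_le v (A *ᵥ v))
    nlinarith

theorem nrm_errR_le_one {y : Motion} {t : ℝ} (h : y.IsState t) : nrm (errR D y t) ≤ 1 := by
  rw [errR_eq]; exact SO3.nrm_skewPart_le_one (relRot_mem h)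

/-- The cable subsystem enters only through the moment gap, bounded because `‖e_q‖ ≤ 1`; hence one
constant serves all cable gains. -/
theorem exists_nrm_deriv_errΩ_le (hrank : 6 ≤ S.grasp.rank) (hbdd : D.IsBounded) :
    ∃ C : ℝ, ∀ K y t, InTube S D 1 K y t → nrm (deriv (errΩ D y) t) ≤ C := by
  obtain ⟨G, hG, hgap⟩ := exists_gap_le (S := S) hbdd
  obtain ⟨B, hB⟩ := hbdd
  obtain ⟨c, hc, hJ⟩ := exists_le_dot_mulVec S.JL_posDef
  obtain ⟨b, hb, hJb⟩ := exists_nrm_mulVec_le S.JL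
  refine ⟨(1 + 1 + b + b * B + B * b + b * B + G * 4) / c, fun K y t h => ?_⟩
  have hst := h.state
  obtain ⟨I, hI, ht, hcl⟩ := h.closed
  refine (nrm_le_of_nrm_mulVec_le hc hJ _).trans (div_le_div_of_nonneg_right ?_ hc.le)
  rw [hcl.inertia_mulVec_deriv_errΩ hrank hI ht, h.unit.2.2.1, h.unit.2.2.2, one_smul, one_smul]
  have he := (nrm_errΩ_le_loadErr (D := D) hst).trans h.small
  have hR := nrm_errR_le_one (D := D) hst
  have hw := (nrm_desΩ (D := D) hst).trans_le (hB t h.nonneg).2.2.1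
  set e := errΩ D y t
  set w := desΩ D y t
  have hB0 : 0 ≤ B := (nrm_nonneg _).trans hw
  have hJe : nrm (S.JL *ᵥ e) ≤ b :=
    (hJb e).trans (by nlinarith)
  have hJw : nrm (S.JL *ᵥ w) ≤ b * B := (hJb w).trans (by nlinarith)
  have x1 : nrm (e ⨯₃ (S.JL *ᵥ e)) ≤ b := (nrm_cross_le _ _).trans
    ((mul_le_mul he hJe (nrm_nonneg _) zero_le_one).trans (by linarith))
  have x2 : nrm (e ⨯₃ (S.JL *ᵥ w)) ≤ b * B := (nrm_cross_le _ _).trans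
    ((mul_le_mul he hJw (nrm_nonneg _) zero_le_one).trans (by linarith))
  have x3 : nrm (w ⨯₃ (S.JL *ᵥ e)) ≤ B * b := (nrm_cross_le _ _).trans
    (mul_le_mul hw hJe (nrm_nonneg _) hB0)
  have x4 : nrm (e ⨯₃ w) ≤ 1 * B := (nrm_cross_le _ _).trans
    (mul_le_mul he hw (nrm_nonneg _) zero_le_one)
  have x5 : nrm (S.JL *ᵥ (e ⨯₃ w)) ≤ b * B := (hJb _).trans
    (mul_le_mul_of_nonneg_left (by linarith) hb.le)
  have x6 : nrm (momentGap S D K y t) ≤ G * 4 := by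
    refine (hgap K y t h).2.trans (mul_le_mul_of_nonneg_left ?_ hG.le)
    refine (Finset.sum_le_sum fun j _ => nrm_errQ_le_one h j).trans ?_
    simp
  refine (nrm_add_le _ _).trans (add_le_add ?_ x6)
  refine (nrm_add_le _ _).trans (add_le_add ?_ x5)
  refine (nrm_sub_le _ _).trans (add_le_add ?_ x3)
  refine (nrm_sub_le _ _).trans (add_le_add ?_ x2)
  refine (nrm_sub_le _ _).trans (add_le_add ?_ x1)
  refine (nrm_sub_le _ _).trans (add_le_add ?_ he)
  rwa [nrm_neg]

theorem exists_nrm_deriv_errV_le (hrank : 6 ≤ S.grasp.rank) (hbdd : D.IsBounded) :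
    ∃ C : ℝ, ∀ K y t, InTube S D 1 K y t → ∃ d, HasDerivAt (errV D y) d t ∧ nrm d ≤ C := by
  obtain ⟨G, hG, hgap⟩ := exists_gap_le (S := S) hbdd
  have hm := S.mL_pos
  refine ⟨1 + 1 + (1 / S.mL) * (G * 4), fun K y t h => ?_⟩
  have hst := h.state
  obtain ⟨I, hI, ht, hcl⟩ := h.closed
  refine ⟨_, hcl.hasDerivAt_errV hrank hI ht, ?_⟩
  rw [h.unit.1, h.unit.2.1, one_smul, one_smul]
  refine (nrm_add_le _ _).trans (add_le_add ((nrm_sub_le _ _).trans (add_le_add ?_ ?_)) ?_)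
  · rw [nrm_neg]; exact (nrm_errX_le_loadErr hst).trans h.small
  · exact (nrm_errV_le_loadErr hst).trans h.small
  · rw [nrm_smul, abs_of_pos (by positivity)]
    refine mul_le_mul_of_nonneg_left ?_ (by positivity)
    refine (hgap K y t h).1.trans (mul_le_mul_of_nonneg_left ?_ hG.le)
    refine (Finset.sum_le_sum fun j _ => nrm_errQ_le_one h j).trans ?_
    simp

/-- In a tube around the desired motion, the desired cable forces vary at a bounded rate. -/
theorem exists_hasDerivAt_desMu (hrank : 6 ≤ S.grasp.rank) (hbdd : D.IsBounded) :
    ∃ C : ℝ, 0 < C ∧ ∀ K y t, InTube S D 1 K y t → ∀ j,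
      ∃ d, HasDerivAt (desMu S D K y j) d t ∧ nrm d ≤ C := by
  obtain ⟨CΩ, hCΩ⟩ := exists_nrm_deriv_errΩ_le hrank hbdd
  obtain ⟨CV, hCV⟩ := exists_nrm_deriv_errV_le hrank hbdd
  obtain ⟨B, hB⟩ := hbdd
  let T : Set ((Gains × Motion) × ℝ) := {p | InTube S D 1 p.1.1 p.1.2 p.2}
  let 𝒜 := c1Bounded T
  have hvec : ∀ f : Motion → ℝ → V3, (∃ A A', ∀ p ∈ T, nrm (f p.1.2 p.2) ≤ A ∧
      ∃ d, HasDerivAt (f p.1.2) d p.2 ∧ nrm d ≤ A') →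
      VecIn 𝒜 fun x : (Gains × Motion) × ℝ => f x.1.2 x.2 := by
    rintro f ⟨A, A', h⟩ a
    refine ⟨|A| + |A'|, by positivity, fun p hp => ?_⟩
    obtain ⟨h1, d, hd, h2⟩ := h p hp
    refine ⟨(abs_apply_le_nrm _ a).trans (h1.trans ?_), d a, hasDerivAt_pi.1 hd a,
      (abs_apply_le_nrm d a).trans (h2.trans ?_)⟩
    · linarith [le_abs_self A, abs_nonneg A']
    · linarith [le_abs_self A', abs_nonneg A]
  have hunit : ∀ f : Gains → ℝ, (∀ p ∈ T, f p.1.1 = 1) →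
      (fun x : (Gains × Motion) × ℝ => f x.1.1) ∈ 𝒜 := fun f hf =>
    ⟨1, zero_le_one, fun p hp => ⟨(congrArg abs (hf p hp)).trans_le (by simp), 0,
      hasDerivAt_const p.2 (f p.1.1), by simp⟩⟩
  have hmat : ∀ (f : Motion → ℝ → M3) (w : Motion → ℝ → V3), (∃ A, ∀ p ∈ T,
      f p.1.2 p.2 ∈ SO3 ∧ nrm (w p.1.2 p.2) ≤ A ∧ ∀ a b,
      HasDerivAt (fun s => f p.1.2 s a b) ((f p.1.2 p.2 * hat (w p.1.2 p.2)) a b) p.2) →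
      MatIn 𝒜 fun x : (Gains × Motion) × ℝ => f x.1.2 x.2 := by
    rintro f w ⟨A, h⟩ a b
    refine ⟨1 + 3 * |A|, by positivity, fun p hp => ?_⟩
    obtain ⟨h1, h2, h3⟩ := h p hp
    refine ⟨(SO3.abs_le_one h1 a b).trans (by linarith [abs_nonneg A]), _, h3 a b,
      (abs_mul_hat_apply_le h1 _ a b).trans ?_⟩
    linarith [le_abs_self A]
  have hR : MatIn 𝒜 fun x : (Gains × Motion) × ℝ => x.1.2.R x.2 := by
    refine hmat (fun y t => y.R t) (fun y t => y.Ω t) ⟨1 + B, fun p hp => ?_⟩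
    have hst := hp.state
    obtain ⟨I, hI, ht, hc⟩ := hp.closed
    refine ⟨hst.R_mem, ?_, hc.att_kin ht⟩
    have : p.1.2.Ω p.2 = errΩ D p.1.2 p.2 + desΩ D p.1.2 p.2 := by rw [errΩ]; abel
    rw [this]
    refine (nrm_add_le _ _).trans (add_le_add ((nrm_errΩ_le_loadErr hst).trans hp.small) ?_)
    rw [nrm_desΩ hst]; exact (hB p.2 hp.nonneg).2.2.1
  have hDR : MatIn 𝒜 fun x : (Gains × Motion) × ℝ => D.R x.2 :=
    hmat (fun _ t => D.R t) (fun _ t => D.Ω t)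
      ⟨B, fun p hp => ⟨D.R_mem p.2, (hB p.2 hp.nonneg).2.2.1, D.R_kin p.2⟩⟩
  have hX : VecIn 𝒜 fun x : (Gains × Motion) × ℝ => errX D x.1.2 x.2 := by
    refine hvec (errX D) ⟨1, 1, fun p hp => ?_⟩
    have hst := hp.state
    obtain ⟨I, hI, ht, hc⟩ := hp.closed
    exact ⟨(nrm_errX_le_loadErr hst).trans hp.small, _, hc.hasDerivAt_errX ht,
      (nrm_errV_le_loadErr hst).trans hp.small⟩
  have hV : VecIn 𝒜 fun x : (Gains × Motion) × ℝ => errV D x.1.2 x.2 :=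
    hvec (errV D) ⟨1, CV, fun p hp => ⟨(nrm_errV_le_loadErr hp.state).trans hp.small,
      hCV _ _ _ hp⟩⟩
  have hΩ : VecIn 𝒜 fun x : (Gains × Motion) × ℝ => errΩ D x.1.2 x.2 := by
    refine hvec (errΩ D) ⟨1, CΩ, fun p hp => ?_⟩
    have hst := hp.state
    have h := hCΩ _ _ _ hp
    obtain ⟨I, hI, ht, hc⟩ := hp.closed
    exact ⟨(nrm_errΩ_le_loadErr hst).trans hp.small, _, hc.hasDerivAt_errΩ ht, h⟩
  have hDv : VecIn 𝒜 fun x : (Gains × Motion) × ℝ => deriv D.v x.2 :=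
    hvec (fun _ t => deriv D.v t) ⟨B, B, fun p hp => ⟨(hB p.2 hp.nonneg).1, _,
      hasDerivAt_of_smooth D.dv_smooth p.2, (hB p.2 hp.nonneg).2.1⟩⟩
  have hDΩ : VecIn 𝒜 fun x : (Gains × Motion) × ℝ => D.Ω x.2 :=
    hvec (fun _ t => D.Ω t) ⟨B, B, fun p hp => ⟨(hB p.2 hp.nonneg).2.2.1, _,
      hasDerivAt_of_smooth D.Ω_smooth p.2, (hB p.2 hp.nonneg).2.2.2.1⟩⟩
  have hDdΩ : VecIn 𝒜 fun x : (Gains × Motion) × ℝ => deriv D.Ω x.2 :=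
    hvec (fun _ t => deriv D.Ω t) ⟨B, B, fun p hp => ⟨(hB p.2 hp.nonneg).2.2.2.1, _,
      hasDerivAt_of_smooth D.dΩ_smooth p.2, (hB p.2 hp.nonneg).2.2.2.2⟩⟩
  have key := fun j => VecIn.desMu (𝒜 := 𝒜) S D (k := fun x => x.1.1) (y := fun x => x.1.2)
    (τ := fun x => x.2) (hunit Gains.kx fun p hp => hp.unit.1)
    (hunit Gains.kv fun p hp => hp.unit.2.1) (hunit Gains.kR fun p hp => hp.unit.2.2.1)
    (hunit Gains.kΩ fun p hp => hp.unit.2.2.2) hR hDR hX hV hΩ hDv hDΩ hDdΩ j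
  choose c hc0 hc using key
  have hcs : ∀ j a, c j a ≤ ∑ j, ∑ a, c j a := fun j a =>
    (Finset.single_le_sum (f := c j) (fun a _ => hc0 j a) (Finset.mem_univ a)).trans
      (Finset.single_le_sum (f := fun j => ∑ a, c j a)
        (fun j _ => Finset.sum_nonneg fun a _ => hc0 j a) (Finset.mem_univ j))
  have hc'0 : 0 ≤ ∑ j, ∑ a, c j a :=
    Finset.sum_nonneg fun j _ => Finset.sum_nonneg fun a _ => hc0 j a
  refine ⟨3 * (∑ j, ∑ a, c j a) + 1, by positivity, fun K y t h j => ?_⟩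
  choose h1 d hd hdc using fun a => hc j a ((K, y), t) h
  refine ⟨d, hasDerivAt_pi.2 hd, (nrm_le_sum_abs _).trans
    ((Finset.sum_le_sum fun a _ => (hdc a).trans (hcs j a)).trans ?_)⟩
  simp only [Finset.sum_const, Finset.card_univ, Fintype.card_fin, nsmul_eq_mul]
  push_cast
  linarith

theorem nrm_sub_abs_le (a b : V3) : nrm b - nrm (a - b) ≤ nrm a := by
  have := nrm_sub_le a (a - b)
  rw [sub_sub_cancel] at this
  linarith

/-- The derivative of the normalising factor contributes a multiple of `μ̃`, which is parallel to
`q̃` and is lost in the cross product. -/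
theorem desω_eq {K : Gains} {y : Motion} {t : ℝ} {j : Fin 4} {d : V3}
    (hne : desMu S D K y j t ≠ 0) (hd : HasDerivAt (desMu S D K y j) d t) :
    desω S D K y j t
      = -((1 / nrm (desMu S D K y j t)) • (desQ S D K y j t ⨯₃ d)) := by
  have hn := nrm_pos hne
  have hdot := hasDerivAt_dot hd hd
  have hpos : desMu S D K y j t ⬝ᵥ desMu S D K y j t ≠ 0 := by
    rw [← nrm_sq]; positivity
  have hsq := (hdot.sqrt hpos).inv (by exact hn.ne')
  have h := (hsq.smul hd).neg
  have e : desQ S D K y j = -((fun s => Real.sqrt (desMu S D K y j s ⬝ᵥ desMu S D K y j s))⁻¹ •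
      desMu S D K y j) := by
    funext s; rw [desQ, one_div]; rfl
  rw [desω]
  have h' := h.deriv
  rw [← e] at h'
  rw [h', map_neg, map_add, map_smul, map_smul]
  have h0 : desQ S D K y j t ⨯₃ desMu S D K y j t = 0 := by
    rw [desQ, map_neg, map_smul, LinearMap.neg_apply, LinearMap.smul_apply, cross_self]; simp
  rw [h0, smul_zero, add_zero, one_div]
  rfl

/-- Close to the desired motion, the desired cable directions turn at a bounded rate. -/
theorem exists_nrm_desω_le (hrank : 6 ≤ S.grasp.rank) (hbdd : D.IsBounded) (htaut : D.IsTaut S) :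
    ∃ r B : ℝ, 0 < r ∧ r ≤ 1 ∧ 0 < B ∧ ∀ K y t, InTube S D r K y t → ∀ j,
      nrm (desω S D K y j t) ≤ B := by
  obtain ⟨A, hA, hclose⟩ := exists_nrm_desMu_sub_le (S := S) hbdd
  obtain ⟨C, hC, hder⟩ := exists_hasDerivAt_desMu hrank hbdd
  obtain ⟨b, hb, htaut⟩ := htaut
  -- Within this radius `μ̃_j` moves by at most `b / 2` from the required force, so `‖μ̃_j‖ ≥ b /
  -- 2`.
  refine ⟨min 1 (b / (2 * A)), 2 * C / b, by positivity, min_le_left _ _, by positivity,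
    fun K y t h j => ?_⟩
  have h1 : InTube S D 1 K y t := ⟨h.nonneg, h.unit, h.closed, h.small.trans (min_le_left _ _)⟩
  obtain ⟨d, hd, hdC⟩ := hder K y t h1 j
  have hlow : b / 2 ≤ nrm (desMu S D K y j t) := by
    have e1 := nrm_sub_abs_le (desMu S D K y j t) (D.cableForce S j t)
    have e2 := (hclose K y t h1 j).1
    have e3 : A * loadErr D y t ≤ A * (b / (2 * A)) :=
      mul_le_mul_of_nonneg_left (h.small.trans (min_le_right _ _)) hA.le
    have e4 : A * (b / (2 * A)) = b / 2 := by field_simp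
    have e5 := htaut t h.nonneg j
    linarith
  obtain ⟨I, hI, ht, hc⟩ := h.closed
  rw [desω_eq (hc.mu_ne t ht j) hd, nrm_neg, nrm_smul, abs_of_nonneg (by
    have := nrm_nonneg (desMu S D K y j t); positivity)]
  have hq : nrm (desQ S D K y j t) = 1 := by rw [nrm, hc.desQ_unit ht, Real.sqrt_one]
  have h2 := nrm_cross_le (desQ S D K y j t) d
  rw [hq, one_mul] at h2
  have h3 : 1 / nrm (desMu S D K y j t) ≤ 2 / b := by
    rw [div_le_div_iff₀ (by linarith) hb]; linarith
  calc _ ≤ 2 / b * C := mul_le_mul h3 (h2.trans hdC) (nrm_nonneg _) (by positivity)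
    _ = _ := by ring

end DerivativeBounds

/-! ### The desired motion solves the closed loop. -/

section Equilibrium

variable {S : Params} {D : Reference} {t : ℝ}

/-- The smooth real functions. -/
def smoothFunctions : Subalgebra ℝ (ℝ → ℝ) where
  carrier := {f | ContDiff ℝ (⊤ : ℕ∞) f}
  mul_mem' := fun {f g} hf hg => by
    have hf : ContDiff ℝ (⊤ : ℕ∞) f := hf
    have hg : ContDiff ℝ (⊤ : ℕ∞) g := hg
    exact hf.mul hg
  add_mem' := fun {f g} hf hg => by
    have hf : ContDiff ℝ (⊤ : ℕ∞) f := hf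
    have hg : ContDiff ℝ (⊤ : ℕ∞) g := hg
    exact hf.add hg
  algebraMap_mem' := fun c => by
    have : ContDiff ℝ (⊤ : ℕ∞) fun _ : ℝ => c := contDiff_const
    exact this

theorem vecIn_smooth {f : ℝ → V3} : VecIn smoothFunctions f ↔ ContDiff ℝ (⊤ : ℕ∞) f :=
  (contDiff_pi (𝕜 := ℝ) (Φ := f) (n := (⊤ : ℕ∞))).symm

theorem cableForce_smooth (S : Params) (D : Reference) (j : Fin 4) :
    ContDiff ℝ (⊤ : ℕ∞) (D.cableForce S j) := by
  have hΩ := vecIn_smooth.2 D.Ω_smooth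
  have hR : MatIn smoothFunctions D.R := fun a b => D.R_smooth a b
  refine vecIn_smooth.1 (VecIn.distribute S hR
    (((vecIn_smooth.2 D.dv_smooth).add (VecIn.const _)).smul (const_mem_algebra _)) ?_ j)
  exact (VecIn.mulVec (MatIn.hat hΩ) (VecIn.mulVec (MatIn.const S.JL) hΩ)).add
    (VecIn.mulVec (MatIn.const S.JL) (vecIn_smooth.2 D.dΩ_smooth))

/-- The times at which the desired motion keeps all cables taut. -/
def tautSet (S : Params) (D : Reference) : Set ℝ := {t | ∀ j, D.cableForce S j t ≠ 0}

theorem isOpen_tautSet : IsOpen (tautSet S D) := by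
  have : tautSet S D = ⋂ j, {t | D.cableForce S j t ≠ 0} := by ext t; simp [tautSet]
  rw [this]
  exact isOpen_iInter_of_finite fun j =>
    isOpen_ne_fun (cableForce_smooth S D j).continuous continuous_const

theorem refMotion_q_smooth (ht : t ∈ tautSet S D) (j : Fin 4) :
    ContDiffAt ℝ (⊤ : ℕ∞) ((refMotion S D).q j) t := by
  have h := (cableForce_smooth S D j).contDiffAt (x := t)
  have hd : ContDiffAt ℝ (⊤ : ℕ∞)
      (fun s => D.cableForce S j s ⬝ᵥ D.cableForce S j s) t := by
    have h' := contDiffAt_pi.1 h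
    simp only [dotProduct]
    exact ContDiffAt.sum fun i _ => (h' i).mul (h' i)
  have hn := nrm_pos (ht j)
  have hpos : D.cableForce S j t ⬝ᵥ D.cableForce S j t ≠ 0 := by
    rw [← nrm_sq]; positivity
  exact ((contDiffAt_const.div (hd.sqrt hpos) hn.ne').smul h).neg

theorem refMotion_q_contDiffOn (j : Fin 4) :
    ContDiffOn ℝ (⊤ : ℕ∞) ((refMotion S D).q j) (tautSet S D) :=
  fun _ ht => (refMotion_q_smooth ht j).contDiffWithinAt

theorem refMotion_q_hasDerivAt (ht : t ∈ tautSet S D) (j : Fin 4) :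
    HasDerivAt ((refMotion S D).q j) (deriv ((refMotion S D).q j) t) t :=
  ((refMotion_q_smooth ht j).differentiableAt (by simp)).hasDerivAt

theorem refMotion_dq_hasDerivAt (ht : t ∈ tautSet S D) (j : Fin 4) :
    HasDerivAt (deriv ((refMotion S D).q j)) (deriv (deriv ((refMotion S D).q j)) t) t := by
  have h := ((contDiffOn_infty_iff_deriv_of_isOpen isOpen_tautSet).1
    (refMotion_q_contDiffOn (S := S) (D := D) j)).2
  exact ((h.contDiffAt (isOpen_tautSet.mem_nhds ht)).differentiableAt (by simp)).hasDerivAt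

theorem refMotion_q_unit (ht : t ∈ tautSet S D) (j : Fin 4) :
    (refMotion S D).q j t ⬝ᵥ (refMotion S D).q j t = 1 := by
  have hn := nrm_pos (ht j)
  change -((1 / nrm (D.cableForce S j t)) • D.cableForce S j t) ⬝ᵥ
    -((1 / nrm (D.cableForce S j t)) • D.cableForce S j t) = 1
  rw [neg_dotProduct_neg, smul_dotProduct, dotProduct_smul, ← nrm_sq, smul_eq_mul, smul_eq_mul]
  field_simp

theorem refMotion_ω (j : Fin 4) (t : ℝ) :
    (refMotion S D).ω j t = (refMotion S D).q j t ⨯₃ deriv ((refMotion S D).q j) t := rfl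

theorem refMotion_dot_dq (ht : t ∈ tautSet S D) (j : Fin 4) :
    (refMotion S D).q j t ⬝ᵥ deriv ((refMotion S D).q j) t = 0 :=
  dot_deriv_of_unit isOpen_tautSet (refMotion_q_hasDerivAt ht j) ht
    fun _ hs => refMotion_q_unit hs j

theorem refMotion_cable_kin (ht : t ∈ tautSet S D) (j : Fin 4) :
    HasDerivAt ((refMotion S D).q j) ((refMotion S D).ω j t ⨯₃ (refMotion S D).q j t) t := by
  refine (refMotion_q_hasDerivAt ht j).congr_deriv ?_
  rw [refMotion_ω, ← cross_anticomm, cross_cross_self, refMotion_dot_dq ht, refMotion_q_unit ht]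
  simp

theorem refMotion_ω_hasDerivAt (ht : t ∈ tautSet S D) (j : Fin 4) :
    HasDerivAt ((refMotion S D).ω j)
      ((refMotion S D).q j t ⨯₃ deriv (deriv ((refMotion S D).q j)) t) t := by
  refine (hasDerivAt_cross (refMotion_q_hasDerivAt ht j)
    (refMotion_dq_hasDerivAt ht j)).congr_deriv ?_
  rw [cross_self, zero_add]

theorem refMotion_dot_ω (j : Fin 4) (t : ℝ) :
    (refMotion S D).q j t ⬝ᵥ (refMotion S D).ω j t = 0 := by
  rw [refMotion_ω, dot_self_cross]

theorem desQ_refMotion (K : Gains) (j : Fin 4) :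
    desQ S D K (refMotion S D) j = (refMotion S D).q j := by
  funext t; rw [desQ, desMu_refMotion]; rfl

theorem desω_refMotion (K : Gains) (j : Fin 4) :
    desω S D K (refMotion S D) j = (refMotion S D).ω j := by
  funext t; rw [desω, desQ_refMotion, refMotion_ω]

theorem errQ_refMotion (K : Gains) (j : Fin 4) (t : ℝ) :
    errQ S D K (refMotion S D) j t = 0 := by
  rw [errQ, desQ_refMotion, cross_self]

theorem errω_refMotion (K : Gains) (ht : t ∈ tautSet S D) (j : Fin 4) :
    errω S D K (refMotion S D) j t = 0 := by
  rw [errω, desω_refMotion, hat_mul_hat_unit (refMotion_q_unit ht j), refMotion_dot_ω]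
  simp

theorem psiQ_refMotion (K : Gains) (ht : t ∈ tautSet S D) (j : Fin 4) :
    psiQ S D K (refMotion S D) j t = 0 := by
  rw [psiQ, desQ_refMotion, refMotion_q_unit ht, sub_self]

/-- Without errors `ω̃ = ω ⊥ q`, and only `-q̂² ω'` is left; it equals `ω'`, since `ω' = q × q''` is
normal to `q`. -/
theorem cableFeedback_refMotion (K : Gains) (ht : t ∈ tautSet S D) (j : Fin 4) :
    cableFeedback S D K (refMotion S D) j t = deriv ((refMotion S D).ω j) t := by
  rw [cableFeedback, errQ_refMotion, errω_refMotion K ht, desω_refMotion,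
    hat_mul_hat_unit (refMotion_q_unit ht j), refMotion_dot_ω,
    (refMotion_ω_hasDerivAt ht j).deriv, dot_self_cross]
  simp

theorem mu_refMotion (K : Gains) (ht : t ∈ tautSet S D) (j : Fin 4) :
    mu S D K (refMotion S D) j t = D.cableForce S j t := by
  have hn := nrm_pos (ht j)
  rw [mu, desMu_refMotion]
  change (-((1 / nrm (D.cableForce S j t)) • D.cableForce S j t) ⬝ᵥ D.cableForce S j t) •
    -((1 / nrm (D.cableForce S j t)) • D.cableForce S j t) = _
  rw [neg_dotProduct, smul_dotProduct, ← nrm_sq, smul_eq_mul]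
  match_scalars
  field_simp

/-- The desired motion is a motion of the closed loop as long as it keeps the cables taut. -/
theorem isClosedLoop_refMotion (hrank : 6 ≤ S.grasp.rank) (K : Gains) {I : Set ℝ} (hI : IsOpen I)
    (hsub : I ⊆ tautSet S D) : IsClosedLoop S D K (refMotion S D) I := by
  have hstate : ∀ t ∈ I, (refMotion S D).IsState t := fun t ht =>
    { R_mem := D.R_mem t
      q_unit := refMotion_q_unit (hsub ht)
      ω_perp := fun j => refMotion_dot_ω j t
      Rq_mem := fun _ => SO3.one_mem
      v_diff := (hasDerivAt_of_smooth D.v_smooth t).differentiableAt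
      Ω_diff := (hasDerivAt_of_smooth D.Ω_smooth t).differentiableAt
      ω_diff := fun j => (refMotion_ω_hasDerivAt (hsub ht) j).differentiableAt
      Ωq_diff := fun _ => differentiableAt_const _ }
  have hdω : ∀ t ∈ I, ∀ j, deriv ((refMotion S D).ω j) t
      = cableFeedback S D K (refMotion S D) j t
        - ((refMotion S D).q j t ⬝ᵥ cableFeedback S D K (refMotion S D) j t) •
          (refMotion S D).q j t := fun t ht j => by
    rw [cableFeedback_refMotion K (hsub ht), (refMotion_ω_hasDerivAt (hsub ht) j).deriv,
      dot_self_cross, zero_smul, sub_zero]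
  have hctrl : ∀ t ∈ I, ∀ j, uPar S D K (refMotion S D) j t + uPerp S D K (refMotion S D) j t
      + (S.mQ * S.L) • deriv (deriv ((refMotion S D).q j)) t
      = mu S D K (refMotion S D) j t + S.mQ • (deriv (refMotion S D).v t + S.g • e3
        + (refMotion S D).bodyAcc S j t) := fun t ht j =>
    control_add_cable (refMotion_q_unit (hsub ht) j) (refMotion_dot_ω j t) (hdω t ht j)
      (deriv_deriv_cable hI ht (fun s hs => refMotion_cable_kin (hsub hs) j)
        ((hstate t ht).ω_diff j))
  refine ⟨fun t ht j => ?_, fun t ht j => ?_, fun t ht j => ?_, fun _ _ => 0, hstate,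
    fun t _ => D.hasDerivAt_x t, fun t _ => D.R_kin t,
    fun t ht j => refMotion_cable_kin (hsub ht) j, fun t ht => ?_, fun t ht => ?_,
    fun t ht j => ?_, fun t _ j a b => ?_, fun t _ j => ?_⟩
  · rw [desMu_refMotion]; exact hsub ht j
  · rw [desQ_refMotion]; exact (refMotion_q_hasDerivAt (hsub ht) j).differentiableAt
  · rw [desω_refMotion]; exact (refMotion_ω_hasDerivAt (hsub ht) j).differentiableAt
  -- Eliminating the cables is an equivalence, so the load equations may be checked in eliminated
  -- form, where the cable forces have the required sum.
  · refine (force_balance_iff S _ _ _ _ _ fun j => hctrl t ht j).2 ?_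
    simp only [mu_refMotion K (hsub ht)]
    exact (sum_distribute hrank (D.R_mem t) _ _).symm
  · refine (moment_balance_iff S (D.R_mem t) _ _ _ _ _ _ fun j => hctrl t ht j).2 ?_
    simp only [mu_refMotion K (hsub ht)]
    exact (add_comm _ _).trans (sum_hat_distribute hrank (D.R_mem t) _ _).symm
  · rw [cable_dyn_rhs (refMotion_q_unit (hsub ht) j)]; exact hdω t ht j
  · refine (hasDerivAt_const t ((1 : M3) a b)).congr_deriv ?_
    simp [refMotion, hat_zero]
  · simp [refMotion]

/-- The zero tracking error is an equilibrium of the closed loop, whatever the gains. -/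
theorem zeroIsEquilibrium (hrank : 6 ≤ S.grasp.rank) (htaut : D.IsTaut S) (K : Gains) :
    ZeroIsEquilibrium S D K := by
  obtain ⟨b, hb, hD⟩ := htaut
  have hnn : ∀ t, 0 ≤ t → t ∈ tautSet S D := fun t ht j h0 => by
    have := hD t ht j
    rw [h0, nrm_zero] at this
    linarith
  -- Tautness is assumed from time `0` on; as an open condition it persists a little before `0`,
  -- which makes the time interval open.
  obtain ⟨ε, hε, hball⟩ := Metric.isOpen_iff.1 isOpen_tautSet 0 (hnn 0 le_rfl)
  have hsub : Set.Ioi (-ε) ⊆ tautSet S D := by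
    intro t ht
    rcases le_or_gt 0 t with h | h
    · exact hnn t h
    · refine hball ?_
      rw [Metric.mem_ball, Real.dist_eq, sub_zero, abs_of_neg h]
      linarith [Set.mem_Ioi.1 ht]
  refine ⟨refMotion S D, Set.Ioi (-ε), isOpen_Ioi, Set.ordConnected_Ioi,
    fun t ht => lt_of_lt_of_le (neg_lt_zero.2 hε) ht,
    isClosedLoop_refMotion hrank K isOpen_Ioi hsub, fun t ht => ⟨?_, psiR_refMotion S D t,
      psiQ_refMotion K (hnn t ht)⟩⟩
  simp [errNorm, errX_refMotion, errV_refMotion, errR_refMotion, errΩ_refMotion, errQ_refMotion,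
    errω_refMotion K (hnn t ht), nrm_zero]

end Equilibrium

/-! ### Energy and Lyapunov function of a cable error. -/

section CableLyapunov

variable {S : Params} {D : Reference} {K : Gains} {y : Motion} {I : Set ℝ} {t : ℝ}

/-- The energy of a cable error. -/
noncomputable def cableEnergy (S : Params) (D : Reference) (K : Gains) (y : Motion) (j : Fin 4)
    (t : ℝ) : ℝ :=
  (1 / 2) * (errω S D K y j t ⬝ᵥ errω S D K y j t) + K.kq * psiQ S D K y j t

/-- The Lyapunov function of a cable error. -/
noncomputable def cableLyap (S : Params) (D : Reference) (K : Gains) (y : Motion) (j : Fin 4)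
    (t : ℝ) : ℝ :=
  cableEnergy S D K y j t + (K.kω / 4) * (errQ S D K y j t ⬝ᵥ errω S D K y j t)

/-- The work of the term `k_q e_q` cancels against the rate of `k_q Ψ_q`. No bound on `ω̃` is
needed, so this holds also outside the tube. -/
theorem IsClosedLoop.hasDerivAt_cableEnergy (hI : IsOpen I) (hc : IsClosedLoop S D K y I)
    (ht : t ∈ I) (j : Fin 4) :
    HasDerivAt (cableEnergy S D K y j) (-K.kω * nrm (errω S D K y j t) ^ 2) t := by
  have hω := hc.hasDerivAt_errω ht j
  have h := ((hasDerivAt_dot hω hω).const_mul (1 / 2)).add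
    ((hc.hasDerivAt_psiQ hI ht j).const_mul K.kq)
  refine h.congr_deriv ?_
  rw [dotProduct_comm _ (errω S D K y j t), nrm_sq]
  simp only [dotProduct_add, dotProduct_sub, dotProduct_neg, dotProduct_smul, smul_eq_mul]
  rw [dotProduct_comm _ (y.q j t), hc.dot_errω ht, dotProduct_comm _ (errQ S D K y j t)]
  ring

/-- The energy of a cable error does not increase. -/
theorem IsClosedLoop.cableEnergy_le (hI : IsOpen I) (hIc : I.OrdConnected)
    (hc : IsClosedLoop S D K y I) (hk : 0 ≤ K.kω) {t₀ : ℝ} (ht₀ : t₀ ∈ I) (ht : t ∈ I)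
    (hle : t₀ ≤ t) (j : Fin 4) : cableEnergy S D K y j t ≤ cableEnergy S D K y j t₀ := by
  have hsub : Set.Icc t₀ t ⊆ I := hIc.out ht₀ ht
  refine antitoneOn_of_deriv_nonpos (convex_Icc t₀ t)
    (fun s hs => (hc.hasDerivAt_cableEnergy hI (hsub hs) j).continuousAt.continuousWithinAt)
    (fun s hs => (hc.hasDerivAt_cableEnergy hI (hsub (interior_subset hs))
      j).differentiableAt.differentiableWithinAt) (fun s hs => ?_)
    (Set.left_mem_Icc.2 hle) (Set.right_mem_Icc.2 hle) hle
  rw [(hc.hasDerivAt_cableEnergy hI (hsub (interior_subset hs)) j).deriv]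
  nlinarith [mul_nonneg hk (sq_nonneg (nrm (errω S D K y j s)))]

theorem IsClosedLoop.half_errQ_sq_le (hc : IsClosedLoop S D K y I) (ht : t ∈ I) (j : Fin 4) :
    nrm (errQ S D K y j t) ^ 2 ≤ 2 * psiQ S D K y j t := by
  rw [hc.errQ_sq ht]; nlinarith [sq_nonneg (psiQ S D K y j t)]

/-- The gains make `e_ω` and `k e_q` comparable. The cross term costs at most an eighth of each
square, out of the halves supplied by the energy. -/
theorem IsClosedLoop.le_cableLyap (hc : IsClosedLoop S D K y I) (ht : t ∈ I) {k : ℝ} (hk : 0 < k)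
    (hkω : K.kω = k) (hkq : K.kq = k ^ 2) (j : Fin 4) :
    (3 / 8) * (nrm (errω S D K y j t) ^ 2 + k ^ 2 * nrm (errQ S D K y j t) ^ 2)
      ≤ cableLyap S D K y j t := by
  have h1 := neg_dot_le (errQ S D K y j t) (errω S D K y j t)
  have h2 := mul_le_mul_of_nonneg_left (hc.half_errQ_sq_le ht j) (sq_nonneg k)
  rw [cableLyap, cableEnergy, ← nrm_sq, hkω, hkq]
  have h3 := mul_le_mul_of_nonneg_left h1 (by positivity : 0 ≤ k / 4)
  nlinarith [sq_nonneg (nrm (errω S D K y j t) - k * nrm (errQ S D K y j t))]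

/-- Here `Ψ_q ≤ 1` is essential: it gives `Ψ_q ≤ ‖e_q‖²`, which fails near the antipode. -/
theorem IsClosedLoop.cableLyap_le (hc : IsClosedLoop S D K y I) (ht : t ∈ I) {k : ℝ} (hk : 0 < k)
    (hkω : K.kω = k) (hkq : K.kq = k ^ 2) {j : Fin 4} (hψ : psiQ S D K y j t ≤ 1) :
    cableLyap S D K y j t
      ≤ (9 / 8) * (nrm (errω S D K y j t) ^ 2 + k ^ 2 * nrm (errQ S D K y j t) ^ 2) := by
  have h1 := dot_le (errQ S D K y j t) (errω S D K y j t)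
  have h0 : psiQ S D K y j t ≤ nrm (errQ S D K y j t) ^ 2 := by
    rw [hc.errQ_sq ht]; nlinarith [hc.psiQ_nonneg ht j]
  have h2 := mul_le_mul_of_nonneg_left h0 (sq_nonneg k)
  rw [cableLyap, cableEnergy, ← nrm_sq, hkω, hkq]
  have h3 := mul_le_mul_of_nonneg_left h1 (by positivity : 0 ≤ k / 4)
  nlinarith [sq_nonneg (nrm (errω S D K y j t) - k * nrm (errQ S D K y j t)),
    sq_nonneg (nrm (errω S D K y j t))]

/-- Decay of the cable errors for high gains. -/
theorem IsClosedLoop.hasDerivAt_cableLyap (hI : IsOpen I) (hc : IsClosedLoop S D K y I)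
    (ht : t ∈ I) {k : ℝ} (hk : 0 < k) (hkω : K.kω = k) (hkq : K.kq = k ^ 2) {j : Fin 4}
    (hB : nrm (desω S D K y j t) ≤ k) :
    ∃ d, HasDerivAt (cableLyap S D K y j) d t ∧
      d ≤ -(k / 8) * (nrm (errω S D K y j t) ^ 2 + k ^ 2 * nrm (errQ S D K y j t) ^ 2) := by
  have h := (hc.hasDerivAt_cableEnergy hI ht j).add
    ((hasDerivAt_dot (hc.hasDerivAt_errQ hI ht j) (hc.hasDerivAt_errω ht j)).const_mul (K.kω / 4))
  refine ⟨_, h, ?_⟩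
  simp only [dotProduct_add, dotProduct_sub, dotProduct_neg, dotProduct_smul, add_dotProduct,
    sub_dotProduct, smul_dotProduct, smul_eq_mul]
  rw [hc.dot_errω ht, dotProduct_comm (errQ S D K y j t) (y.q j t), dot_errQ, ← nrm_sq, ← nrm_sq,
    hkω, hkq]
  have h1 := dot_le (desω S D K y j t ⨯₃ errQ S D K y j t) (errω S D K y j t)
  have h2 := nrm_cross_le (desω S D K y j t) (errQ S D K y j t)
  have h3 : desQ S D K y j t ⬝ᵥ y.q j t ≤ 1 := by
    have := hc.psiQ_nonneg ht j
    rw [psiQ] at this; linarith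
  have h4 := neg_dot_le (errQ S D K y j t) (errω S D K y j t)
  set a := nrm (errω S D K y j t)
  set p := nrm (errQ S D K y j t)
  have ha : 0 ≤ a := nrm_nonneg _
  have hp : 0 ≤ p := nrm_nonneg _
  -- The rotation of the desired direction, bounded by `k`, costs no more than the mixed term of the
  -- damping.
  have h5 : (desω S D K y j t ⨯₃ errQ S D K y j t) ⬝ᵥ errω S D K y j t ≤ k * p * a :=
    h1.trans (mul_le_mul_of_nonneg_right (h2.trans (mul_le_mul_of_nonneg_right hB hp)) ha)
  have h6 := mul_le_mul_of_nonneg_right h3 (sq_nonneg a)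
  have h7 := mul_le_mul_of_nonneg_left h4 hk.le
  set X := (desω S D K y j t ⨯₃ errQ S D K y j t) ⬝ᵥ errω S D K y j t
  set Y := (desQ S D K y j t ⬝ᵥ y.q j t) * a ^ 2
  set Z := errQ S D K y j t ⬝ᵥ errω S D K y j t
  have h8 : X + Y + -(k ^ 2 * p ^ 2) - k * Z ≤ 2 * (k * p * a) + a ^ 2 - k ^ 2 * p ^ 2 := by
    linarith
  have h9 := mul_le_mul_of_nonneg_left h8 (by positivity : 0 ≤ k / 4)
  have h10 : -k * a ^ 2 + k / 4 * (2 * (k * p * a) + a ^ 2 - k ^ 2 * p ^ 2)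
      ≤ -(k / 8) * (a ^ 2 + k ^ 2 * p ^ 2) := by
    -- Positive as a form in `a` and `k p`, because `(1/2)² < 4 · (5/8) · (1/8)`.
    have : 0 ≤ 5 / 8 * a ^ 2 + 1 / 8 * (k * p) ^ 2 - 1 / 2 * (k * p) * a := by
      nlinarith [sq_nonneg (2 * a - k * p), sq_nonneg a]
    nlinarith [mul_nonneg hk.le this]
  linarith

end CableLyapunov

/-! ### Lyapunov function of the load errors. -/

section LoadLyapunov

variable {S : Params} {D : Reference}

/-- The Lyapunov function of the load errors. -/
noncomputable def loadLyap (S : Params) (D : Reference) (c : ℝ) (y : Motion) (t : ℝ) : ℝ :=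
  (1 / 2) * (errV D y t ⬝ᵥ errV D y t) + (1 / 2) * (errX D y t ⬝ᵥ errX D y t)
    + (1 / 2) * (errX D y t ⬝ᵥ errV D y t)
    + (1 / 2) * (errΩ D y t ⬝ᵥ (S.JL *ᵥ errΩ D y t)) + psiR D y t
    + c * (errR D y t ⬝ᵥ (S.JL *ᵥ errΩ D y t))

theorem inertia_symm (S : Params) (a b : V3) : (S.JL *ᵥ a) ⬝ᵥ b = a ⬝ᵥ (S.JL *ᵥ b) := by
  have h : S.JLᵀ = S.JL := (conjTranspose_eq_transpose_of_trivial S.JL).symm.trans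
    S.JL_posDef.isHermitian.eq
  rw [dotProduct_mulVec, ← mulVec_transpose, h]

/-- By symmetry of `J_L` both sides are the triple product of `e`, `w`, `J_L e`; this removes the
mixed gyroscopic terms from the energy rate. -/
theorem inertia_cross (S : Params) (e w : V3) :
    e ⬝ᵥ (w ⨯₃ (S.JL *ᵥ e)) = e ⬝ᵥ (S.JL *ᵥ (e ⨯₃ w)) := by
  rw [← inertia_symm, triple_product_permutation, triple_product_permutation]

/-- A weight for the cross term of the attitude Lyapunov function. -/
theorem exists_cross_weight {σ b m : ℝ} (hσ : 0 < σ) (hb : 0 < b) :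
    ∃ c : ℝ, 0 < c ∧ c ≤ 1 / 2 ∧ (c * b) ^ 2 ≤ σ / 4 ∧ c * (10 * b + m ^ 2 / 2) ≤ 1 / 2 := by
  have hp : 0 < 10 * b + m ^ 2 / 2 := by positivity
  -- The second entry keeps the Lyapunov function positive definite, the third keeps the indefinite
  -- terms of the cross rate below half of the damping.
  refine ⟨min (1 / 2) (min (min 1 σ / (2 * b)) (1 / (2 * (10 * b + m ^ 2 / 2)))), by positivity,
    min_le_left _ _, ?_, ?_⟩
  all_goals set c := min (1 / 2) (min (min 1 σ / (2 * b)) (1 / (2 * (10 * b + m ^ 2 / 2)))) with hc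
  · have hc0 : 0 < c := by positivity
    have h0 : c ≤ min 1 σ / (2 * b) := (min_le_right _ _).trans (min_le_left _ _)
    have hc2 : c * b ≤ min 1 σ / 2 := by
      calc c * b ≤ min 1 σ / (2 * b) * b := mul_le_mul_of_nonneg_right h0 hb.le
        _ = _ := by field_simp
    have h1 : min 1 σ ≤ 1 := min_le_left _ _
    have h2 : min 1 σ ≤ σ := min_le_right _ _
    have h3 : 0 < min 1 σ := lt_min one_pos hσ
    calc (c * b) ^ 2 ≤ (min 1 σ / 2) ^ 2 := pow_le_pow_left₀ (by positivity) hc2 2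
      _ = min 1 σ * min 1 σ / 4 := by ring
      _ ≤ 1 * σ / 4 := by gcongr
      _ = _ := by ring
  · have : c ≤ 1 / (2 * (10 * b + m ^ 2 / 2)) := (min_le_right _ _).trans (min_le_right _ _)
    calc _ ≤ 1 / (2 * (10 * b + m ^ 2 / 2)) * (10 * b + m ^ 2 / 2) :=
          mul_le_mul_of_nonneg_right this hp.le
      _ = _ := by field_simp

theorem abs_cross_term_le {b : ℝ} (hJb : ∀ v, nrm (S.JL *ᵥ v) ≤ b * nrm v) (r e : V3) :
    |r ⬝ᵥ (S.JL *ᵥ e)| ≤ b * (nrm r * nrm e) :=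
  (abs_dot_le _ _).trans (by nlinarith [mul_le_mul_of_nonneg_left (hJb e) (nrm_nonneg r)])

theorem le_loadLyap {σ b c : ℝ} (hJ : ∀ v : V3, σ * nrm v ^ 2 ≤ v ⬝ᵥ (S.JL *ᵥ v))
    (hJb : ∀ v, nrm (S.JL *ᵥ v) ≤ b * nrm v) (hc : 0 ≤ c) (hcb : (c * b) ^ 2 ≤ σ / 4)
    {y : Motion} {t : ℝ} (hst : y.IsState t) :
    min (1 / 4) (σ / 4) * loadErr D y t ^ 2 ≤ loadLyap S D c y t := by
  have hs := loadErr_sq (D := D) hst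
  have hR := errR_sq (D := D) hst
  have hψ := psiR_nonneg (D := D) hst
  have x1 := neg_dot_le (errX D y t) (errV D y t)
  have x2 := (abs_le.1 (abs_cross_term_le hJb (errR D y t) (errΩ D y t))).1
  have x3 := hJ (errΩ D y t)
  rw [loadLyap, ← nrm_sq, ← nrm_sq, hs]
  generalize nrm (errX D y t) = x at *
  generalize nrm (errV D y t) = v at *
  generalize nrm (errR D y t) = r at *
  generalize nrm (errΩ D y t) = e at *
  generalize psiR D y t = ψ at *
  have hr2 : r ^ 2 ≤ 2 * ψ := by rw [hR]; linarith [sq_nonneg ψ]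
  have xv : x * v ≤ (x ^ 2 + v ^ 2) / 2 := by linarith [sq_nonneg (x - v)]
  have z1 : c * (b * (r * e)) ≤ σ / 4 * e ^ 2 + 1 / 4 * r ^ 2 := by
    linarith [sq_nonneg (c * b * e - r / 2), mul_le_mul_of_nonneg_right hcb (sq_nonneg e)]
  have z2 := mul_le_mul_of_nonneg_left x2 hc
  have z3 : min (1 / 4) (σ / 4) * (x ^ 2 + v ^ 2 + ψ + e ^ 2)
      ≤ 1 / 4 * (x ^ 2 + v ^ 2 + ψ) + σ / 4 * e ^ 2 := by
    have y1 := mul_le_mul_of_nonneg_right (min_le_left (1 / 4) (σ / 4))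
      (by positivity : 0 ≤ x ^ 2 + v ^ 2 + ψ)
    have y2 := mul_le_mul_of_nonneg_right (min_le_right (1 / 4) (σ / 4)) (sq_nonneg e)
    linarith
  linarith

theorem loadLyap_le {b c : ℝ} (hb : 0 ≤ b) (hJb : ∀ v, nrm (S.JL *ᵥ v) ≤ b * nrm v) (hc : 0 ≤ c)
    (hc1 : c ≤ 1) {y : Motion} {t : ℝ} (hst : y.IsState t) :
    loadLyap S D c y t ≤ (1 + b) * loadErr D y t ^ 2 := by
  have hs := loadErr_sq (D := D) hst
  have hR := errR_sq (D := D) hst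
  have hψ := psiR_nonneg (D := D) hst
  have x1 := dot_le (errX D y t) (errV D y t)
  have x2 := (abs_le.1 (abs_cross_term_le hJb (errR D y t) (errΩ D y t))).2
  have x3 := (abs_le.1 (abs_cross_term_le hJb (errΩ D y t) (errΩ D y t))).2
  have n3 := nrm_nonneg (errR D y t)
  have n4 := nrm_nonneg (errΩ D y t)
  rw [loadLyap, ← nrm_sq, ← nrm_sq, hs]
  generalize nrm (errX D y t) = x at *
  generalize nrm (errV D y t) = v at *
  generalize nrm (errR D y t) = r at *
  generalize nrm (errΩ D y t) = e at *
  generalize psiR D y t = ψ at *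
  have hr2 : r ^ 2 ≤ 2 * ψ := by rw [hR]; linarith [sq_nonneg ψ]
  have xv : x * v ≤ (x ^ 2 + v ^ 2) / 2 := by linarith [sq_nonneg (x - v)]
  have z1 : r * e ≤ (2 * ψ + e ^ 2) / 2 := by linarith [sq_nonneg (r - e)]
  have z2 := mul_le_mul_of_nonneg_left x2 hc
  have z3 : c * (b * (r * e)) ≤ 1 * (b * (r * e)) :=
    mul_le_mul_of_nonneg_right hc1 (by positivity)
  have z4 := mul_le_mul_of_nonneg_left z1 hb
  have z5 : 0 ≤ b * (x ^ 2 + v ^ 2) := by positivity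
  have z6 : 0 ≤ e ^ 2 := sq_nonneg e
  linarith [sq_nonneg x, sq_nonneg v]

theorem translational_rate_le (x v F : V3) {c : ℝ} (hc : 0 ≤ c) :
    v ⬝ᵥ (-x - v + c • F) + x ⬝ᵥ v + (1 / 2) * (v ⬝ᵥ v + x ⬝ᵥ (-x - v + c • F))
      ≤ -(1 / 4) * (nrm x ^ 2 + nrm v ^ 2) + c * ((nrm v + nrm x / 2) * nrm F) := by
  have h1 := mul_le_mul_of_nonneg_left (dot_le v F) hc
  have h2 := mul_le_mul_of_nonneg_left (dot_le x F) hc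
  have h3 := neg_dot_le x v
  simp only [dotProduct_add, dotProduct_sub, dotProduct_neg, dotProduct_smul, smul_eq_mul,
    ← nrm_sq, dotProduct_comm v x]
  linarith [sq_nonneg (nrm x - nrm v)]

theorem attitude_energy_rate (S : Params) (r e w Δ : V3) :
    e ⬝ᵥ (-r - e - e ⨯₃ (S.JL *ᵥ e) - e ⨯₃ (S.JL *ᵥ w) - w ⨯₃ (S.JL *ᵥ e)
      + S.JL *ᵥ (e ⨯₃ w) + Δ) = -(r ⬝ᵥ e) - nrm e ^ 2 + e ⬝ᵥ Δ := by
  simp only [dotProduct_add, dotProduct_sub, dotProduct_neg, dot_self_cross, inertia_cross,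
    ← nrm_sq, dotProduct_comm e r]
  ring

/-- The cross term supplies the decay `-‖e_R‖²` that the energy rate lacks. Of the `10 b`, nine come
from the rate of `e_R` and one from the cubic gyroscopic term, where `‖e_R‖ ≤ 1` is used. -/
theorem attitude_cross_rate_le {b B : ℝ} (hb : 0 ≤ b) (hJb : ∀ v, nrm (S.JL *ᵥ v) ≤ b * nrm v)
    {r r' e w : V3} (Δ : V3) (hr : nrm r ≤ 1) (hw : nrm w ≤ B) (hr' : nrm r' ≤ 9 * nrm e) :
    r' ⬝ᵥ (S.JL *ᵥ e) + r ⬝ᵥ (-r - e - e ⨯₃ (S.JL *ᵥ e) - e ⨯₃ (S.JL *ᵥ w) - w ⨯₃ (S.JL *ᵥ e)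
      + S.JL *ᵥ (e ⨯₃ w) + Δ)
      ≤ 10 * b * nrm e ^ 2 - nrm r ^ 2 + (1 + 3 * (b * B)) * (nrm r * nrm e) + nrm r * nrm Δ := by
  have n1 := nrm_nonneg r
  have n2 := nrm_nonneg e
  have n3 := nrm_nonneg w
  have q5 := dot_le r Δ
  have q7 := neg_dot_le r e
  have j1 := hJb e
  have q6 : r' ⬝ᵥ (S.JL *ᵥ e) ≤ 9 * nrm e * (b * nrm e) :=
    (dot_le _ _).trans (mul_le_mul hr' j1 (nrm_nonneg _) (by positivity))
  have q9 : -(r ⬝ᵥ (e ⨯₃ (S.JL *ᵥ e))) ≤ 1 * (nrm e * (b * nrm e)) :=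
    (neg_dot_le _ _).trans (mul_le_mul hr ((nrm_cross_le _ _).trans
      (mul_le_mul_of_nonneg_left j1 n2)) (nrm_nonneg _) zero_le_one)
  have q10 : -(r ⬝ᵥ (e ⨯₃ (S.JL *ᵥ w))) ≤ nrm r * (nrm e * (b * B)) :=
    (neg_dot_le _ _).trans (mul_le_mul_of_nonneg_left ((nrm_cross_le _ _).trans
      (mul_le_mul_of_nonneg_left ((hJb w).trans (mul_le_mul_of_nonneg_left hw hb)) n2)) n1)
  have q11 : -(r ⬝ᵥ (w ⨯₃ (S.JL *ᵥ e))) ≤ nrm r * (B * (b * nrm e)) :=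
    (neg_dot_le _ _).trans (mul_le_mul_of_nonneg_left ((nrm_cross_le _ _).trans
      (mul_le_mul hw j1 (nrm_nonneg _) (n3.trans hw))) n1)
  have q12 : r ⬝ᵥ (S.JL *ᵥ (e ⨯₃ w)) ≤ nrm r * (b * (nrm e * B)) :=
    (dot_le _ _).trans (mul_le_mul_of_nonneg_left ((hJb _).trans (mul_le_mul_of_nonneg_left
      ((nrm_cross_le _ _).trans (mul_le_mul_of_nonneg_left hw n2)) hb)) n1)
  simp only [dotProduct_add, dotProduct_sub, dotProduct_neg, ← nrm_sq]
  linarith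

theorem load_rate_le {x v r e ψ s F M G q c m κ b : ℝ} (hG : 0 ≤ G) (hq : 0 ≤ q) (hκ : 0 ≤ κ)
    (hc : 0 < c) (hc1 : c ≤ 1 / 2) (hcm : c * (10 * b + m ^ 2 / 2) ≤ 1 / 2)
    (hr : r ^ 2 = ψ * (2 - ψ)) (hψ : 0 ≤ ψ) (hψ1 : ψ ≤ 1)
    (hs : s ^ 2 = x ^ 2 + v ^ 2 + ψ + e ^ 2) (hs0 : 0 ≤ s) (hx0 : 0 ≤ x) (hv0 : 0 ≤ v)
    (hr0 : 0 ≤ r) (he0 : 0 ≤ e) (hF : F ≤ G * q) (hM : M ≤ G * q) :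
    -(1 / 4) * (x ^ 2 + v ^ 2) + κ * ((v + x / 2) * F) + (-e ^ 2 + e * M)
      + c * (10 * b * e ^ 2 - r ^ 2 + m * (r * e) + r * M)
      ≤ -(c / 2) * s ^ 2 + (2 * κ + 3) * G * s * q := by
  have hxs : x ≤ s := abs_le_of_sq_le_sq' (by nlinarith [sq_nonneg v, sq_nonneg e]) hs0 |>.2
  have hvs : v ≤ s := abs_le_of_sq_le_sq' (by nlinarith [sq_nonneg x, sq_nonneg e]) hs0 |>.2
  have hes : e ≤ s := abs_le_of_sq_le_sq' (by nlinarith [sq_nonneg x, sq_nonneg v]) hs0 |>.2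
  have hrs : r ≤ 2 * s := abs_le_of_sq_le_sq' (by
    nlinarith [sq_nonneg x, sq_nonneg v, sq_nonneg e, sq_nonneg ψ]) (by positivity) |>.2
  have hGq : 0 ≤ G * q := mul_nonneg hG hq
  have t1 : (v + x / 2) * F ≤ (2 * s) * (G * q) :=
    (mul_le_mul_of_nonneg_left hF (by positivity)).trans
      (mul_le_mul_of_nonneg_right (by linarith) hGq)
  have t2 : e * M ≤ s * (G * q) :=
    (mul_le_mul_of_nonneg_left hM he0).trans (mul_le_mul_of_nonneg_right hes hGq)
  have t3 : r * M ≤ 2 * s * (G * q) :=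
    (mul_le_mul_of_nonneg_left hM hr0).trans (mul_le_mul_of_nonneg_right hrs hGq)
  have t4 : c * (r * M) ≤ 1 * (2 * s * (G * q)) :=
    (mul_le_mul_of_nonneg_left t3 hc.le).trans
      (mul_le_mul_of_nonneg_right (by linarith) (by positivity))
  have t5 := mul_le_mul_of_nonneg_left t1 hκ
  have t6 : m * (r * e) ≤ r ^ 2 / 2 + m ^ 2 / 2 * e ^ 2 := by linarith [sq_nonneg (r - m * e)]
  have t7 := mul_le_mul_of_nonneg_left t6 hc.le
  have t8 := mul_le_mul_of_nonneg_right hcm (sq_nonneg e)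
  -- For `Ψ ≤ 1`, decay in `‖e_R‖²` is decay in `Ψ`.
  have t9 : ψ ≤ r ^ 2 := by rw [hr]; nlinarith
  have t10 := mul_le_mul_of_nonneg_left t9 hc.le
  have t11 := mul_le_mul_of_nonneg_right hc1 (by positivity : 0 ≤ x ^ 2 + v ^ 2 + e ^ 2)
  have t12 : -(c / 2) * s ^ 2 = -(c / 2) * (x ^ 2 + v ^ 2 + e ^ 2) - c * ψ / 2 := by
    rw [hs]; ring
  linarith [sq_nonneg e]

/-- The load errors decay up to a disturbance caused by the cable errors. -/
theorem exists_loadLyap (hrank : 6 ≤ S.grasp.rank) (hbdd : D.IsBounded) :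
    ∃ c c₁ c₂ c₃ c₄ : ℝ, 0 < c₁ ∧ 0 < c₂ ∧ 0 < c₃ ∧ 0 < c₄ ∧
      (∀ (y : Motion) (t : ℝ), y.IsState t → c₁ * loadErr D y t ^ 2 ≤ loadLyap S D c y t ∧
        loadLyap S D c y t ≤ c₂ * loadErr D y t ^ 2) ∧
      (∀ K y I t, IsOpen I → t ∈ I → IsClosedLoop S D K y I →
        DifferentiableAt ℝ (loadLyap S D c y) t) ∧
      ∀ K y t, InTube S D 1 K y t → deriv (loadLyap S D c y) t
        ≤ -c₃ * loadErr D y t ^ 2 + c₄ * loadErr D y t * ∑ j, nrm (errQ S D K y j t) := by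
  obtain ⟨G, hG, hgap⟩ := exists_gap_le (S := S) hbdd
  obtain ⟨B, hB⟩ := hbdd
  obtain ⟨σ, hσ, hJ⟩ := exists_le_dot_mulVec S.JL_posDef
  obtain ⟨b, hb, hJb⟩ := exists_nrm_mulVec_le S.JL
  have hmL := S.mL_pos
  obtain ⟨c, hc0, hc1, hcb, hcm⟩ := exists_cross_weight (m := 1 + 3 * (b * B)) hσ hb
  have hder : ∀ K y I t, IsOpen I → t ∈ I → IsClosedLoop S D K y I →
      HasDerivAt (loadLyap S D c y) _ t := fun K y I t hI ht hcl =>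
    have dX := hcl.hasDerivAt_errX ht
    have dV := hcl.hasDerivAt_errV hrank hI ht
    have dΩ := hcl.hasDerivAt_errΩ ht
    have dJ := hasDerivAt_const_mulVec S.JL dΩ
    ((((((hasDerivAt_dot dV dV).const_mul (1 / 2)).add
      ((hasDerivAt_dot dX dX).const_mul (1 / 2))).add
      ((hasDerivAt_dot dX dV).const_mul (1 / 2))).add
      ((hasDerivAt_dot dΩ dJ).const_mul (1 / 2))).add (hcl.hasDerivAt_psiR ht)).add
      ((hasDerivAt_dot (hcl.hasDerivAt_errR ht) dJ).const_mul c)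
  refine ⟨c, min (1 / 4) (σ / 4), 1 + b, c / 2, (2 * (1 / S.mL) + 3) * G, by positivity,
    by positivity, by positivity, by positivity, fun y t hst =>
    ⟨le_loadLyap hJ hJb hc0.le hcb hst, loadLyap_le hb.le hJb hc0.le (by linarith) hst⟩,
    fun K y I t hI ht hcl => (hder K y I t hI ht hcl).differentiableAt, fun K y t h => ?_⟩
  have hst := h.state
  have hψ1 : psiR D y t ≤ 1 := (psiR_le_loadErr_sq hst).trans
    (pow_le_one₀ (loadErr_nonneg D y t) h.small)
  have hr1 := nrm_errR_le_one (D := D) hst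
  have hw := (nrm_desΩ (D := D) hst).trans_le (hB t h.nonneg).2.2.1
  obtain ⟨hF, hM⟩ := hgap K y t h
  obtain ⟨I, hI, ht, hcl⟩ := h.closed
  have hJd := hcl.inertia_mulVec_deriv_errΩ hrank hI ht
  rw [h.unit.2.2.1, h.unit.2.2.2, one_smul, one_smul] at hJd
  rw [(hder K y I t hI ht hcl).deriv, ← inertia_symm S (deriv (errΩ D y) t), h.unit.1,
    h.unit.2.1, one_smul, one_smul]
  have r1 := translational_rate_le (errX D y t) (errV D y t) (forceGap S D K y t)
    (by positivity : 0 ≤ 1 / S.mL)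
  have r2 := attitude_energy_rate S (errR D y t) (errΩ D y t) (desΩ D y t) (momentGap S D K y t)
  have r3 := mul_le_mul_of_nonneg_left (attitude_cross_rate_le hb.le hJb (momentGap S D K y t) hr1
    hw (SO3.nrm_skewPart_mul_hat_le (relRot_mem (D := D) hst) (errΩ D y t))) hc0.le
  have r4 := dot_le (errΩ D y t) (momentGap S D K y t)
  have r5 := load_rate_le hG.le (Finset.sum_nonneg fun j _ => nrm_nonneg (errQ S D K y j t))
    (by positivity : 0 ≤ 1 / S.mL) hc0 hc1 hcm (errR_sq hst) (psiR_nonneg hst) hψ1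
    (loadErr_sq hst) (loadErr_nonneg D y t) (nrm_nonneg _) (nrm_nonneg _) (nrm_nonneg _)
    (nrm_nonneg _) hF hM
  rw [← hJd] at r2 r3
  generalize -errX D y t - errV D y t + (1 / S.mL) • forceGap S D K y t = A at *
  generalize S.JL *ᵥ deriv (errΩ D y) t = A' at *
  rw [dotProduct_comm A (errV D y t), dotProduct_comm (errV D y t) (errX D y t),
    dotProduct_comm A' (errΩ D y t)]
  linarith

end LoadLyapunov

/-! ### First exit times, exponential decay and composite rates. -/

section Comparison

/-- A continuous function that stays below a level as long as it does not exceed it. -/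
theorem lt_of_first_exit {f : ℝ → ℝ} {a b ρ : ℝ} (hf : ContinuousOn f (Set.Icc a b))
    (ha : f a < ρ)
    (h : ∀ t ∈ Set.Icc a b, (∀ s ∈ Set.Icc a t, f s ≤ ρ) → f t < ρ) :
    ∀ t ∈ Set.Icc a b, f t < ρ := by
  intro t ht
  by_contra hlt
  push Not at hlt
  have hivt : ∀ s ∈ Set.Icc a b, ρ ≤ f s → ∃ s' ∈ Set.Icc a s, f s' = ρ := fun s hs hρ =>
    intermediate_value_Icc hs.1 (hf.mono (Set.Icc_subset_Icc_right hs.2)) ⟨ha.le, hρ⟩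
  have hK : IsCompact (Set.Icc a b ∩ f ⁻¹' {ρ}) :=
    isCompact_Icc.of_isClosed_subset (hf.preimage_isClosed_of_isClosed isClosed_Icc
      isClosed_singleton) Set.inter_subset_left
  obtain ⟨s₀, hs₀, hs₀'⟩ := hivt t ht hlt
  -- Take the first time at which the level is attained. Exceeding the level earlier would force an
  -- even earlier crossing, so the hypothesis applies at `c`.
  obtain ⟨c, ⟨hc, hcρ⟩, hmin⟩ :=
    hK.exists_isLeast ⟨s₀, ⟨hs₀.1, hs₀.2.trans ht.2⟩, hs₀'⟩
  have hcρ : f c = ρ := hcρ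
  refine absurd (h c hc fun s hs => ?_) (by rw [hcρ]; exact lt_irrefl ρ)
  by_contra hs'
  push Not at hs'
  obtain ⟨s', hs'1, hs'2⟩ := hivt s ⟨hs.1, hs.2.trans hc.2⟩ hs'.le
  have hle : c ≤ s' := hmin ⟨⟨hs'1.1, hs'1.2.trans (hs.2.trans hc.2)⟩, hs'2⟩
  have : s = c := le_antisymm hs.2 (hle.trans hs'1.2)
  rw [this, hcρ] at hs'
  exact lt_irrefl ρ hs'

theorem le_exp_mul_of_deriv_le {W : ℝ → ℝ} {lam a b : ℝ} (hab : a ≤ b)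
    (hd : ∀ s ∈ Set.Icc a b, DifferentiableAt ℝ W s)
    (hle : ∀ s ∈ Set.Icc a b, deriv W s ≤ -lam * W s) :
    W b ≤ Real.exp (-lam * (b - a)) * W a := by
  have hder : ∀ s ∈ Set.Icc a b, HasDerivAt (fun s => Real.exp (lam * s) * W s)
      (Real.exp (lam * s) * (lam * W s + deriv W s)) s := fun s hs => by
    have h := ((((hasDerivAt_id s).const_mul lam).exp).mul (hd s hs).hasDerivAt)
    refine h.congr_deriv ?_
    simp only [id]; ring
  have hanti : Real.exp (lam * b) * W b ≤ Real.exp (lam * a) * W a := by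
    refine antitoneOn_of_deriv_nonpos (f := fun s => Real.exp (lam * s) * W s) (convex_Icc a b)
      (fun s hs => (hder s hs).continuousAt.continuousWithinAt)
      (fun s hs => (hder s (interior_subset hs)).differentiableAt.differentiableWithinAt)
      (fun s hs => ?_) (Set.left_mem_Icc.2 hab) (Set.right_mem_Icc.2 hab) hab
    rw [(hder s (interior_subset hs)).deriv]
    have := hle s (interior_subset hs)
    exact mul_nonpos_of_nonneg_of_nonpos (Real.exp_nonneg _) (by linarith)
  have e : Real.exp (-lam * (b - a)) = Real.exp (lam * a) / Real.exp (lam * b) := by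
    rw [← Real.exp_sub]; congr 1; ring
  rw [e, div_mul_eq_mul_div, le_div_iff₀ (Real.exp_pos _), mul_comm]
  exact hanti

/-- Decay of a composite Lyapunov function, for a large gain of the fast subsystem. -/
theorem composite_rate_le {s L dL c₂ c₃ c₄ ε k lam : ℝ} {p a V dV : Fin 4 → ℝ}
    (hc₃ : 0 < c₃) (hε : 0 < ε) (hk : 0 < k) (hlam : 0 ≤ lam)
    (hdL : dL ≤ -c₃ * s ^ 2 + c₄ * s * ∑ j, p j)
    (hdV : ∀ j, dV j ≤ -(k / 8) * (a j ^ 2 + k ^ 2 * p j ^ 2))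
    (hL : L ≤ c₂ * s ^ 2) (hV : ∀ j, V j ≤ (9 / 8) * (a j ^ 2 + k ^ 2 * p j ^ 2))
    (hgain : 32 * c₄ ^ 2 ≤ c₃ * (ε * k)) (h1 : lam * c₂ ≤ c₃ / 2) (h2 : lam ≤ k / 18) :
    dL + ε / k ^ 2 * ∑ j, dV j ≤ -lam * (L + ε / k ^ 2 * ∑ j, V j) := by
  set U := ∑ j, (a j ^ 2 + k ^ 2 * p j ^ 2) with hU
  have hη : 0 < ε / k ^ 2 := by positivity
  have hUp : k ^ 2 * ∑ j, p j ^ 2 ≤ U := by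
    rw [hU, Finset.mul_sum]
    exact Finset.sum_le_sum fun j _ => by linarith [sq_nonneg (a j)]
  have hU0 : 0 ≤ U := Finset.sum_nonneg fun j _ => by positivity
  have hdV' : ∑ j, dV j ≤ -(k / 8) * U := by
    rw [hU, Finset.mul_sum]; exact Finset.sum_le_sum fun j _ => hdV j
  have hV' : ∑ j, V j ≤ (9 / 8) * U := by
    rw [hU, Finset.mul_sum]; exact Finset.sum_le_sum fun j _ => hV j
  have hP : (∑ j, p j) ^ 2 ≤ 4 * ∑ j, p j ^ 2 := by
    have := sq_sum_le_card_mul_sum_sq (s := (Finset.univ : Finset (Fin 4))) (f := p)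
    simpa using this
  set P := ∑ j, p j
  set Q := ∑ j, p j ^ 2
  -- Half of the load decay pays for the load side of the coupling.
  have hyoung : c₄ * s * P ≤ c₃ / 2 * s ^ 2 + c₄ ^ 2 / (2 * c₃) * P ^ 2 := by
    have : 0 ≤ (c₃ * s - c₄ * P) ^ 2 / (2 * c₃) := by positivity
    have e : (c₃ * s - c₄ * P) ^ 2 / (2 * c₃)
        = c₃ / 2 * s ^ 2 + c₄ ^ 2 / (2 * c₃) * P ^ 2 - c₄ * s * P := by field_simp; ring
    linarith
  -- The gain condition makes the cable side at most half of the cable decay. The other half, with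
  -- factor `k / 16`, matches `lam ≤ k / 18` times the factor `9/8`.
  have hQ : c₄ ^ 2 / (2 * c₃) * P ^ 2 ≤ ε / k ^ 2 * (k / 16) * U := by
    calc c₄ ^ 2 / (2 * c₃) * P ^ 2 ≤ c₄ ^ 2 / (2 * c₃) * (4 * Q) :=
          mul_le_mul_of_nonneg_left hP (by positivity)
      _ = 32 * c₄ ^ 2 * (Q / (16 * c₃)) := by field_simp; ring
      _ ≤ c₃ * (ε * k) * (Q / (16 * c₃)) := by
          refine mul_le_mul_of_nonneg_right hgain ?_
          have : 0 ≤ Q := Finset.sum_nonneg fun j _ => sq_nonneg _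
          positivity
      _ = ε / k ^ 2 * (k / 16) * (k ^ 2 * Q) := by field_simp
      _ ≤ _ := mul_le_mul_of_nonneg_left hUp (by positivity)
  have b1 := mul_le_mul_of_nonneg_left hdV' hη.le
  have b2 := mul_le_mul_of_nonneg_left hL hlam
  have b3 := mul_le_mul_of_nonneg_left (mul_le_mul_of_nonneg_left hV' hη.le) hlam
  have b4 := mul_le_mul_of_nonneg_right h1 (sq_nonneg s)
  have b5 := mul_le_mul_of_nonneg_right h2 (by positivity : 0 ≤ ε / k ^ 2 * (9 / 8 * U))
  linarith

end Comparison

/-! ### Comparison of the total Lyapunov function with the tracking error. -/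

section Stability

variable {S : Params} {D : Reference} {K : Gains} {y : Motion} {I : Set ℝ}

theorem psiR_le_errR_sq {t : ℝ} (h : y.IsState t) (h1 : psiR D y t ≤ 1) :
    psiR D y t ≤ nrm (errR D y t) ^ 2 := by
  rw [errR_sq h]; nlinarith [psiR_nonneg (D := D) h]

/-- The Lyapunov function of the whole tracking error. -/
noncomputable def totalLyap (S : Params) (D : Reference) (K : Gains) (c η : ℝ) (y : Motion)
    (t : ℝ) : ℝ := loadLyap S D c y t + η * ∑ j, cableLyap S D K y j t

/-- The cable errors stay away from the antipode of the desired direction. -/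
theorem psiQ_lt_one (hI : IsOpen I) (hIc : I.OrdConnected) (hc : IsClosedLoop S D K y I) {k : ℝ}
    (hk : 1 ≤ k) (hkω : K.kω = k) (hkq : K.kq = k ^ 2) {t₀ t : ℝ} (ht₀ : t₀ ∈ I) (ht : t ∈ I)
    (hle : t₀ ≤ t) {j : Fin 4} {ψ δ : ℝ} (hψ : psiQ S D K y j t₀ < ψ)
    (hω : nrm (errω S D K y j t₀) < δ) (hδ : δ ≤ 1) (hδψ : δ ≤ 1 - ψ) :
    psiQ S D K y j t < 1 := by
  have h := hc.cableEnergy_le hI hIc (by rw [hkω]; linarith) ht₀ ht hle j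
  rw [cableEnergy, cableEnergy, ← nrm_sq, ← nrm_sq, hkq] at h
  have h0 := nrm_nonneg (errω S D K y j t₀)
  -- The initial kinetic part is too small to lift `Ψ_q` from below `ψ` to 1, since `k² ≥ 1`.
  have h1 : nrm (errω S D K y j t₀) ^ 2 ≤ 1 - ψ := by nlinarith
  have hk2 : 1 ≤ k ^ 2 := one_le_pow₀ hk
  have h2 : (1 - ψ) ≤ k ^ 2 * (1 - ψ) := by nlinarith
  have h3 : k ^ 2 * psiQ S D K y j t₀ < k ^ 2 * ψ := mul_lt_mul_of_pos_left hψ (by linarith)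
  have h4 : k ^ 2 * psiQ S D K y j t < k ^ 2 * 1 := by
    linarith [sq_nonneg (nrm (errω S D K y j t)), mul_nonneg h0 h0, h1, h2, h3, h0,
      sq_nonneg (nrm (errω S D K y j t₀))]
  exact lt_of_mul_lt_mul_left h4 (by linarith)

theorem errNorm_sq (t : ℝ) : errNorm S D K y t ^ 2 = nrm (errX D y t) ^ 2 + nrm (errV D y t) ^ 2
    + nrm (errR D y t) ^ 2 + nrm (errΩ D y t) ^ 2
    + ∑ j, (nrm (errQ S D K y j t) ^ 2 + nrm (errω S D K y j t) ^ 2) :=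
  Real.sq_sqrt (by positivity)

/-- The Lyapunov function dominates the tracking error. -/
theorem IsClosedLoop.errNorm_sq_le (hc : IsClosedLoop S D K y I) {k c c₁ ε t : ℝ} (hk : 1 ≤ k)
    (hkω : K.kω = k) (hkq : K.kq = k ^ 2) (hc₁ : 0 < c₁) (hε : 0 < ε) (ht : t ∈ I)
    (hL : c₁ * loadErr D y t ^ 2 ≤ loadLyap S D c y t) :
    errNorm S D K y t ^ 2
      ≤ (2 / c₁ + 8 / 3 * (k ^ 2 / ε)) * totalLyap S D K c (ε / k ^ 2) y t := by
  have hst := hc.state ht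
  have hk0 : 0 < k := by linarith
  have hs := loadErr_sq (D := D) hst
  have hR := errR_sq (D := D) hst
  have hsum : ∑ j, (nrm (errQ S D K y j t) ^ 2 + nrm (errω S D K y j t) ^ 2)
      ≤ 8 / 3 * ∑ j, cableLyap S D K y j t := by
    rw [Finset.mul_sum]
    refine Finset.sum_le_sum fun j _ => ?_
    have h1 := hc.le_cableLyap ht hk0 hkω hkq j
    have h2 : nrm (errQ S D K y j t) ^ 2 ≤ k ^ 2 * nrm (errQ S D K y j t) ^ 2 :=
      le_mul_of_one_le_left (sq_nonneg _) (one_le_pow₀ hk)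
    linarith
  have hpos : 0 ≤ ∑ j, cableLyap S D K y j t := Finset.sum_nonneg fun j _ =>
    (by positivity : (0 : ℝ) ≤ _).trans (hc.le_cableLyap ht hk0 hkω hkq j)
  have hLpos : 0 ≤ loadLyap S D c y t := le_trans (by positivity) hL
  have h3 : loadErr D y t ^ 2 ≤ loadLyap S D c y t / c₁ := by
    rw [le_div_iff₀ hc₁]; linarith
  have e : (2 / c₁ + 8 / 3 * (k ^ 2 / ε)) * totalLyap S D K c (ε / k ^ 2) y t
      = 2 * (loadLyap S D c y t / c₁) + 8 / 3 * ∑ j, cableLyap S D K y j t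
        + (2 / c₁ * (ε / k ^ 2 * ∑ j, cableLyap S D K y j t)
          + 8 / 3 * (k ^ 2 / ε) * loadLyap S D c y t) := by
    rw [totalLyap]; field_simp; ring
  have h4 : 0 ≤ 2 / c₁ * (ε / k ^ 2 * ∑ j, cableLyap S D K y j t)
      + 8 / 3 * (k ^ 2 / ε) * loadLyap S D c y t := by positivity
  rw [e, errNorm_sq, hR]
  have h5 := psiR_nonneg (D := D) hst
  nlinarith [sq_nonneg (psiR D y t), sq_nonneg (nrm (errX D y t)), sq_nonneg (nrm (errV D y t)),
    sq_nonneg (nrm (errΩ D y t))]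

/-- The weight `ε / k²` compensates the factor `k²` in front of `‖e_q‖²`, so the bound does not
depend on the gain. -/
theorem IsClosedLoop.sum_cableLyap_le (hc : IsClosedLoop S D K y I) {k ε t : ℝ} (hk : 1 ≤ k)
    (hkω : K.kω = k) (hkq : K.kq = k ^ 2) (hε : 0 < ε) (ht : t ∈ I)
    (hψ : ∀ j, psiQ S D K y j t ≤ 1) :
    ε / k ^ 2 * ∑ j, cableLyap S D K y j t
      ≤ 9 / 8 * ε * ∑ j, (nrm (errQ S D K y j t) ^ 2 + nrm (errω S D K y j t) ^ 2) := by
  have hk0 : 0 < k := by linarith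
  rw [Finset.mul_sum, Finset.mul_sum]
  refine Finset.sum_le_sum fun j _ => ?_
  have h1 := mul_le_mul_of_nonneg_left (hc.cableLyap_le ht hk0 hkω hkq (hψ j))
    (by positivity : 0 ≤ ε / k ^ 2)
  have h2 : ε / k ^ 2 * nrm (errω S D K y j t) ^ 2 ≤ ε * nrm (errω S D K y j t) ^ 2 :=
    mul_le_mul_of_nonneg_right (div_le_self hε.le (one_le_pow₀ hk)) (sq_nonneg _)
  have h3 : ε / k ^ 2 * (k ^ 2 * nrm (errQ S D K y j t) ^ 2) = ε * nrm (errQ S D K y j t) ^ 2 := by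
    field_simp
  linarith

/-- The tracking error dominates the Lyapunov function. -/
theorem IsClosedLoop.totalLyap_le (hc : IsClosedLoop S D K y I) {k c c₂ ε t : ℝ} (hk : 1 ≤ k)
    (hkω : K.kω = k) (hkq : K.kq = k ^ 2) (hc₂ : 0 < c₂) (hε : 0 < ε) (ht : t ∈ I)
    (hψ : ∀ j, psiQ S D K y j t ≤ 1) (hψR : psiR D y t ≤ 1)
    (hL : loadLyap S D c y t ≤ c₂ * loadErr D y t ^ 2) :
    totalLyap S D K c (ε / k ^ 2) y t ≤ (c₂ + 9 / 8 * ε) * errNorm S D K y t ^ 2 := by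
  have hst := hc.state ht
  have a1 := hc.sum_cableLyap_le hk hkω hkq hε ht hψ
  rw [totalLyap, errNorm_sq]
  rw [loadErr_sq hst] at hL
  have a3 : c₂ * psiR D y t ≤ c₂ * nrm (errR D y t) ^ 2 :=
    mul_le_mul_of_nonneg_left (psiR_le_errR_sq hst hψR) hc₂.le
  have a4 : 0 ≤ ∑ j, (nrm (errQ S D K y j t) ^ 2 + nrm (errω S D K y j t) ^ 2) :=
    Finset.sum_nonneg fun j _ => by positivity
  have a5 : 0 ≤ 9 / 8 * ε * (nrm (errX D y t) ^ 2 + nrm (errV D y t) ^ 2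
    + nrm (errR D y t) ^ 2 + nrm (errΩ D y t) ^ 2) := by positivity
  have a6 := mul_nonneg hc₂.le a4
  linarith

end Stability

/-! ### Choice of levels and gains, and the stability proof. -/

section Main

variable {S : Params} {D : Reference}

/-- Exponential stability under unit load gains and high cable gains, in terms of a Lyapunov
function of the load errors. -/
theorem zeroIsExpStable_of_loadLyap {r B c c₁ c₂ c₃ c₄ : ℝ} (hr1 : r ≤ 1)
    (hc₁ : 0 < c₁) (hc₂ : 0 < c₂) (hc₃ : 0 < c₃)
    (hω : ∀ K y t, InTube S D r K y t → ∀ j, nrm (desω S D K y j t) ≤ B)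
    (hL : ∀ (y : Motion) (t : ℝ), y.IsState t → c₁ * loadErr D y t ^ 2 ≤ loadLyap S D c y t ∧
      loadLyap S D c y t ≤ c₂ * loadErr D y t ^ 2)
    (hLd : ∀ K y I t, IsOpen I → t ∈ I → IsClosedLoop S D K y I →
      DifferentiableAt ℝ (loadLyap S D c y) t)
    (hLr : ∀ K y t, InTube S D 1 K y t → deriv (loadLyap S D c y) t
      ≤ -c₃ * loadErr D y t ^ 2 + c₄ * loadErr D y t * ∑ j, nrm (errQ S D K y j t))
    {ψq : Fin 4 → ℝ} (hψq : ∀ j, ψq j < 1) {ψR eMax ϱ ε k : ℝ} (hψR : ψR < 1) (hϱ : 0 < ϱ)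
    (hϱr : ϱ ≤ r) (hϱe : ϱ < eMax) (hϱR : ϱ < ψR) (hε : 0 < ε) (hερ : 36 * ε = c₁ * ϱ ^ 2)
    (hk : 1 ≤ k) (hkB : B ≤ k) (hgain : 32 * c₄ ^ 2 ≤ c₃ * (ε * k)) :
    ZeroIsExpStable S D ⟨1, 1, 1, 1, k ^ 2, k⟩ ψq ψR eMax := by
  have hk0 : 0 < k := by linarith
  obtain ⟨j₀, hj₀⟩ := Finite.exists_max ψq
  set K : Gains := ⟨1, 1, 1, 1, k ^ 2, k⟩ with hK
  have hunit : K.UnitLoad := ⟨rfl, rfl, rfl, rfl⟩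
  set ρ := c₁ * ϱ ^ 2 with hρ
  have hρ0 : 0 < ρ := by positivity
  set lam := min (c₃ / (2 * c₂)) (k / 18) with hlam
  have hlam0 : 0 < lam := by positivity
  set C₁ := 2 / c₁ + 8 / 3 * (k ^ 2 / ε) with hC₁
  set C₂ := c₂ + 9 / 8 * ε with hC₂
  have hC : 0 < C₁ * C₂ := by positivity
  have hψ₀ : 0 < 1 - ψq j₀ := by linarith [hψq j₀]
  refine ⟨min 1 (min (1 - ψq j₀) (ρ / (16 * c₂))), Real.sqrt (C₁ * C₂), lam / 2, by positivity,
    Real.sqrt_pos.2 hC, by positivity, ?_⟩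
  intro y I hI hIc hcl t₀ ht₀ h0 hQ₀ hR₀ hx₀ hv₀ hr₀ hΩ₀ hω₀ t ht hle
  set δ := min 1 (min (1 - ψq j₀) (ρ / (16 * c₂))) with hδ
  have hδ0 : 0 < δ := by positivity
  have hδ1 : δ ≤ 1 := min_le_left _ _
  have hδψ : ∀ j, δ ≤ 1 - ψq j := fun j =>
    ((min_le_right _ _).trans (min_le_left _ _)).trans (by linarith [hj₀ j])
  have hδρ : c₂ * (16 * δ) ≤ ρ := by
    have : δ ≤ ρ / (16 * c₂) := (min_le_right _ _).trans (min_le_right _ _)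
    rw [le_div_iff₀ (by positivity)] at this
    linarith
  have hsub : Set.Icc t₀ t ⊆ I := hIc.out ht₀ ht
  have hQ : ∀ s ∈ Set.Icc t₀ t, ∀ j, psiQ S D K y j s < 1 := fun s hs j =>
    psiQ_lt_one hI hIc hcl hk rfl rfl ht₀ (hsub hs) hs.1 (hQ₀ j) (hω₀ j) hδ1 (hδψ j)
  set W := totalLyap S D K c (ε / k ^ 2) y with hW
  have hst₀ := hcl.state ht₀
  have ht₀' : t₀ ∈ Set.Icc t₀ t := Set.left_mem_Icc.2 hle
  have hψR₀ := psiR_le_errR_sq (D := D) hst₀ (by linarith)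
  have hWle : ∀ s ∈ Set.Icc t₀ t, loadLyap S D c y s ≤ W s := fun s hs => by
    have : 0 ≤ ε / k ^ 2 * ∑ j, cableLyap S D K y j s :=
      mul_nonneg (by positivity) (Finset.sum_nonneg fun j _ =>
        (by positivity : (0 : ℝ) ≤ _).trans (hcl.le_cableLyap (hsub hs) hk0 rfl rfl j))
    rw [hW, totalLyap]; linarith
  have hsq : ∀ v : V3, nrm v < δ → nrm v ^ 2 ≤ δ := fun v hv =>
    (pow_le_pow_left₀ (nrm_nonneg v) hv.le 2).trans (by
      rw [sq]; exact mul_le_of_le_one_left hδ0.le hδ1)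
  -- The cables contribute at most `9 ε = ρ / 4`, even for direction errors that are not small; the
  -- load contributes at most `4 c₂ δ ≤ ρ / 4`.
  have hW₀ : W t₀ < ρ := by
    have h1 := hcl.sum_cableLyap_le hk rfl rfl hε ht₀ fun j => (hQ t₀ ht₀' j).le
    have h2 : ∑ j, (nrm (errQ S D K y j t₀) ^ 2 + nrm (errω S D K y j t₀) ^ 2)
        ≤ ∑ _j : Fin 4, (2 : ℝ) := Finset.sum_le_sum fun j _ => by
      have a1 := hcl.errQ_sq_le_one ht₀ j
      have a2 := hsq _ (hω₀ j)
      linarith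
    rw [Finset.sum_const, Finset.card_univ, Fintype.card_fin, nsmul_eq_mul] at h2
    have h3 := mul_le_mul_of_nonneg_left h2 (by positivity : 0 ≤ 9 / 8 * ε)
    have h4 : loadErr D y t₀ ^ 2 ≤ 4 * δ := by
      rw [loadErr_sq hst₀]
      linarith [hsq _ hx₀, hsq _ hv₀, hsq _ hr₀, hsq _ hΩ₀]
    have h5 := (hL y t₀ hst₀).2
    have h6 := mul_le_mul_of_nonneg_left h4 hc₂.le
    rw [hW, totalLyap]
    push_cast at h3
    linarith
  have htube : ∀ s ∈ Set.Icc t₀ t, loadLyap S D c y s ≤ ρ → loadErr D y s ≤ ϱ := by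
    intro s hs hLs
    have h1 := (hL y s (hcl.state (hsub hs))).1.trans hLs
    exact (abs_le_of_sq_le_sq' (le_of_mul_le_mul_left h1 hc₁) hϱ.le).2
  have hWd : ∀ s ∈ Set.Icc t₀ t, ∀ j, DifferentiableAt ℝ (cableLyap S D K y j) s :=
    fun s hs j => ((hcl.hasDerivAt_cableEnergy hI (hsub hs) j).add
      ((hasDerivAt_dot (hcl.hasDerivAt_errQ hI (hsub hs) j)
        (hcl.hasDerivAt_errω (hsub hs) j)).const_mul (K.kω / 4))).differentiableAt
  have hWder : ∀ s ∈ Set.Icc t₀ t, HasDerivAt W (deriv (loadLyap S D c y) s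
      + ε / k ^ 2 * ∑ j, deriv (cableLyap S D K y j) s) s := fun s hs =>
    (hLd K y I s hI (hsub hs) hcl).hasDerivAt.add
      ((HasDerivAt.fun_sum fun j _ => (hWd s hs j).hasDerivAt).const_mul (ε / k ^ 2))
  have hrate : ∀ s ∈ Set.Icc t₀ t, loadLyap S D c y s ≤ ρ → deriv W s ≤ -lam * W s := by
    intro s hs hLs
    have hsm := htube s hs hLs
    have hin : InTube S D r K y s :=
      ⟨h0.trans hs.1, hunit, ⟨I, hI, hsub hs, hcl⟩, hsm.trans hϱr⟩
    have hin1 : InTube S D 1 K y s := ⟨hin.nonneg, hunit, hin.closed, hin.small.trans hr1⟩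
    rw [(hWder s hs).deriv]
    refine composite_rate_le hc₃ hε hk0 hlam0.le (hLr K y s hin1)
      (fun j => ?_) (hL y s (hcl.state (hsub hs))).2
      (fun j => hcl.cableLyap_le (hsub hs) hk0 rfl rfl (hQ s hs j).le) hgain ?_ (min_le_right _ _)
    · obtain ⟨d, hd, hdle⟩ := hcl.hasDerivAt_cableLyap hI (hsub hs) hk0 rfl rfl
        ((hω K y s hin j).trans hkB)
      rw [hd.deriv]; exact hdle
    · calc lam * c₂ ≤ c₃ / (2 * c₂) * c₂ := mul_le_mul_of_nonneg_right (min_le_left _ _) hc₂.le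
        _ = c₃ / 2 := by field_simp
  have hdecay : ∀ s ∈ Set.Icc t₀ t, (∀ s' ∈ Set.Icc t₀ s, loadLyap S D c y s' ≤ ρ) →
      W s ≤ Real.exp (-lam * (s - t₀)) * W t₀ := fun s hs hall =>
    le_exp_mul_of_deriv_le hs.1
      (fun s' hs' => (hWder s' ⟨hs'.1, hs'.2.trans hs.2⟩).differentiableAt)
      (fun s' hs' => hrate s' ⟨hs'.1, hs'.2.trans hs.2⟩ (hall s' hs'))
  have hW₀' : 0 ≤ W t₀ :=
    le_trans ((by positivity : 0 ≤ c₁ * loadErr D y t₀ ^ 2).trans (hL y t₀ hst₀).1)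
      (hWle t₀ ht₀')
  -- Bootstrap: while the load function is at most `ρ`, the motion is in the tube and `W` decays, so
  -- the load function stays below `W t₀ < ρ`.
  have hexit : ∀ s ∈ Set.Icc t₀ t, loadLyap S D c y s < ρ := by
    refine lt_of_first_exit
      (fun s hs => (hLd K y I s hI (hsub hs) hcl).continuousAt.continuousWithinAt)
      ((hWle t₀ ht₀').trans_lt hW₀) fun s hs hall => ?_
    have h1 := hdecay s hs hall
    have h2 : Real.exp (-lam * (s - t₀)) ≤ 1 :=
      Real.exp_le_one_iff.2 (by
      rw [neg_mul]; exact neg_nonpos.2 (mul_nonneg hlam0.le (sub_nonneg.2 hs.1)))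
    calc _ ≤ W s := hWle s hs
      _ ≤ 1 * W t₀ := h1.trans (mul_le_mul_of_nonneg_right h2 hW₀')
      _ < ρ := by rwa [one_mul]
  have htt : t ∈ Set.Icc t₀ t := Set.right_mem_Icc.2 hle
  have hst := hcl.state ht
  have hsmall := htube t htt (hexit t htt).le
  refine ⟨?_, (nrm_errX_le_loadErr hst).trans_lt (hsmall.trans_lt hϱe), ?_, hQ t htt⟩
  · have h1 := hdecay t htt fun s hs => (hexit s hs).le
    have h2 := hcl.errNorm_sq_le hk rfl rfl hc₁ hε ht (hL y t hst).1
    have h3 : W t₀ ≤ C₂ * errNorm S D K y t₀ ^ 2 :=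
      hcl.totalLyap_le hk rfl rfl hc₂ hε ht₀ (fun j => (hQ t₀ ht₀' j).le) (by linarith)
        (hL y t₀ hst₀).2
    -- `W` is quadratic in the error, hence the error decays at half the rate of `W`.
    have hexp : Real.exp (-lam * (t - t₀)) = Real.exp (-(lam / 2) * (t - t₀)) ^ 2 := by
      rw [← Real.exp_nat_mul]; congr 1; push_cast; ring
    have hC₁0 : 0 ≤ C₁ := by positivity
    refine (abs_le_of_sq_le_sq' ?_ ?_).2
    · calc errNorm S D K y t ^ 2 ≤ C₁ * W t := h2
        _ ≤ C₁ * (Real.exp (-lam * (t - t₀)) * (C₂ * errNorm S D K y t₀ ^ 2)) :=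
          mul_le_mul_of_nonneg_left (h1.trans
            (mul_le_mul_of_nonneg_left h3 (Real.exp_nonneg _))) hC₁0
        _ = _ := by rw [mul_pow, mul_pow, Real.sq_sqrt hC.le, hexp]; ring
    · have : 0 ≤ errNorm S D K y t₀ := Real.sqrt_nonneg _
      positivity
  · exact (psiR_le_loadErr_sq hst).trans_lt ((pow_le_of_le_one (loadErr_nonneg D y t)
      (hsmall.trans (hϱr.trans hr1)) two_ne_zero).trans_lt (hsmall.trans_lt hϱR))

end Main
end LoadTransport

theorem theorem1 (S : Params) (hrank : 6 ≤ S.grasp.rank)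
    (D : Reference) (hbdd : D.IsBounded) (htaut : D.IsTaut S) :
    ∃ α₀ : ℝ, 0 < α₀ ∧
      ∀ ψq : Fin 4 → ℝ,
        (∀ j, 0 < ψq j ∧ ψq j < 1 ∧ Real.sqrt (ψq j * (2 - ψq j)) < α₀) →
      ∀ ψR eMax : ℝ, 0 < ψR → ψR < 1 → 0 < eMax →
        ∃ K : Gains, K.Positive ∧
          ZeroIsEquilibrium S D K ∧ ZeroIsExpStable S D K ψq ψR eMax := by
  obtain ⟨r, B, hr, hr1, -, hω⟩ := exists_nrm_desω_le hrank hbdd htaut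
  obtain ⟨c, c₁, c₂, c₃, c₄, hc₁, hc₂, hc₃, hc₄, hL, hLd, hLr⟩ := exists_loadLyap hrank hbdd
  -- High cable gains tolerate every initial cable error in the hemisphere of the desired direction.
  refine ⟨1, one_pos, fun ψq hψq ψR eMax hψR hψR1 heMax => ?_⟩
  -- The radius of load errors to be preserved: inside the tube where `ω̃_j` is bounded, and
  -- strictly inside both prescribed limits.
  have hϱ : 0 < min r (min (eMax / 2) (ψR / 2)) := by positivity
  have hϱe : min r (min (eMax / 2) (ψR / 2)) < eMax :=
    ((min_le_right _ _).trans (min_le_left _ _)).trans_lt (by linarith)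
  have hϱR : min r (min (eMax / 2) (ψR / 2)) < ψR :=
    ((min_le_right _ _).trans (min_le_right _ _)).trans_lt (by linarith)
  have hϱr : min r (min (eMax / 2) (ψR / 2)) ≤ r := min_le_left _ _
  generalize min r (min (eMax / 2) (ψR / 2)) = ϱ at hϱ hϱe hϱR hϱr
  have hε : 0 < c₁ * ϱ ^ 2 / 36 := by positivity
  generalize hεd : c₁ * ϱ ^ 2 / 36 = ε at hε
  -- The gain dominates 1, the bound on `ω̃_j` and the coupling. It can be chosen last because `B`
  -- and the `c_i` hold for all cable gains.
  have hk : 1 ≤ max 1 (max B (32 * c₄ ^ 2 / (c₃ * ε))) := le_max_left _ _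
  have hkB : B ≤ max 1 (max B (32 * c₄ ^ 2 / (c₃ * ε))) :=
    (le_max_left _ _).trans (le_max_right _ _)
  have hkg : 32 * c₄ ^ 2 / (c₃ * ε) ≤ max 1 (max B (32 * c₄ ^ 2 / (c₃ * ε))) :=
    (le_max_right _ _).trans (le_max_right _ _)
  generalize max 1 (max B (32 * c₄ ^ 2 / (c₃ * ε))) = k at hk hkB hkg
  rw [div_le_iff₀ (by positivity)] at hkg
  refine ⟨⟨1, 1, 1, 1, k ^ 2, k⟩, ⟨one_pos, one_pos, one_pos, one_pos, by positivity,
    by positivity⟩, zeroIsEquilibrium hrank htaut _, ?_⟩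
  exact zeroIsExpStable_of_loadLyap hr1 hc₁ hc₂ hc₃ hω hL hLd hLr (fun j => (hψq j).2.1) hψR1 hϱ
    hϱr hϱe hϱR hε (by rw [← hεd]; ring) hk hkB (by linarith)
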